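/- **Setting.** Let $V\in C^2(\mathbb R)$ with $0<c_1\le V''\le c_2$, let $\beta>0$, and put $G(\beta,\tau)=\log\int_{\mathbb R} e^{-\beta V(r)+\beta\tau r}\,dr$, $F(\beta,\rho)=\sup_{\tau}\{\tau\rho-\beta^{-1}G(\beta,\tau)\}$, $\tau_\beta(\rho)=\partial_\rho F(\beta,\rho)$, and $U(\beta,\tau)=\mathbb E_{\lambda_{\beta,0,\tau}}[p^2/2+V(r)]$, where $\lambda_{\beta,0,\tau}(dr,dp)=e^{-\beta p^2/2-\beta V(r)+\beta\tau r-G(\beta,\tau)}\,dr\,dp/\sqrt{2\pi\beta^{-1}}$. Let $\bar\tau\in C^1(\mathbb R)$ with $\bar\tau(0)=\tau_0$ and $\bar\tau(t)=\tau_1$ for all $t\ge t_1$. For each $N$ let $(r_i(t),p_i(t))_{1\le i\le N}$ be a continuous Markovian diffusion (a solution of the martingale problem) with generator $NL_N^{\bar\tau(t)}+N\sigma(S_N+\tilde S_N)$, where, with $p_0=0$, $$L_N^{\tau}=\sum_{i=1}^N(p_i-p_{i-1})\partial_{r_i}+\sum_{i=1}^{N-1}(V'(r_{i+1})-V'(r_i))\partial_{p_i}+(\tau-V'(r_N))\partial_{p_N},$$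 $S_N=-\sum_{i=1}^{N-1}D_i^*D_i$, $\tilde S_N=-\sum_{i=1}^{N-1}\tilde D_i^*\tilde D_i$, $D_i=\partial_{p_{i+1}}-\partial_{p_i}$, $D_i^*=p_{i+1}-p_i-\beta^{-1}D_i$, $\tilde D_i=\partial_{r_{i+1}}-\partial_{r_i}$, $\tilde D_i^*=V'(r_{i+1})-V'(r_i)-\beta^{-1}\tilde D_i$, and $\sigma=\sigma(N)>0$ satisfies $\sigma/N\to0$, $N/\sigma^2\to0$. Let $l=l(N)\ge1$ be integers with $l/\sigma\to0$, $N\sigma/l^3\to0$, let $\hat u_{l,i}=\frac1l\sum_{|j|<l}\frac{l-|j|}{l}(r_{i-j},p_{i-j})$, and let $\hat u_N(t,x)=(r_N,p_N)(t,x)$ be equal to $\hat u_{l,i}(t)$ for $|x-i/N|<1/(2N)$, $l\le i\le N-l+1$, and to $0$ otherwise. Put $$E_N=\frac1N\sum_{i=1}^N\Big(\frac{p_i^2}2+V(r_i)\Big),\qquad W_N(t)=\int_0^t\bar\tau(s)p_N(s)\,ds ,$$ $$\bar Q_N(t)=-\sigma\int_0^t\sum_{i=1}^{N-1}\Big[(p_{i+1}-p_i)^2-2\beta^{-1}+(V'(r_{i+1})-V'(r_i))^2-\beta^{-1}(V''(r_{i+1})+V''(r_i))\Big]ds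 ,$$ where in $W_N$, $p_N(s)$ is the momentum of the last particle; $\bar Q_N$ is the heat exchanged with the thermostats, up to a martingale of mean zero. Let $(\tilde r,\tilde p)(t,x)$, $t\ge0$, $x\in[0,1]$, be a random field, square integrable on $\tilde\Omega\times[0,T]\times[0,1]$ for each $T$, that is a limit in law, along a subsequence of $N$, of the empirical measures $\frac1N\sum_i\delta_{i/N}(dx)\,(r_i(t),p_i(t))\,dt$. **Assumptions.** (A) Energy convergence, along the subsequence: $E_N(0)$ is integrable and $\mathbb E[E_N(0)]\to U(\beta,\tau_0)$; $$\mathbb E\Big[E_N(t)-\int_0^1\Big(\tfrac12p_N(t,x)^2+U(\beta,\tau_\beta(r_N(t,x)))\Big)dx\Big]\to0$$ weakly in $t$ (against continuous compactly supported functions of $t\in[0,\infty)$); and $\int_0^1\!\int_0^\infty\psi\,\mathbb E[f(\hat u_N)]\,dt\,dx\to\int_0^1\!\int_0^\infty\psi\,\mathbb E[f(\tilde r,\tilde p)]\,dt\,dx$ for all continuous compactly supported $\psi(t,x)$ and all continuous $f$ with $|f(y)|\le C(1+|y|^2)$. (B) Initial equilibrium: $\mathbb E[\frac1N\sum_ir_i(0)]\to\tau_\beta^{-1}(\tau_0)$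 along the subsequence, and almost surely $\tilde r(0,x)=\tau_\beta^{-1}(\tau_0)$, $\tilde p(0,x)=0$ for a.e. $x\in[0,1]$. (C) Almost surely $(\tilde r,\tilde p)$ is a vanishing viscosity solution: the limit, in $L^1([0,T]\times[0,1])$ for every $T$ and for some sequence $\delta_1,\delta_2>0$ tending to $0$, of strong solutions of $\partial_tr-\partial_xp=\delta_1\partial_{xx}\tau_\beta(r)$, $\partial_tp-\partial_x\tau_\beta(r)=\delta_2\partial_{xx}p$ with $p(t,0)=0$, $\tau_\beta(r(t,1))=\bar\tau(t)$, $\partial_xp(t,1)=0$, $\partial_xr(t,0)=0$, whose initial data converge in $L^2(0,1)$ to $(\tilde r,\tilde p)(0,\cdot)$. (D) Almost surely $(\tilde r,\tilde p)$ reaches equilibrium: for a.e. $x\in[0,1]$, $\tau_\beta(\tilde r(t,x))\to\tau_1$ and $\tilde p(t,x)\to0$ as $t\to\infty$, and for some $T$ the functions $\tilde r(t,\cdot)^2,\tilde p(t,\cdot)^2$, $t\ge T$, are uniformly integrable on $[0,1]$. (E) Almost surely $\mathcal L(t)=\int_0^1\tilde r(t,y)\,dy$ is well defined for all $t\ge0$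 and is of bounded variation on bounded time intervals. **Theorem.** Define, for each realization of $(\tilde r,\tilde p)$, $$W(t)=\int_0^t\bar\tau(s)\,d\mathcal L(s),\qquad Q(t)=\int_0^1\Big(\tfrac12\tilde p(t,x)^2+U(\beta,\tau_\beta(\tilde r(t,x)))-U(\beta,\tau_0)\Big)dx-W(t),$$ the first being a Riemann–Stieltjes integral. Then: 1. For all $N\ge1$, $t\ge0$, the variables $E_N(t),W_N(t),\bar Q_N(t)$ are integrable and $\mathbb E[E_N(t)]-\mathbb E[E_N(0)]=\mathbb E[W_N(t)]+\mathbb E[\bar Q_N(t)]$. 2. $W(t)$ and $Q(t)$ have finite expectation for a.e. $t$, and along the subsequence $\mathbb E[W_N(t)]\to\mathbb E[W(t)]$ and $\mathbb E[\bar Q_N(t)]\to\mathbb E[Q(t)]$ weakly in $t$. 3. Almost surely $W(t)$ exists for all $t\ge0$, the limits $W=\lim_{t\to\infty}W(t)$ and $Q=\lim_{t\to\infty}Q(t)$ exist and are finite, and the first law $$U(\beta,\tau_1)-U(\beta,\tau_0)=W+Q$$ and the Clausius inequality $$F(\beta,\tau_\beta^{-1}(\tau_1))-F(\beta,\tau_\beta^{-1}(\tau_0))\le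 W$$ hold. -/

import Mathlib

open MeasureTheory ProbabilityTheory Filter Topology Set
open scoped ENNReal NNReal

noncomputable section

namespace AnharmonicChain

/-! ### Equilibrium thermodynamics of the one-particle Gibbs measures -/

/-- Canonical Gibbs function `G(β, τ) = log ∫ exp (-β V(r) + β τ r) dr`. -/
def gibbsG (V : ℝ → ℝ) (β τ : ℝ) : ℝ :=
  Real.log (∫ r : ℝ, Real.exp (-β * V r + β * τ * r))

/-- Free energy `F(β, ρ) = sup_τ (τ ρ - β⁻¹ G(β, τ))`. -/
def freeEnergy (V : ℝ → ℝ) (β ρ : ℝ) : ℝ :=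
  ⨆ τ : ℝ, (τ * ρ - β⁻¹ * gibbsG V β τ)

/-- Equilibrium tension `τ_β(ρ) = ∂_ρ F(β, ρ)`. -/
def tension (V : ℝ → ℝ) (β ρ : ℝ) : ℝ :=
  deriv (freeEnergy V β) ρ

/-- The inverse function `τ_β⁻¹` of the equilibrium tension (a bijection of the real line when
`V''` lies between two positive constants). -/
def tensionInv (V : ℝ → ℝ) (β τ : ℝ) : ℝ :=
  Function.invFun (tension V β) τ

/-- The one-particle Gibbs measure `λ_{β, pbar, τ}(dr, dp)` on `ℝ²`, points being written
`(r, p)`. -/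
def gibbsMeasure (V : ℝ → ℝ) (β pbar τ : ℝ) : Measure (ℝ × ℝ) :=
  volume.withDensity fun z =>
    ENNReal.ofReal
      (Real.exp (-(β / 2) * (z.2 - pbar) ^ 2 - β * V z.1 + β * τ * z.1 - gibbsG V β τ) /
        Real.sqrt (2 * Real.pi * β⁻¹))

/-- Internal energy `U(β, τ)`, the mean of `p²/2 + V(r)` under `λ_{β, 0, τ}`. -/
def internalEnergy (V : ℝ → ℝ) (β τ : ℝ) : ℝ :=
  ∫ z, (z.2 ^ 2 / 2 + V z.1) ∂(gibbsMeasure V β 0 τ)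

/-! ### The microscopic dynamics -/

/-- Phase space of the chain: `(r, p)` with `r = (r_1, …, r_N)` and `p = (p_1, …, p_N)`. -/
abbrev Phase (N : ℕ) : Type := (Fin N → ℝ) × (Fin N → ℝ)

/-- The entry number `k` of a vector indexed by `1, …, N`; it is `0` for other `k`, which
incorporates the convention `p_0 = 0`. -/
def site {N : ℕ} (q : Fin N → ℝ) (k : ℕ) : ℝ :=
  if h : 1 ≤ k ∧ k ≤ N then q ⟨k - 1, by omega⟩ else 0

/-- The direction of the coordinate `r_k`. -/
def dirR (N k : ℕ) : Phase N := (fun j => if (j : ℕ) + 1 = k then 1 else 0, 0)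

/-- The direction of the coordinate `p_k`. -/
def dirP (N k : ℕ) : Phase N := (0, fun j => if (j : ℕ) + 1 = k then 1 else 0)

/-- The directional derivative of `f` along the fixed vector `v`. -/
def dirDeriv {N : ℕ} (v : Phase N) (f : Phase N → ℝ) (z : Phase N) : ℝ := fderiv ℝ f z v

/-- Liouville operator with tension `τ` applied to the last particle. -/
def liouville (V : ℝ → ℝ) (N : ℕ) (τ : ℝ) (f : Phase N → ℝ) (z : Phase N) : ℝ :=
  (∑ i ∈ Finset.Icc 1 N, (site z.2 i - site z.2 (i - 1)) * dirDeriv (dirR N i) f z) +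
  (∑ i ∈ Finset.Ico 1 N,
    (deriv V (site z.1 (i + 1)) - deriv V (site z.1 i)) * dirDeriv (dirP N i) f z) +
  (τ - deriv V (site z.1 N)) * dirDeriv (dirP N N) f z

/-- `D_i = ∂_{p_{i+1}} - ∂_{p_i}`. -/
def opD {N : ℕ} (i : ℕ) (f : Phase N → ℝ) : Phase N → ℝ :=
  dirDeriv (dirP N (i + 1) - dirP N i) f

/-- `D_i^* = p_{i+1} - p_i - β⁻¹ D_i`. -/
def opDstar {N : ℕ} (β : ℝ) (i : ℕ) (f : Phase N → ℝ) (z : Phase N) : ℝ :=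
  (site z.2 (i + 1) - site z.2 i) * f z - β⁻¹ * opD i f z

/-- `D~_i = ∂_{r_{i+1}} - ∂_{r_i}`. -/
def opDt {N : ℕ} (i : ℕ) (f : Phase N → ℝ) : Phase N → ℝ :=
  dirDeriv (dirR N (i + 1) - dirR N i) f

/-- `D~_i^* = V'(r_{i+1}) - V'(r_i) - β⁻¹ D~_i`. -/
def opDtstar {N : ℕ} (V : ℝ → ℝ) (β : ℝ) (i : ℕ) (f : Phase N → ℝ) (z : Phase N) : ℝ :=
  (deriv V (site z.1 (i + 1)) - deriv V (site z.1 i)) * f z - β⁻¹ * opDt i f z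

/-- `S_N = - ∑_{i=1}^{N-1} D_i^* D_i`. -/
def opS (β : ℝ) (N : ℕ) (f : Phase N → ℝ) (z : Phase N) : ℝ :=
  -∑ i ∈ Finset.Ico 1 N, opDstar β i (opD i f) z

/-- `S~_N = - ∑_{i=1}^{N-1} D~_i^* D~_i`. -/
def opSt (V : ℝ → ℝ) (β : ℝ) (N : ℕ) (f : Phase N → ℝ) (z : Phase N) : ℝ :=
  -∑ i ∈ Finset.Ico 1 N, opDtstar V β i (opDt i f) z

/-- The full generator `N L_N^τ + N σ (S_N + S~_N)`, in macroscopic time. -/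
def generator (V : ℝ → ℝ) (β σ : ℝ) (N : ℕ) (τ : ℝ) (f : Phase N → ℝ) (z : Phase N) : ℝ :=
  N * liouville V N τ f z + N * σ * (opS β N f z + opSt V β N f z)

/-- `X` is a continuous process whose law is that of the chain of `N` particles driven by the time
dependent tension `τbar`: it solves the martingale problem of the generator (equivalently, it is
a weak solution of the corresponding system of stochastic differential equations). The initial
law is not prescribed. -/
structure IsChain {Ω : Type*} [mΩ : MeasurableSpace Ω] (P : Measure Ω) (V : ℝ → ℝ) (β σ : ℝ)
    (τbar : ℝ → ℝ) (N : ℕ) (X : ℝ≥0 → Ω → Phase N) : Prop where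
  continuous_paths : ∀ ω, Continuous fun t => X t ω
  martingale_problem : ∃ ℱ : Filtration ℝ≥0 mΩ, (∀ t, Measurable[ℱ t] (X t)) ∧
    ∀ f : Phase N → ℝ, ContDiff ℝ 2 f → HasCompactSupport f →
      Martingale (fun (t : ℝ≥0) (ω : Ω) => f (X t ω) -
        ∫ s in (0 : ℝ)..(t : ℝ), generator V β σ N (τbar s) f (X s.toNNReal ω)) ℱ P

/-- Energy per particle `E_N = N⁻¹ ∑ (p_i²/2 + V(r_i))`. -/
def energy (V : ℝ → ℝ) (N : ℕ) (z : Phase N) : ℝ :=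
  (1 / (N : ℝ)) * ∑ i ∈ Finset.Icc 1 N, (site z.2 i ^ 2 / 2 + V (site z.1 i))

/-- Length per particle `N⁻¹ ∑ r_i = q_N / N`. -/
def meanLength (N : ℕ) (z : Phase N) : ℝ :=
  (1 / (N : ℝ)) * ∑ i ∈ Finset.Icc 1 N, site z.1 i

/-- Microscopic work `W_N(t) = ∫_0^t τbar(s) p_N(s) ds` along a path `x` of the chain. -/
def microWork (τbar : ℝ → ℝ) (N : ℕ) (x : ℝ≥0 → Phase N) (t : ℝ) : ℝ :=
  ∫ s in (0 : ℝ)..t, τbar s * site (x s.toNNReal).2 N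

/-- The bounded variation part of the microscopic heat `Q_N(t)` exchanged with the stochastic
thermostats along a path `x`: the time integral of `N σ (S_N + S~_N) E_N`. The heat itself is the
sum of this and of a martingale with mean zero, so that both have the same expectation. -/
def microHeat (V : ℝ → ℝ) (β σ : ℝ) (N : ℕ) (x : ℝ≥0 → Phase N) (t : ℝ) : ℝ :=
  -σ * ∫ s in (0 : ℝ)..t, ∑ i ∈ Finset.Ico 1 N,
    let z := x s.toNNReal
    (((site z.2 (i + 1) - site z.2 i) ^ 2 - 2 * β⁻¹) +
      ((deriv V (site z.1 (i + 1)) - deriv V (site z.1 i)) ^ 2 -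
        β⁻¹ * (deriv (deriv V) (site z.1 (i + 1)) + deriv (deriv V) (site z.1 i))))

/-! ### Empirical profiles and their limits -/

/-- The weighted block average `l⁻¹ ∑_{|j| < l} ((l - |j|) / l) q_{i-j}`. -/
def blockAvg {N : ℕ} (l : ℕ) (q : Fin N → ℝ) (i : ℕ) : ℝ :=
  (1 / (l : ℝ)) * ∑ j ∈ Finset.Ioo (-(l : ℤ)) (l : ℤ),
    ((l : ℝ) - |(j : ℝ)|) / l * site q ((i : ℤ) - j).toNat

/-- The block-averaged empirical profile
`∑_{i=l}^{N-l+1} 1_{N,i}(x) q̂_{l,i}`, with `1_{N,i}` the indicator function of the ball of centre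
`i/N` and diameter `1/N`. -/
def blockProfile {N : ℕ} (l : ℕ) (q : Fin N → ℝ) (x : ℝ) : ℝ :=
  ∑ i ∈ Finset.Icc l (N + 1 - l),
    (Metric.ball ((i : ℝ) / N) (1 / (2 * N))).indicator (fun _ => blockAvg l q i) x

/-- The pair `û_N(x) = (r_N(x), p_N(x))` of block-averaged empirical profiles. -/
def uhat {N : ℕ} (l : ℕ) (z : Phase N) (x : ℝ) : ℝ × ℝ :=
  (blockProfile l z.1 x, blockProfile l z.2 x)

/-- The empirical measures of a path, integrated against the pair `(Jr, Jp)` of space-time test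
functions: `∫_0^∞ N⁻¹ ∑_i (Jr(t, i/N) r_i(t) + Jp(t, i/N) p_i(t)) dt`. -/
def empirical (N : ℕ) (x : ℝ≥0 → Phase N) (Jr Jp : ℝ × ℝ → ℝ) : ℝ :=
  ∫ t in Ioi (0 : ℝ), (1 / (N : ℝ)) * ∑ i ∈ Finset.Icc 1 N,
    (Jr (t, (i : ℝ) / N) * site (x t.toNNReal).1 i +
      Jp (t, (i : ℝ) / N) * site (x t.toNNReal).2 i)

/-- The random profile `(r, p)`, functions of `(ω, t, x)`, is a limit point of the empirical
profiles along the subsequence `φ`: it is a square integrable random field, and the laws of the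
empirical measures converge weakly to the law of the measures with densities `r` and `p`. By
linearity of the empirical measures in the test functions, convergence in law of their integrals
against arbitrary pairs of test functions contains the joint convergence in law of any finite
number of such integrals. -/
structure IsLimitProfile {Ω : ℕ → Type*} [∀ N, MeasurableSpace (Ω N)]
    (P : ∀ N, Measure (Ω N)) [∀ N, IsProbabilityMeasure (P N)]
    (X : ∀ N, ℝ≥0 → Ω N → Phase N) (φ : ℕ → ℕ)
    {Ω' : Type*} [MeasurableSpace Ω'] (P' : Measure Ω') [IsProbabilityMeasure P']
    (r p : Ω' → ℝ → ℝ → ℝ) : Prop where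
  strictMono : StrictMono φ
  measurable_r : Measurable fun y : Ω' × ℝ × ℝ => r y.1 y.2.1 y.2.2
  measurable_p : Measurable fun y : Ω' × ℝ × ℝ => p y.1 y.2.1 y.2.2
  square_integrable : ∀ T : ℝ,
    ∫⁻ ω, (∫⁻ t in Ioc (0 : ℝ) T, ∫⁻ x in Icc (0 : ℝ) 1,
      ENNReal.ofReal (r ω t x ^ 2 + p ω t x ^ 2)) ∂P' < ∞
  tendsto_law : ∀ Jr Jp : ℝ × ℝ → ℝ, Continuous Jr → HasCompactSupport Jr →
    Continuous Jp → HasCompactSupport Jp →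
    TendstoInDistribution
      (fun k (ω : Ω (φ k)) => empirical (φ k) (fun t => X (φ k) t ω) Jr Jp) atTop
      (fun ω => ∫ t in Ioi (0 : ℝ), ∫ x in (0 : ℝ)..1,
        (Jr (t, x) * r ω t x + Jp (t, x) * p ω t x))
      (fun k => P (φ k)) P'

/-- Convergence of the energy along the subsequence `φ`. Limits of functions of the time `t` are
understood in the weak sense, that is, against continuous compactly supported functions of `t`.
The energy of the macroscopic profiles is the sum of their kinetic energy and of the internal
energy. -/
structure EnergyConvergence {Ω : ℕ → Type*} [∀ N, MeasurableSpace (Ω N)]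
    (P : ∀ N, Measure (Ω N)) (V : ℝ → ℝ) (β τ₀ : ℝ) (l : ℕ → ℕ)
    (X : ∀ N, ℝ≥0 → Ω N → Phase N) (φ : ℕ → ℕ)
    {Ω' : Type*} [MeasurableSpace Ω'] (P' : Measure Ω')
    (r p : Ω' → ℝ → ℝ → ℝ) : Prop where
  integrable_initial : ∀ N, Integrable (fun ω => energy V N (X N 0 ω)) (P N)
  tendsto_initial :
    Tendsto (fun k => ∫ ω, energy V (φ k) (X (φ k) 0 ω) ∂(P (φ k))) atTop
      (𝓝 (internalEnergy V β τ₀))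
  tendsto_energy : ∀ ψ : ℝ → ℝ, Continuous ψ → HasCompactSupport ψ →
    Tendsto (fun k => ∫ t in Ioi (0 : ℝ), ψ t *
      ∫ ω, (energy V (φ k) (X (φ k) t.toNNReal ω) -
        ∫ x in (0 : ℝ)..1,
          ((uhat (l (φ k)) (X (φ k) t.toNNReal ω) x).2 ^ 2 / 2 +
            internalEnergy V β
              (tension V β (uhat (l (φ k)) (X (φ k) t.toNNReal ω) x).1))) ∂(P (φ k)))
      atTop (𝓝 0)
  tendsto_quadratic : ∀ ψ : ℝ × ℝ → ℝ, Continuous ψ → HasCompactSupport ψ →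
    ∀ f : ℝ × ℝ → ℝ, Continuous f → (∃ C : ℝ, ∀ y, |f y| ≤ C * (1 + y.1 ^ 2 + y.2 ^ 2)) →
    Tendsto (fun k => ∫ x in (0 : ℝ)..1, ∫ t in Ioi (0 : ℝ), ψ (t, x) *
        ∫ ω, f (uhat (l (φ k)) (X (φ k) t.toNNReal ω) x) ∂(P (φ k)))
      atTop
      (𝓝 (∫ x in (0 : ℝ)..1, ∫ t in Ioi (0 : ℝ), ψ (t, x) *
        ∫ ω, f (r ω t x, p ω t x) ∂P'))

/-! ### Vanishing viscosity solutions of the p-system -/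

/-- Time derivative. -/
def dt (f : ℝ → ℝ → ℝ) (t x : ℝ) : ℝ := deriv (fun s => f s x) t

/-- Space derivative on `[0, 1]` (one-sided at the end points). -/
def dx (f : ℝ → ℝ → ℝ) (t x : ℝ) : ℝ := derivWithin (fun y => f t y) (Icc 0 1) x

/-- The function `f` is continuous on `[0, ∞) × [0, 1]`; on `(0, ∞) × [0, 1]` it is differentiable
in `t` and twice differentiable in `x`, with continuous derivatives. -/
structure IsC12 (f : ℝ → ℝ → ℝ) : Prop where
  cont : ContinuousOn (Function.uncurry f) (Ici 0 ×ˢ Icc 0 1)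
  diff_t : ∀ t > 0, ∀ x ∈ Icc (0 : ℝ) 1, DifferentiableAt ℝ (fun s => f s x) t
  diff_x : ∀ t > 0, DifferentiableOn ℝ (fun y => f t y) (Icc 0 1)
  diff_xx : ∀ t > 0, DifferentiableOn ℝ (fun y => dx f t y) (Icc 0 1)
  cont_t : ContinuousOn (Function.uncurry (dt f)) (Ioi 0 ×ˢ Icc 0 1)
  cont_x : ContinuousOn (Function.uncurry (dx f)) (Ioi 0 ×ˢ Icc 0 1)
  cont_xx : ContinuousOn (Function.uncurry (dx (dx f))) (Ioi 0 ×ˢ Icc 0 1)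

/-- `(r, p)` is a strong solution of the viscous system
`∂_t r - ∂_x p = δ₁ ∂_xx τ_β(r)`, `∂_t p - ∂_x τ_β(r) = δ₂ ∂_xx p` on `(0, ∞) × (0, 1)` with the
boundary conditions `p(t,0) = 0`, `τ_β(r(t,1)) = τbar(t)`, `∂_x p(t,1) = 0`, `∂_x r(t,0) = 0`. -/
structure IsViscousSolution (V : ℝ → ℝ) (β : ℝ) (τbar : ℝ → ℝ) (δ₁ δ₂ : ℝ)
    (r p : ℝ → ℝ → ℝ) : Prop where
  regular_r : IsC12 r
  regular_tension : IsC12 fun t x => tension V β (r t x)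
  regular_p : IsC12 p
  eq_r : ∀ t > 0, ∀ x ∈ Ioo (0 : ℝ) 1,
    dt r t x - dx p t x = δ₁ * dx (dx fun t x => tension V β (r t x)) t x
  eq_p : ∀ t > 0, ∀ x ∈ Ioo (0 : ℝ) 1,
    dt p t x - dx (fun t x => tension V β (r t x)) t x = δ₂ * dx (dx p) t x
  p_zero : ∀ t > 0, p t 0 = 0
  tension_one : ∀ t > 0, tension V β (r t 1) = τbar t
  dp_one : ∀ t > 0, dx p t 1 = 0
  dr_zero : ∀ t > 0, dx r t 0 = 0

/-- `(r, p)` is a vanishing viscosity solution: the limit, in `L¹([0, T] × [0, 1])` for every `T`,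
of strong solutions of the viscous system for viscosities `δ₁, δ₂ > 0` that tend to zero, the
initial profiles of which converge to that of `(r, p)` in `L²(0, 1)`. -/
def IsVanishingViscositySolution (V : ℝ → ℝ) (β : ℝ) (τbar : ℝ → ℝ) (r p : ℝ → ℝ → ℝ) : Prop :=
  ∃ (δ₁ δ₂ : ℕ → ℝ) (rδ pδ : ℕ → ℝ → ℝ → ℝ),
    (∀ n, 0 < δ₁ n) ∧ (∀ n, 0 < δ₂ n) ∧
    Tendsto δ₁ atTop (𝓝 0) ∧ Tendsto δ₂ atTop (𝓝 0) ∧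
    (∀ n, IsViscousSolution V β τbar (δ₁ n) (δ₂ n) (rδ n) (pδ n)) ∧
    Tendsto (fun n => ∫⁻ x in Icc (0 : ℝ) 1,
      ENNReal.ofReal ((rδ n 0 x - r 0 x) ^ 2 + (pδ n 0 x - p 0 x) ^ 2)) atTop (𝓝 0) ∧
    ∀ T : ℝ, Tendsto (fun n => ∫⁻ t in Ioc 0 T, ∫⁻ x in Icc (0 : ℝ) 1,
      ENNReal.ofReal (|rδ n t x - r t x| + |pδ n t x - p t x|)) atTop (𝓝 0)

/-- At time `0` the profile is the equilibrium of tension `τ₀`. -/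
def StartsAtEquilibrium (V : ℝ → ℝ) (β τ₀ : ℝ) (r p : ℝ → ℝ → ℝ) : Prop :=
  ∀ᵐ x ∂(volume.restrict (Icc (0 : ℝ) 1)), r 0 x = tensionInv V β τ₀ ∧ p 0 x = 0

/-- As `t → ∞` the profile reaches the equilibrium of tension `τ₁`: for almost every `x` the
tension converges to `τ₁` and the momentum to `0`, and the squares of the profiles at large times
are uniformly integrable on `[0, 1]`. -/
def ReachesEquilibrium (V : ℝ → ℝ) (β τ₁ : ℝ) (r p : ℝ → ℝ → ℝ) : Prop :=
  (∀ᵐ x ∂(volume.restrict (Icc (0 : ℝ) 1)),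
    Tendsto (fun t => tension V β (r t x)) atTop (𝓝 τ₁) ∧
    Tendsto (fun t => p t x) atTop (𝓝 0)) ∧
  ∃ T : ℝ,
    UniformIntegrable (fun t : Ici T => r t) 2 (volume.restrict (Icc (0 : ℝ) 1)) ∧
    UniformIntegrable (fun t : Ici T => p t) 2 (volume.restrict (Icc (0 : ℝ) 1))

/-! ### Macroscopic work and heat -/

/-- Total length `ℒ(t) = ∫_0^1 r(t, y) dy`. -/
def totalLength (r : ℝ → ℝ → ℝ) (t : ℝ) : ℝ := ∫ y in (0 : ℝ)..1, r t y

/-- The total length is well defined at all times, and of bounded variation on bounded time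
intervals. -/
def HasBVLength (r : ℝ → ℝ → ℝ) : Prop :=
  (∀ t ≥ 0, IntegrableOn (r t) (Icc 0 1)) ∧
    LocallyBoundedVariationOn (totalLength r) (Ici 0)

/-- `I` is the Riemann–Stieltjes integral `∫_a^b f dg`: the limit of the sums
`∑ f(ξ_i) (g(x_{i+1}) - g(x_i))` over tagged partitions of `[a, b]` as the mesh tends to zero. -/
def HasRSIntegral (f g : ℝ → ℝ) (a b I : ℝ) : Prop :=
  ∀ ε > 0, ∃ δ > 0, ∀ (n : ℕ) (x ξ : ℕ → ℝ), Monotone x → x 0 = a → x n = b →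
    (∀ i < n, x (i + 1) - x i < δ) → (∀ i < n, ξ i ∈ Icc (x i) (x (i + 1))) →
    |(∑ i ∈ Finset.range n, f (ξ i) * (g (x (i + 1)) - g (x i))) - I| < ε

open Classical in
/-- The Riemann–Stieltjes integral `∫_a^b f dg` (and `0` if it does not exist). -/
def rsIntegral (f g : ℝ → ℝ) (a b : ℝ) : ℝ :=
  if h : ∃ I, HasRSIntegral f g a b I then h.choose else 0

/-- Macroscopic work up to time `t`: `W(t) = ∫_0^t τbar(s) dℒ(s)`. -/
def macroWork (τbar : ℝ → ℝ) (r : ℝ → ℝ → ℝ) (t : ℝ) : ℝ :=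
  rsIntegral τbar (totalLength r) 0 t

/-- Macroscopic heat up to time `t`:
`Q(t) = ∫_0^1 (p(t,x)²/2 + U(β, τ_β(r(t,x))) - U(β, τ₀)) dx - W(t)`. -/
def macroHeat (V : ℝ → ℝ) (β τ₀ : ℝ) (τbar : ℝ → ℝ) (r p : ℝ → ℝ → ℝ) (t : ℝ) : ℝ :=
  (∫ x in (0 : ℝ)..1,
    (p t x ^ 2 / 2 + internalEnergy V β (tension V β (r t x)) - internalEnergy V β τ₀)) -
    macroWork τbar r t

end AnharmonicChain

end

/-! Microscopic level. Expectations in the martingale problem turn every balance into a computation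
with the generator. On the energy, the Liouville part sums by parts to the power `τ p_N` of the
external tension and the thermostats produce minus `N σ` times the heat density
(`generator_hamiltonian`, `IsChain.energy_balance`). On the total length the thermostats act
trivially and only the end velocity `p_N` survives (`generator_length`, `IsChain.length_balance`).
Hence `E[W_N(t)]` is the integral of `τbar` against the increments of the mean length. Integrated by
parts it becomes `f(t) m(t) - f(0) m(0) - ∫ f' m` (`stieltjesByParts`), with `f = τbar` and `m` the
mean length (`IsChain.expectation_microWork`).

The martingale problem only admits compactly supported functions. The energy, shifted to be at least
`1`, bounds its own generator and its own carré du champ linearly. Gronwall's inequality applied to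
bounded concave functions of it bounds its expectation (`IsChain.exists_expectation_lyapunov_le`),
and truncation at high energy then extends Dynkin's formula by dominated convergence
(`IsChain.dynkin`).

Passage to the limit. For `C¹` tension and a length of bounded variation the Riemann–Stieltjes
integral exists and equals the by-parts expression (`hasRSIntegral_stieltjesByParts`), so the mean
macroscopic work is the same functional of the mean macroscopic length. Weak convergence of the work
thus reduces to that of the mean length, together with its value at time `0`
(`tendsto_weak_stieltjesByParts`). The empirical length converges in law; its square is at most `C
(E_N + C)`, and the mean energies converge weakly, so uniform integrability upgrades this to
convergence of expectations (`tendsto_weak_energy`, `tendsto_weak_length`). Heat is energy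
difference minus work at both levels, at the microscopic one in mean.

Macroscopic level. Along the viscous system, `∫ (p²/2 + F(r))` grows at the rate `τbar ℒ'` minus a
nonnegative dissipation. Convexity of `F` bounds the final free energy below by a tangent, and a
parabola bounds the initial one above; the terms in `ℒ(t)` and `ℒ(0)` cancel. What is left involves
the initial error and `∫ τbar' ℒ` only, and passes to `L¹` limits
(`IsVanishingViscositySolution.clausius`). Since `τbar' = 0` after `t₁`, that integral is frozen;
Vitali's theorem gives the limits of length and energy, and the inequality at one finite time is the
Clausius inequality (`thermodynamic_transformation`).

The equilibrium facts rest on one identity: under the Gibbs measure the covariance of `r` and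
`V'(r)` is `1/β`. The bounds on `V''` then place the variance of `r` between `1/(c₂ β)` and `1/(c₁
β)`. So the mean elongation is a bi-Lipschitz function of the tension, with inverse `τ_β`, and the
internal energy grows at most quadratically in the elongation. -/

namespace AnharmonicChain

/-! ### Uniformly convex potentials -/

/-- The standing assumptions on the potential and on the inverse temperature. -/
structure Admissible (V : ℝ → ℝ) (c₁ c₂ β : ℝ) : Prop where
  contDiff : ContDiff ℝ 2 V
  pos : 0 < c₁
  bounds : ∀ r, c₁ ≤ deriv (deriv V) r ∧ deriv (deriv V) r ≤ c₂
  beta_pos : 0 < β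

/-- The sign condition makes `f` decrease up to `0` and increase afterwards. It yields all
comparisons with tangents and parabolas below without second derivatives. -/
lemma nonneg_of_deriv_mul_nonneg {f f' : ℝ → ℝ} (hf : ∀ x, HasDerivAt f (f' x) x) (h0 : f 0 = 0)
    (h : ∀ x, 0 ≤ f' x * x) (x : ℝ) : 0 ≤ f x := by
  have hc : Continuous f := continuous_iff_continuousAt.2 fun x => (hf x).continuousAt
  rcases le_total 0 x with hx | hx
  · have hm : MonotoneOn f (Ici 0) := by
      refine monotoneOn_of_deriv_nonneg (convex_Ici 0) hc.continuousOn
        (fun y _ => (hf y).differentiableAt.differentiableWithinAt) fun y hy => ?_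
      rw [interior_Ici, mem_Ioi] at hy
      rw [(hf y).deriv]
      exact nonneg_of_mul_nonneg_left (h y) hy
    have := hm (mem_Ici.2 le_rfl) (mem_Ici.2 hx) hx
    linarith
  · have hm : AntitoneOn f (Iic 0) := by
      refine antitoneOn_of_deriv_nonpos (convex_Iic 0) hc.continuousOn
        (fun y _ => (hf y).differentiableAt.differentiableWithinAt) fun y hy => ?_
      rw [interior_Iic, mem_Iio] at hy
      rw [(hf y).deriv]
      by_contra hcon
      push Not at hcon
      nlinarith [h y]
    have := hm (mem_Iic.2 hx) (mem_Iic.2 le_rfl) hx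
    linarith

namespace Admissible

variable {V : ℝ → ℝ} {c₁ c₂ β : ℝ}

lemma upper_pos (h : Admissible V c₁ c₂ β) : 0 < c₂ :=
  h.pos.trans_le ((h.bounds 0).1.trans (h.bounds 0).2)

lemma contDiff_deriv (h : Admissible V c₁ c₂ β) : ContDiff ℝ 1 (deriv V) :=
  (contDiff_succ_iff_deriv (n := 1)).1 h.contDiff |>.2.2

lemma hasDerivAt (h : Admissible V c₁ c₂ β) (r : ℝ) : HasDerivAt V (deriv V r) r :=
  (h.contDiff.differentiable (by norm_num) r).hasDerivAt

lemma hasDerivAt_deriv (h : Admissible V c₁ c₂ β) (r : ℝ) :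
    HasDerivAt (deriv V) (deriv (deriv V) r) r :=
  (h.contDiff_deriv.differentiable (by norm_num) r).hasDerivAt

lemma continuous (h : Admissible V c₁ c₂ β) : Continuous V := h.contDiff.continuous

lemma continuous_deriv (h : Admissible V c₁ c₂ β) : Continuous (deriv V) :=
  h.contDiff_deriv.continuous

lemma continuous_deriv_deriv (h : Admissible V c₁ c₂ β) : Continuous (deriv (deriv V)) :=
  h.contDiff_deriv.continuous_deriv le_rfl

/-- Mean value bounds for `V'`. The product form is symmetric in `a` and `b`, and is the one that is
integrated against Gibbs measures. -/
lemma deriv_sub_mul_bounds (h : Admissible V c₁ c₂ β) (a b : ℝ) :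
    c₁ * (a - b) ^ 2 ≤ (deriv V a - deriv V b) * (a - b) ∧
      (deriv V a - deriv V b) * (a - b) ≤ c₂ * (a - b) ^ 2 := by
  have hd := h.contDiff_deriv.differentiable (by norm_num)
  wlog hab : b ≤ a generalizing a b
  · obtain ⟨h1, h2⟩ := this b a (le_of_not_ge hab)
    constructor <;> linarith
  have h1 := mul_sub_le_image_sub_of_le_deriv hd (fun x => (h.bounds x).1) hab
  have h2 := image_sub_le_mul_sub_of_deriv_le hd (fun x => (h.bounds x).2) hab
  constructor <;> nlinarith

lemma quadratic_lower (h : Admissible V c₁ c₂ β) (r : ℝ) :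
    V 0 + deriv V 0 * r + c₁ / 2 * r ^ 2 ≤ V r := by
  have := nonneg_of_deriv_mul_nonneg (f := fun r => V r - (V 0 + deriv V 0 * r + c₁ / 2 * r ^ 2))
    (f' := fun r => deriv V r - (deriv V 0 + c₁ * r)) (fun x => by
      have := (h.hasDerivAt x).sub ((((hasDerivAt_id x).const_mul (deriv V 0)).const_add
        (V 0)).add (((hasDerivAt_pow 2 x)).const_mul (c₁ / 2)))
      exact this.congr_deriv (by simp; ring)) (by simp) (fun x => by
        have := (h.deriv_sub_mul_bounds x 0).1
        nlinarith) r
  simpa using this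

lemma quadratic_upper (h : Admissible V c₁ c₂ β) (r : ℝ) :
    V r ≤ V 0 + deriv V 0 * r + c₂ / 2 * r ^ 2 := by
  have := nonneg_of_deriv_mul_nonneg (f := fun r => (V 0 + deriv V 0 * r + c₂ / 2 * r ^ 2) - V r)
    (f' := fun r => (deriv V 0 + c₂ * r) - deriv V r) (fun x => by
      have := ((((hasDerivAt_id x).const_mul (deriv V 0)).const_add
        (V 0)).add (((hasDerivAt_pow 2 x)).const_mul (c₂ / 2))).sub (h.hasDerivAt x)
      exact this.congr_deriv (by simp; ring)) (by simp) (fun x => by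
        have := (h.deriv_sub_mul_bounds x 0).2
        nlinarith) r
  simpa using this

lemma abs_deriv_le (h : Admissible V c₁ c₂ β) (r : ℝ) :
    |deriv V r| ≤ |deriv V 0| + c₂ * |r| := by
  have h1 : |deriv V r - deriv V 0| ≤ c₂ * |r| := by
    have h2 := h.deriv_sub_mul_bounds r 0
    have h3 : |deriv V r - deriv V 0| * |r| ≤ c₂ * |r| * |r| := by
      rw [← abs_mul, abs_of_nonneg]
      · have : c₂ * |r| * |r| = c₂ * r ^ 2 := by rw [mul_assoc, ← sq, sq_abs]
        rw [this]; simpa using h2.2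
      · have := mul_nonneg h.pos.le (sq_nonneg r)
        simp only [sub_zero] at h2
        linarith [h2.1]
    rcases eq_or_ne r 0 with rfl | hr
    · simp
    · exact le_of_mul_le_mul_right h3 (abs_pos.2 hr)
  have := abs_sub_abs_le_abs_sub (deriv V r) (deriv V 0)
  linarith

lemma exists_abs_le (h : Admissible V c₁ c₂ β) : ∃ C, 0 ≤ C ∧ ∀ r, |V r| ≤ C * (1 + r ^ 2) := by
  refine ⟨|V 0| + |deriv V 0| + c₂, by have := h.upper_pos; positivity, fun r => ?_⟩
  have h1 := h.quadratic_lower r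
  have h2 := h.quadratic_upper r
  have h3 : |deriv V 0 * r| ≤ |deriv V 0| * (1 + r ^ 2) := by
    rw [abs_mul]
    refine mul_le_mul_of_nonneg_left ?_ (abs_nonneg _)
    rw [abs_le]; constructor <;> nlinarith [sq_nonneg (r - 1), sq_nonneg (r + 1)]
  have h4 := abs_le.1 h3
  have h5 := abs_le.1 (le_refl |V 0|)
  have h6 := h.upper_pos
  have h7 := h.pos
  have h8 : 0 ≤ |V 0| * r ^ 2 := by positivity
  have h9 : 0 ≤ c₂ * r ^ 2 := by positivity
  have h10 : 0 ≤ c₁ * r ^ 2 := by positivity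
  rw [abs_le]; constructor <;> nlinarith

/-- The Hamiltonian of one particle dominates the square norm. -/
lemma exists_sq_le (h : Admissible V c₁ c₂ β) : ∃ C, 0 ≤ C ∧ ∀ r, r ^ 2 ≤ C * (V r + C) := by
  have hc := h.pos
  set B := |V 0| + deriv V 0 ^ 2 / c₁ with hB
  have hB0 : 0 ≤ B := by positivity
  -- Completing the square: half of the quadratic term absorbs the linear one.
  have key : ∀ r, c₁ / 4 * r ^ 2 ≤ V r + B := fun r => by
    have h1 := h.quadratic_lower r
    have h3 : 0 ≤ (c₁ * r / 2 + deriv V 0) ^ 2 / c₁ := by positivity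
    have h4 : (c₁ * r / 2 + deriv V 0) ^ 2 / c₁ =
      c₁ / 4 * r ^ 2 + deriv V 0 * r + deriv V 0 ^ 2 / c₁ := by field_simp; ring
    have := neg_abs_le (V 0)
    linarith
  -- A single constant serves both as factor and as shift, hence a sum exceeding both `4 / c₁` and
  -- `B`.
  refine ⟨B + 4 / c₁, by positivity, fun r => ?_⟩
  have h1 : r ^ 2 ≤ 4 / c₁ * (V r + B) := by
    have := mul_le_mul_of_nonneg_left (key r) (by positivity : 0 ≤ 4 / c₁)
    calc r ^ 2 = 4 / c₁ * (c₁ / 4 * r ^ 2) := by field_simp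
      _ ≤ _ := this
  have h2 : 0 ≤ V r + B := le_trans (by positivity) (key r)
  have h3 : 0 ≤ 4 / c₁ := by positivity
  nlinarith [mul_nonneg hB0 h2, mul_nonneg hB0 h3, mul_nonneg h3 h3]

end Admissible

/-! ### Gibbs integrals -/

/-- The unnormalised Gibbs density. -/
noncomputable def gibbsWeight (V : ℝ → ℝ) (β τ r : ℝ) : ℝ := Real.exp (-β * V r + β * τ * r)

/-- The unnormalised Gibbs average of `h`. -/
noncomputable def gibbsIntegral (V : ℝ → ℝ) (β : ℝ) (h : ℝ → ℝ) (τ : ℝ) : ℝ :=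
  ∫ r, h r * gibbsWeight V β τ r

/-- The mean elongation in the Gibbs measure of tension `τ`. -/
noncomputable def gibbsMean (V : ℝ → ℝ) (β τ : ℝ) : ℝ :=
  gibbsIntegral V β id τ / gibbsIntegral V β 1 τ

lemma gibbsWeight_pos (V : ℝ → ℝ) (β τ r : ℝ) : 0 < gibbsWeight V β τ r := Real.exp_pos _

namespace Admissible

variable {V : ℝ → ℝ} {c₁ c₂ β : ℝ}

lemma continuous_gibbsWeight (hV : Admissible V c₁ c₂ β) (τ : ℝ) :
    Continuous (gibbsWeight V β τ) := by
  have := hV.continuous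
  unfold gibbsWeight
  fun_prop

/-- Half of the quadratic growth of `β V` absorbs all terms linear in `|r|`. Uniformity over `|τ| ≤
S` provides the dominating function for differentiation in `τ`. -/
lemma exists_exp_mul_gibbsWeight_le (hV : Admissible V c₁ c₂ β) (S a : ℝ) :
    ∃ K, ∀ τ, |τ| ≤ S → ∀ r,
      Real.exp (a * |r|) * gibbsWeight V β τ r ≤ K * Real.exp (-(β * c₁ / 4) * r ^ 2) := by
  have hβ := hV.beta_pos
  have hc := hV.pos
  set b := β * c₁ / 4 with hb
  have hb0 : 0 < b := by positivity
  set D := |a| + β * |deriv V 0| + β * S with hD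
  refine ⟨Real.exp (-β * V 0 + D ^ 2 / (4 * b)), fun τ hτ r => ?_⟩
  rw [gibbsWeight, ← Real.exp_add, ← Real.exp_add]
  refine Real.exp_le_exp.2 ?_
  have h1 := mul_le_mul_of_nonneg_left (hV.quadratic_lower r) hβ.le
  have h2 : 0 ≤ (2 * b * |r| - D) ^ 2 / (4 * b) := by positivity
  have h3 : (2 * b * |r| - D) ^ 2 / (4 * b) = b * r ^ 2 - D * |r| + D ^ 2 / (4 * b) := by
    have : |r| ^ 2 = r ^ 2 := sq_abs r
    field_simp
    rw [← this]; ring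
  have h4 : a * |r| ≤ |a| * |r| := mul_le_mul_of_nonneg_right (le_abs_self a) (abs_nonneg r)
  have h5 : -(deriv V 0 * r) ≤ |deriv V 0| * |r| := by rw [← abs_mul]; exact neg_le_abs _
  have h6 : τ * r ≤ S * |r| := by
    calc τ * r ≤ |τ * r| := le_abs_self _
      _ = |τ| * |r| := abs_mul _ _
      _ ≤ _ := mul_le_mul_of_nonneg_right hτ (abs_nonneg r)
  have h7 := mul_le_mul_of_nonneg_left h5 hβ.le
  have h8 := mul_le_mul_of_nonneg_left h6 hβ.le
  have h9 : β * (c₁ / 2 * r ^ 2) = 2 * b * r ^ 2 := by rw [hb]; ring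
  rw [h3] at h2
  have h10 : D * |r| = |a| * |r| + β * (|deriv V 0| * |r|) + β * (S * |r|) := by rw [hD]; ring
  nlinarith

lemma integrable_mul_gibbsWeight (hV : Admissible V c₁ c₂ β) {h : ℝ → ℝ} (hc : Continuous h)
    {A a : ℝ} (hh : ∀ r, |h r| ≤ A * Real.exp (a * |r|)) (τ : ℝ) :
    Integrable fun r => h r * gibbsWeight V β τ r := by
  obtain ⟨K, hK⟩ := hV.exists_exp_mul_gibbsWeight_le |τ| a
  have hb0 : 0 < β * c₁ / 4 := by have := hV.pos; have := hV.beta_pos; positivity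
  have hA : 0 ≤ A := by have := (abs_nonneg _).trans (hh 0); simpa using this
  refine ((integrable_exp_neg_mul_sq hb0).const_mul (A * K)).mono'
    (hc.mul (hV.continuous_gibbsWeight τ)).aestronglyMeasurable (ae_of_all _ fun r => ?_)
  rw [Real.norm_eq_abs, abs_mul, abs_of_pos (gibbsWeight_pos V β τ r)]
  calc |h r| * gibbsWeight V β τ r ≤ A * Real.exp (a * |r|) * gibbsWeight V β τ r :=
        mul_le_mul_of_nonneg_right (hh r) (gibbsWeight_pos V β τ r).le
    _ = A * (Real.exp (a * |r|) * gibbsWeight V β τ r) := by ring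
    _ ≤ A * (K * Real.exp (-(β * c₁ / 4) * r ^ 2)) :=
        mul_le_mul_of_nonneg_left (hK τ le_rfl r) hA
    _ = _ := by ring

lemma hasDerivAt_gibbsIntegral (hV : Admissible V c₁ c₂ β) {h : ℝ → ℝ} (hc : Continuous h)
    {A a : ℝ} (hh : ∀ r, |h r| ≤ A * Real.exp (a * |r|)) (τ : ℝ) :
    HasDerivAt (gibbsIntegral V β h) (β * gibbsIntegral V β (fun r => r * h r) τ) τ := by
  have hβ := hV.beta_pos
  -- The tension varies in a ball of radius `1`, and the factor `r` brought down by the derivative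
  -- costs one unit of exponential rate.
  obtain ⟨K, hK⟩ := hV.exists_exp_mul_gibbsWeight_le (|τ| + 1) (a + 1)
  have hb0 : 0 < β * c₁ / 4 := by have := hV.pos; positivity
  have hA : 0 ≤ A := by have := (abs_nonneg _).trans (hh 0); simpa using this
  have key := (hasDerivAt_integral_of_dominated_loc_of_deriv_le (μ := volume)
    (F := fun τ r => h r * gibbsWeight V β τ r)
    (F' := fun τ r => β * (r * h r * gibbsWeight V β τ r))
    (bound := fun r => β * (A * K) * Real.exp (-(β * c₁ / 4) * r ^ 2))
    (x₀ := τ) (Metric.ball_mem_nhds τ one_pos)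
    (Eventually.of_forall fun τ =>
      (hc.mul (hV.continuous_gibbsWeight τ)).aestronglyMeasurable)
    (hV.integrable_mul_gibbsWeight hc hh τ)
    (((continuous_id.mul hc).mul
      (hV.continuous_gibbsWeight τ)).const_mul β).aestronglyMeasurable
    (ae_of_all _ fun r τ' hτ' => ?_)
    ((integrable_exp_neg_mul_sq hb0).const_mul _)
    (ae_of_all _ fun r τ' _ => ?_)).2
  · unfold gibbsIntegral
    rw [← integral_const_mul]
    exact key
  · have hτ1 : |τ'| ≤ |τ| + 1 := by
      rw [Metric.mem_ball, Real.dist_eq] at hτ'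
      have := abs_sub_abs_le_abs_sub τ' τ
      linarith
    have hr : |r| ≤ Real.exp |r| := by have := Real.add_one_le_exp |r|; linarith
    rw [Real.norm_eq_abs, abs_mul, abs_mul, abs_mul, abs_of_pos hβ,
      abs_of_pos (gibbsWeight_pos V β τ' r), mul_assoc β]
    refine mul_le_mul_of_nonneg_left ?_ hβ.le
    calc |r| * |h r| * gibbsWeight V β τ' r
        ≤ Real.exp |r| * (A * Real.exp (a * |r|)) * gibbsWeight V β τ' r := by
          refine mul_le_mul_of_nonneg_right ?_ (gibbsWeight_pos V β τ' r).le
          exact mul_le_mul hr (hh r) (abs_nonneg _) (Real.exp_pos _).le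
      _ = A * (Real.exp ((a + 1) * |r|) * gibbsWeight V β τ' r) := by
          rw [add_mul, Real.exp_add, one_mul]; ring
      _ ≤ A * (K * Real.exp (-(β * c₁ / 4) * r ^ 2)) :=
          mul_le_mul_of_nonneg_left (hK τ' hτ1 r) hA
      _ = _ := by ring
  · have h1 : HasDerivAt (fun τ => -β * V r + β * τ * r) (β * r) τ' := by
      simpa using (((hasDerivAt_id τ').const_mul β).mul_const r).const_add (-β * V r)
    have h2 := (h1.exp).const_mul (h r)
    exact h2.congr_deriv (by unfold gibbsWeight; ring)

lemma abs_le_exp_abs (r : ℝ) : |r| ≤ 1 * Real.exp (1 * |r|) := by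
  have := Real.add_one_le_exp |r|
  simp only [one_mul]; linarith

lemma sq_le_exp_abs (r : ℝ) : |r * r| ≤ 1 * Real.exp (2 * |r|) := by
  have h1 := abs_le_exp_abs r
  rw [abs_mul, one_mul, two_mul, Real.exp_add]
  simp only [one_mul] at h1
  exact mul_le_mul h1 h1 (abs_nonneg _) (Real.exp_pos _).le

lemma one_le_exp_abs (r : ℝ) : |(1 : ℝ → ℝ) r| ≤ 1 * Real.exp (0 * |r|) := by simp

lemma exists_exp_bound {h : ℝ → ℝ} {C : ℝ} (hC0 : 0 ≤ C) (hC : ∀ r, |h r| ≤ C * (1 + r ^ 2))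
    (r : ℝ) : |h r| ≤ (2 * C) * Real.exp (2 * |r|) := by
  refine (hC r).trans ?_
  have h1 := sq_le_exp_abs r
  rw [← sq, abs_of_nonneg (sq_nonneg r)] at h1
  have h2 : 1 ≤ Real.exp (2 * |r|) := Real.one_le_exp (by positivity)
  nlinarith

lemma gibbsIntegral_one_pos (hV : Admissible V c₁ c₂ β) (τ : ℝ) : 0 < gibbsIntegral V β 1 τ := by
  have h1 := hV.integrable_mul_gibbsWeight (h := 1) continuous_const one_le_exp_abs τ
  refine (integral_pos_iff_support_of_nonneg (fun r => ?_) h1).2 ?_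
  · simpa using (gibbsWeight_pos V β τ r).le
  · have : (Function.support fun r => (1 : ℝ → ℝ) r * gibbsWeight V β τ r) = univ := by
      ext r; simp [(gibbsWeight_pos V β τ r).ne']
    rw [this]; simp

end Admissible

/-! ### Gibbs identities, variance bounds and the Legendre duality between `G` and `F`. -/

namespace Admissible

variable {V : ℝ → ℝ} {c₁ c₂ β : ℝ}

lemma integrable_gibbsWeight (hV : Admissible V c₁ c₂ β) (τ : ℝ) :
    Integrable (gibbsWeight V β τ) := by
  simpa using hV.integrable_mul_gibbsWeight (h := 1) continuous_const one_le_exp_abs τ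

lemma integrable_id_mul_gibbsWeight (hV : Admissible V c₁ c₂ β) (τ : ℝ) :
    Integrable fun r => r * gibbsWeight V β τ r :=
  hV.integrable_mul_gibbsWeight (h := id) continuous_id abs_le_exp_abs τ

lemma integrable_sq_mul_gibbsWeight (hV : Admissible V c₁ c₂ β) (τ : ℝ) :
    Integrable fun r => r * r * gibbsWeight V β τ r :=
  hV.integrable_mul_gibbsWeight (h := fun r => r * r) (by fun_prop) sq_le_exp_abs τ

lemma integrable_deriv_mul_gibbsWeight (hV : Admissible V c₁ c₂ β) (τ : ℝ) :
    Integrable fun r => deriv V r * gibbsWeight V β τ r := by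
  refine hV.integrable_mul_gibbsWeight (A := |deriv V 0| + c₂) (a := 1) hV.continuous_deriv
    (fun r => (hV.abs_deriv_le r).trans ?_) τ
  have h1 := abs_le_exp_abs r
  have h2 : 1 ≤ Real.exp (1 * |r|) := Real.one_le_exp (by positivity)
  have h3 := hV.upper_pos
  nlinarith [abs_nonneg (deriv V 0), abs_nonneg r]

lemma integrable_id_mul_deriv_mul_gibbsWeight (hV : Admissible V c₁ c₂ β) (τ : ℝ) :
    Integrable fun r => r * deriv V r * gibbsWeight V β τ r := by
  refine hV.integrable_mul_gibbsWeight (A := |deriv V 0| + c₂) (a := 2)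
    (continuous_id.mul hV.continuous_deriv) (fun r => ?_) τ
  have h0 := hV.abs_deriv_le r
  have h1 := abs_le_exp_abs r
  have h2 := sq_le_exp_abs r
  have h4 : |r| ≤ Real.exp (2 * |r|) := by
    have h5 : 1 ≤ Real.exp |r| := Real.one_le_exp (by positivity)
    rw [two_mul, Real.exp_add]
    simp only [one_mul] at h1
    nlinarith
  rw [abs_mul] at h2
  calc |r * deriv V r| = |r| * |deriv V r| := abs_mul _ _
    _ ≤ |r| * (|deriv V 0| + c₂ * |r|) := mul_le_mul_of_nonneg_left h0 (abs_nonneg _)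
    _ = |deriv V 0| * |r| + c₂ * (|r| * |r|) := by ring
    _ ≤ |deriv V 0| * Real.exp (2 * |r|) + c₂ * (1 * Real.exp (2 * |r|)) :=
        add_le_add (mul_le_mul_of_nonneg_left h4 (abs_nonneg _))
          (mul_le_mul_of_nonneg_left h2 hV.upper_pos.le)
    _ = _ := by ring

lemma hasDerivAt_gibbsWeight (hV : Admissible V c₁ c₂ β) (τ r : ℝ) :
    HasDerivAt (gibbsWeight V β τ) (β * (τ - deriv V r) * gibbsWeight V β τ r) r := by
  have h1 : HasDerivAt (fun r => -β * V r + β * τ * r) (-β * deriv V r + β * τ) r :=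
    (((hV.hasDerivAt r).const_mul (-β)).add ((hasDerivAt_id r).const_mul (β * τ))).congr_deriv
      (by simp)
  exact h1.exp.congr_deriv (by unfold gibbsWeight; ring)

/-- The mean of `V'` is the tension. -/
lemma integral_deriv_mul_gibbsWeight (hV : Admissible V c₁ c₂ β) (τ : ℝ) :
    ∫ r, deriv V r * gibbsWeight V β τ r = τ * ∫ r, gibbsWeight V β τ r := by
  have hi := hV.integrable_gibbsWeight τ
  have hi1 := hV.integrable_deriv_mul_gibbsWeight τ
  have h0 := integral_eq_zero_of_hasDerivAt_of_integrable (hV.hasDerivAt_gibbsWeight τ)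
    ((((hi.const_mul τ).sub hi1).const_mul β).congr (ae_of_all _ fun r => by
      simp only [Pi.sub_apply]; ring)) hi
  have h1 : ∫ r, β * (τ - deriv V r) * gibbsWeight V β τ r =
      β * (τ * ∫ r, gibbsWeight V β τ r) - β * ∫ r, deriv V r * gibbsWeight V β τ r := by
    rw [← integral_const_mul, ← integral_const_mul, ← integral_const_mul, ← integral_sub
      ((hi.const_mul τ).const_mul β) (hi1.const_mul β)]
    exact integral_congr_ae (ae_of_all _ fun r => by ring)
  rw [h1] at h0
  have := hV.beta_pos
  exact (mul_left_cancel₀ this.ne' (by linarith)).symm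

/-- The derivative of `r w(r)` integrates to zero, where `w' = β (τ - V') w`. Combined with the mean
of `V'`, this says that `r` and `V'(r)` have covariance `1/β` at every tension. -/
lemma integral_id_mul_deriv_mul_gibbsWeight (hV : Admissible V c₁ c₂ β) (τ : ℝ) :
    β * ∫ r, r * deriv V r * gibbsWeight V β τ r =
      (∫ r, gibbsWeight V β τ r) + β * τ * ∫ r, r * gibbsWeight V β τ r := by
  have hi := hV.integrable_gibbsWeight τ
  have hi1 := hV.integrable_id_mul_gibbsWeight τ
  have hi2 := hV.integrable_id_mul_deriv_mul_gibbsWeight τ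
  have hd : ∀ r, HasDerivAt (fun r => r * gibbsWeight V β τ r)
      (gibbsWeight V β τ r + β * τ * (r * gibbsWeight V β τ r) -
        β * (r * deriv V r * gibbsWeight V β τ r)) r := fun r =>
    ((hasDerivAt_id r).mul (hV.hasDerivAt_gibbsWeight τ r)).congr_deriv (by simp; ring)
  have h0 := integral_eq_zero_of_hasDerivAt_of_integrable hd
    ((hi.add (hi1.const_mul (β * τ))).sub (hi2.const_mul β)) hi1
  rw [integral_sub (by exact hi.add (hi1.const_mul (β * τ))) (by exact hi2.const_mul β),
    integral_add hi (by exact hi1.const_mul (β * τ)), integral_const_mul, integral_const_mul] at h0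
  linarith

/-- Two-sided bounds on the variance of the Gibbs measure. -/
lemma variance_bounds (hV : Admissible V c₁ c₂ β) (τ : ℝ) :
    c₁ * β * (gibbsIntegral V β (fun r => r * r) τ * gibbsIntegral V β 1 τ -
        gibbsIntegral V β id τ ^ 2) ≤ gibbsIntegral V β 1 τ ^ 2 ∧
      gibbsIntegral V β 1 τ ^ 2 ≤ c₂ * β * (gibbsIntegral V β (fun r => r * r) τ *
        gibbsIntegral V β 1 τ - gibbsIntegral V β id τ ^ 2) := by
  have hβ := hV.beta_pos
  have hZ := hV.gibbsIntegral_one_pos τ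
  set Z := gibbsIntegral V β 1 τ with hZd
  set M := gibbsIntegral V β id τ with hMd
  set S := gibbsIntegral V β (fun r => r * r) τ with hSd
  have hi := hV.integrable_gibbsWeight τ
  have hi1 := hV.integrable_id_mul_gibbsWeight τ
  have hi2 := hV.integrable_sq_mul_gibbsWeight τ
  have hi3 := hV.integrable_deriv_mul_gibbsWeight τ
  have hi4 := hV.integrable_id_mul_deriv_mul_gibbsWeight τ
  have e0 : ∫ r, gibbsWeight V β τ r = Z := by simp [hZd, gibbsIntegral]
  have e1 : ∫ r, r * gibbsWeight V β τ r = M := by simp [hMd, gibbsIntegral]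
  have e2 : ∫ r, r * r * gibbsWeight V β τ r = S := by simp [hSd, gibbsIntegral]
  have e3 := hV.integral_deriv_mul_gibbsWeight τ
  have e4 := hV.integral_id_mul_deriv_mul_gibbsWeight τ
  rw [e0] at e3 e4
  rw [e1] at e4
  set m := M / Z with hm
  have hmZ : m * Z = M := div_mul_cancel₀ M hZ.ne'
  -- the integrals of `(r - m)²` and of `(V' - V'(m)) (r - m)`
  have iv : ∫ r, (r - m) ^ 2 * gibbsWeight V β τ r = S - 2 * m * M + m ^ 2 * Z := by
    rw [← e2, ← e1, ← e0, ← integral_const_mul, ← integral_const_mul, ← integral_sub hi2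
      (hi1.const_mul _), ← integral_add (by exact hi2.sub (hi1.const_mul _)) (hi.const_mul _)]
    exact integral_congr_ae (ae_of_all _ fun r => by ring)
  have intv : Integrable fun r => (r - m) ^ 2 * gibbsWeight V β τ r :=
    ((hi2.sub (hi1.const_mul (2 * m))).add (hi.const_mul (m ^ 2))).congr
      (ae_of_all _ fun r => by simp only [Pi.add_apply, Pi.sub_apply]; ring)
  have intw : Integrable fun r => (deriv V r - deriv V m) * (r - m) * gibbsWeight V β τ r :=
    ((hi4.sub (hi3.const_mul m)).sub ((hi1.sub (hi.const_mul m)).const_mul (deriv V m))).congr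
      (ae_of_all _ fun r => by simp only [Pi.sub_apply]; ring)
  -- This is the covariance: the constant `V'(m)` contributes nothing because `r - m` has mean zero.
  have iw : ∫ r, (deriv V r - deriv V m) * (r - m) * gibbsWeight V β τ r = β⁻¹ * Z := by
    have h1 : ∫ r, (deriv V r - deriv V m) * (r - m) * gibbsWeight V β τ r =
        (∫ r, r * deriv V r * gibbsWeight V β τ r) - m * (∫ r, deriv V r * gibbsWeight V β τ r) -
        deriv V m * ((∫ r, r * gibbsWeight V β τ r) - m * ∫ r, gibbsWeight V β τ r) := by
      rw [← integral_const_mul, ← integral_const_mul, ← integral_sub hi1 (hi.const_mul _),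
        ← integral_const_mul, ← integral_sub hi4 (hi3.const_mul _),
        ← integral_sub (by exact hi4.sub (hi3.const_mul _))
          (by exact (hi1.sub (hi.const_mul _)).const_mul _)]
      exact integral_congr_ae (ae_of_all _ fun r => by ring)
    rw [h1, e1, e0, e3, hmZ, sub_self, mul_zero, sub_zero]
    have h2 : ∫ r, r * deriv V r * gibbsWeight V β τ r = β⁻¹ * (Z + β * τ * M) := by
      rw [← e4]; field_simp
    rw [h2, ← hmZ]; field_simp; ring
  have hvar : (S - 2 * m * M + m ^ 2 * Z) * Z = S * Z - M ^ 2 := by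
    rw [← hmZ]; ring
  -- Pointwise, `(V'(r) - V'(m)) (r - m)` lies between `c₁ (r - m)²` and `c₂ (r - m)²`; integration
  -- compares the variance with `1/β`.
  have b1 : c₁ * (S - 2 * m * M + m ^ 2 * Z) ≤ β⁻¹ * Z := by
    rw [← iv, ← iw, ← integral_const_mul]
    refine integral_mono (intv.const_mul c₁) intw fun r => ?_
    have := mul_le_mul_of_nonneg_right (hV.deriv_sub_mul_bounds r m).1 (gibbsWeight_pos V β τ r).le
    simp only at this ⊢
    linarith
  have b2 : β⁻¹ * Z ≤ c₂ * (S - 2 * m * M + m ^ 2 * Z) := by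
    rw [← iv, ← iw, ← integral_const_mul]
    refine integral_mono intw (intv.const_mul c₂) fun r => ?_
    have := mul_le_mul_of_nonneg_right (hV.deriv_sub_mul_bounds r m).2 (gibbsWeight_pos V β τ r).le
    simp only at this ⊢
    linarith
  have hββ : β * (β⁻¹ * Z) = Z := by field_simp
  rw [← hvar]
  constructor
  · have := mul_le_mul_of_nonneg_right (mul_le_mul_of_nonneg_left b1 hβ.le) hZ.le
    rw [hββ] at this
    nlinarith
  · have := mul_le_mul_of_nonneg_right (mul_le_mul_of_nonneg_left b2 hβ.le) hZ.le
    rw [hββ] at this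
    nlinarith

/-- The quotient rule gives `β (S Z - M²) / Z²`, that is `β` times the variance, to which the
variance bounds apply. -/
lemma exists_hasDerivAt_gibbsMean (hV : Admissible V c₁ c₂ β) (τ : ℝ) :
    ∃ d, HasDerivAt (gibbsMean V β) d τ ∧ 1 / c₂ ≤ d ∧ d ≤ 1 / c₁ := by
  have hZ := hV.gibbsIntegral_one_pos τ
  have h1 := hV.hasDerivAt_gibbsIntegral (h := 1) continuous_const one_le_exp_abs τ
  have h2 := hV.hasDerivAt_gibbsIntegral (h := id) continuous_id abs_le_exp_abs τ
  have e1 : (fun r : ℝ => r * (1 : ℝ → ℝ) r) = id := by ext; simp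
  rw [e1] at h1
  simp only [id_eq] at h2
  refine ⟨_, h2.div h1 hZ.ne', ?_, ?_⟩
  · rw [div_le_div_iff₀ hV.upper_pos (by positivity)]
    have := (hV.variance_bounds τ).2
    nlinarith
  · rw [div_le_div_iff₀ (by positivity) hV.pos]
    have := (hV.variance_bounds τ).1
    nlinarith

lemma differentiable_gibbsMean (hV : Admissible V c₁ c₂ β) : Differentiable ℝ (gibbsMean V β) :=
  fun τ => (hV.exists_hasDerivAt_gibbsMean τ).choose_spec.1.differentiableAt

lemma gibbsMean_sub_bounds (hV : Admissible V c₁ c₂ β) {a b : ℝ} (hab : a ≤ b) :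
    1 / c₂ * (b - a) ≤ gibbsMean V β b - gibbsMean V β a ∧
      gibbsMean V β b - gibbsMean V β a ≤ 1 / c₁ * (b - a) := by
  have h := hV.differentiable_gibbsMean
  constructor
  · exact mul_sub_le_image_sub_of_le_deriv h (fun τ => by
      obtain ⟨d, hd, h1, h2⟩ := hV.exists_hasDerivAt_gibbsMean τ
      rwa [hd.deriv]) hab
  · exact image_sub_le_mul_sub_of_deriv_le h (fun τ => by
      obtain ⟨d, hd, h1, h2⟩ := hV.exists_hasDerivAt_gibbsMean τ
      rwa [hd.deriv]) hab

lemma strictMono_gibbsMean (hV : Admissible V c₁ c₂ β) : StrictMono (gibbsMean V β) := by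
  intro a b hab
  have := (hV.gibbsMean_sub_bounds hab.le).1
  have h2 : 0 < 1 / c₂ * (b - a) := mul_pos (one_div_pos.2 hV.upper_pos) (sub_pos.2 hab)
  linarith

lemma surjective_gibbsMean (hV : Admissible V c₁ c₂ β) : Function.Surjective (gibbsMean V β) := by
  have hc := one_div_pos.2 hV.upper_pos
  refine hV.differentiable_gibbsMean.continuous.surjective ?_ ?_
  · refine tendsto_atTop_mono' _ ?_ (tendsto_atTop_add_const_left _ (gibbsMean V β 0)
      (tendsto_id.const_mul_atTop hc))
    filter_upwards [eventually_ge_atTop 0] with b hb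
    have := (hV.gibbsMean_sub_bounds hb).1
    simp only [id, sub_zero] at this ⊢
    linarith
  · refine tendsto_atBot_mono' _ ?_ (tendsto_atBot_add_const_left _ (gibbsMean V β 0)
      (tendsto_id.const_mul_atBot hc))
    filter_upwards [eventually_le_atBot 0] with b hb
    have := (hV.gibbsMean_sub_bounds hb).1
    simp only [id] at this ⊢
    linarith

lemma gibbsG_eq (τ : ℝ) : gibbsG V β τ = Real.log (gibbsIntegral V β 1 τ) := by
  simp [gibbsG, gibbsIntegral, gibbsWeight]

lemma hasDerivAt_gibbsG (hV : Admissible V c₁ c₂ β) (τ : ℝ) :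
    HasDerivAt (gibbsG V β) (β * gibbsMean V β τ) τ := by
  have h1 := hV.hasDerivAt_gibbsIntegral (h := 1) continuous_const one_le_exp_abs τ
  have e1 : (fun r : ℝ => r * (1 : ℝ → ℝ) r) = id := by ext; simp
  rw [e1] at h1
  have h2 := h1.log (hV.gibbsIntegral_one_pos τ).ne'
  have h3 : gibbsG V β = fun τ => Real.log (gibbsIntegral V β 1 τ) := funext gibbsG_eq
  rw [h3]
  exact h2.congr_deriv (by rw [gibbsMean]; ring)

/-- `G / β` lies above its tangents. -/
lemma gibbsG_tangent_le (hV : Admissible V c₁ c₂ β) (s τ : ℝ) :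
    β⁻¹ * gibbsG V β τ + gibbsMean V β τ * (s - τ) ≤ β⁻¹ * gibbsG V β s := by
  have hβ := hV.beta_pos
  have := nonneg_of_deriv_mul_nonneg
    (f := fun x => β⁻¹ * gibbsG V β (x + τ) - (β⁻¹ * gibbsG V β τ + gibbsMean V β τ * x))
    (f' := fun x => gibbsMean V β (x + τ) - gibbsMean V β τ) (fun x => by
      have h1 : HasDerivAt (fun x => gibbsG V β (x + τ)) (β * gibbsMean V β (x + τ)) x :=
        HasDerivAt.comp_add_const x τ (hV.hasDerivAt_gibbsG (x + τ))
      exact ((h1.const_mul β⁻¹).sub (((hasDerivAt_id x).const_mul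
        (gibbsMean V β τ)).const_add (β⁻¹ * gibbsG V β τ))).congr_deriv (by
          field_simp)) (by simp) (fun x => by
      rcases le_total 0 x with hx | hx
      · exact mul_nonneg (sub_nonneg.2 (hV.strictMono_gibbsMean.monotone (by linarith))) hx
      · exact mul_nonneg_of_nonpos_of_nonpos
          (sub_nonpos.2 (hV.strictMono_gibbsMean.monotone (by linarith))) hx) (s - τ)
  simp only [sub_add_cancel] at this
  linarith

/-- By the tangent inequality for `G / β`, the supremum at the elongation of tension `τ` is attained
at `τ`. The same inequality provides the upper bound without which the real supremum would be
meaningless. -/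
lemma freeEnergy_gibbsMean (hV : Admissible V c₁ c₂ β) (τ : ℝ) :
    freeEnergy V β (gibbsMean V β τ) = τ * gibbsMean V β τ - β⁻¹ * gibbsG V β τ := by
  have hle : ∀ s, s * gibbsMean V β τ - β⁻¹ * gibbsG V β s ≤
      τ * gibbsMean V β τ - β⁻¹ * gibbsG V β τ := fun s => by
    have := hV.gibbsG_tangent_le s τ
    linarith
  exact le_antisymm (ciSup_le hle) (le_ciSup (f := fun s => s * gibbsMean V β τ -
    β⁻¹ * gibbsG V β s) ⟨_, by rintro _ ⟨s, rfl⟩; exact hle s⟩ τ)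

/-- The tangent inequality for `G / β` at `s` gives the lower bound; the one at `τ` leaves an excess
`(s - τ)` times the difference of elongations, and `|s - τ|` is at most `c₂` times that difference.
Differentiability of `F` and both comparisons in the Clausius inequality come from here. -/
lemma freeEnergy_bounds (hV : Admissible V c₁ c₂ β) (s τ : ℝ) :
    τ * (gibbsMean V β s - gibbsMean V β τ) ≤
        freeEnergy V β (gibbsMean V β s) - freeEnergy V β (gibbsMean V β τ) ∧
      freeEnergy V β (gibbsMean V β s) - freeEnergy V β (gibbsMean V β τ) ≤
        τ * (gibbsMean V β s - gibbsMean V β τ) +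
          c₂ * (gibbsMean V β s - gibbsMean V β τ) ^ 2 := by
  rw [hV.freeEnergy_gibbsMean, hV.freeEnergy_gibbsMean]
  have h1 := hV.gibbsG_tangent_le τ s
  have h2 := hV.gibbsG_tangent_le s τ
  have h3 : (s - τ) * (gibbsMean V β s - gibbsMean V β τ) ≤
      c₂ * (gibbsMean V β s - gibbsMean V β τ) ^ 2 := by
    have hc := hV.upper_pos
    wlog hst : τ ≤ s generalizing s τ
    · have := this τ s h2 h1 (le_of_not_ge hst)
      linarith
    have h4 := (hV.gibbsMean_sub_bounds hst).1
    have h5 : s - τ ≤ c₂ * (gibbsMean V β s - gibbsMean V β τ) := by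
      rw [one_div, inv_mul_le_iff₀ hc] at h4; exact h4
    have h6 : 0 ≤ gibbsMean V β s - gibbsMean V β τ :=
      sub_nonneg.2 (hV.strictMono_gibbsMean.monotone hst)
    nlinarith
  constructor <;> linarith

lemma hasDerivAt_freeEnergy_gibbsMean (hV : Admissible V c₁ c₂ β) (τ : ℝ) :
    HasDerivAt (freeEnergy V β) τ (gibbsMean V β τ) := by
  rw [hasDerivAt_iff_isLittleO, Asymptotics.isLittleO_iff]
  intro ε hε
  have hc := hV.upper_pos
  filter_upwards [Metric.ball_mem_nhds (gibbsMean V β τ) (div_pos hε hc)] with y hy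
  obtain ⟨s, rfl⟩ := hV.surjective_gibbsMean y
  obtain ⟨h1, h2⟩ := hV.freeEnergy_bounds s τ
  rw [Metric.mem_ball, Real.dist_eq, lt_div_iff₀ hc] at hy
  rw [smul_eq_mul, Real.norm_eq_abs, Real.norm_eq_abs, abs_of_nonneg (by linarith)]
  have h3 : |gibbsMean V β s - gibbsMean V β τ| ^ 2 = (gibbsMean V β s - gibbsMean V β τ) ^ 2 :=
    sq_abs _
  have h4 := abs_nonneg (gibbsMean V β s - gibbsMean V β τ)
  nlinarith

lemma tension_gibbsMean (hV : Admissible V c₁ c₂ β) (τ : ℝ) :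
    tension V β (gibbsMean V β τ) = τ :=
  (hV.hasDerivAt_freeEnergy_gibbsMean τ).deriv

lemma gibbsMean_tension (hV : Admissible V c₁ c₂ β) (ρ : ℝ) :
    gibbsMean V β (tension V β ρ) = ρ := by
  obtain ⟨τ, rfl⟩ := hV.surjective_gibbsMean ρ
  rw [hV.tension_gibbsMean]

lemma tensionInv_eq (hV : Admissible V c₁ c₂ β) (τ : ℝ) :
    tensionInv V β τ = gibbsMean V β τ := by
  -- `Function.invFun` is some preimage; injectivity makes it the inverse.
  have hinj : Function.Injective (tension V β) := fun a b hab => by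
    rw [← hV.gibbsMean_tension a, hab, hV.gibbsMean_tension]
  apply hinj
  rw [hV.tension_gibbsMean]
  exact Function.invFun_eq ⟨_, hV.tension_gibbsMean τ⟩

lemma tension_tensionInv (hV : Admissible V c₁ c₂ β) (τ : ℝ) :
    tension V β (tensionInv V β τ) = τ := by
  rw [hV.tensionInv_eq, hV.tension_gibbsMean]

lemma tensionInv_tension (hV : Admissible V c₁ c₂ β) (ρ : ℝ) :
    tensionInv V β (tension V β ρ) = ρ := by
  rw [hV.tensionInv_eq, hV.gibbsMean_tension]

lemma continuous_tensionInv (hV : Admissible V c₁ c₂ β) : Continuous (tensionInv V β) := by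
  rw [show tensionInv V β = gibbsMean V β from funext hV.tensionInv_eq]
  exact hV.differentiable_gibbsMean.continuous

lemma hasDerivAt_freeEnergy (hV : Admissible V c₁ c₂ β) (ρ : ℝ) :
    HasDerivAt (freeEnergy V β) (tension V β ρ) ρ := by
  have := hV.hasDerivAt_freeEnergy_gibbsMean (tension V β ρ)
  rwa [hV.gibbsMean_tension] at this

lemma continuous_freeEnergy (hV : Admissible V c₁ c₂ β) : Continuous (freeEnergy V β) :=
  continuous_iff_continuousAt.2 fun ρ => (hV.hasDerivAt_freeEnergy ρ).continuousAt

lemma freeEnergy_sub_bounds (hV : Admissible V c₁ c₂ β) (a b : ℝ) :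
    tension V β b * (a - b) ≤ freeEnergy V β a - freeEnergy V β b ∧
      freeEnergy V β a - freeEnergy V β b ≤ tension V β b * (a - b) + c₂ * (a - b) ^ 2 := by
  have := hV.freeEnergy_bounds (tension V β a) (tension V β b)
  simpa only [hV.gibbsMean_tension] using this

lemma abs_tension_sub_le (hV : Admissible V c₁ c₂ β) (a b : ℝ) :
    |tension V β a - tension V β b| ≤ c₂ * |a - b| := by
  wlog hab : tension V β b ≤ tension V β a generalizing a b
  · rw [abs_sub_comm, abs_sub_comm a]; exact this b a (le_of_not_ge hab)
  have h4 := (hV.gibbsMean_sub_bounds hab).1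
  rw [hV.gibbsMean_tension, hV.gibbsMean_tension, one_div, inv_mul_le_iff₀ hV.upper_pos] at h4
  rw [abs_of_nonneg (sub_nonneg.2 hab)]
  exact h4.trans (mul_le_mul_of_nonneg_left (le_abs_self _) hV.upper_pos.le)

lemma continuous_tension (hV : Admissible V c₁ c₂ β) : Continuous (tension V β) := by
  refine LipschitzWith.continuous (K := ⟨c₂, hV.upper_pos.le⟩) (LipschitzWith.of_dist_le_mul ?_)
  intro a b
  rw [Real.dist_eq, Real.dist_eq]
  exact hV.abs_tension_sub_le a b

/-! ### The internal energy -/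

/-- The density of the momentum. -/
lemma integrable_gaussian (hV : Admissible V c₁ c₂ β) :
    Integrable (fun p : ℝ => Real.exp (-(β / 2) * p ^ 2)) ∧
      Integrable (fun p : ℝ => p ^ 2 / 2 * Real.exp (-(β / 2) * p ^ 2)) := by
  have hβ : 0 < β / 2 := half_pos hV.beta_pos
  refine ⟨integrable_exp_neg_mul_sq hβ, ?_⟩
  have := (integrable_rpow_mul_exp_neg_mul_sq hβ (s := 2) (by norm_num)).div_const 2
  refine this.congr (ae_of_all _ fun p => ?_)
  simp only [Real.rpow_ofNat]; ring

/-- Elongation and momentum are independent. `A` is the mean kinetic energy and `B` the mass of the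
momentum marginal; their values play no role in continuity and growth. -/
lemma internalEnergy_eq (hV : Admissible V c₁ c₂ β) : ∃ A B : ℝ, ∀ τ,
    internalEnergy V β τ = A + B * (gibbsIntegral V β V τ / gibbsIntegral V β 1 τ) := by
  obtain ⟨hg0, hg1⟩ := hV.integrable_gaussian
  set s := Real.sqrt (2 * Real.pi * β⁻¹) with hs
  have hs0 : 0 < s := by
    have := hV.beta_pos
    exact Real.sqrt_pos.2 (by positivity)
  refine ⟨(∫ p : ℝ, p ^ 2 / 2 * Real.exp (-(β / 2) * p ^ 2)) / s,
    (∫ p : ℝ, Real.exp (-(β / 2) * p ^ 2)) / s, fun τ => ?_⟩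
  obtain ⟨C, hC0, hC⟩ := hV.exists_abs_le
  have hZ := hV.gibbsIntegral_one_pos τ
  have hi := hV.integrable_gibbsWeight τ
  have hi1 : Integrable fun r => V r * gibbsWeight V β τ r :=
    hV.integrable_mul_gibbsWeight hV.continuous (exists_exp_bound hC0 hC) τ
  set Z := gibbsIntegral V β 1 τ with hZd
  have hden : ∀ z : ℝ × ℝ, Real.exp (-(β / 2) * (z.2 - 0) ^ 2 - β * V z.1 + β * τ * z.1 -
      gibbsG V β τ) / s = gibbsWeight V β τ z.1 * Real.exp (-(β / 2) * z.2 ^ 2) / (Z * s) := by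
    intro z
    rw [gibbsG_eq, Real.exp_sub, Real.exp_log hZ, sub_zero, gibbsWeight, ← Real.exp_add, div_div]
    congr 2; ring
  rw [internalEnergy, gibbsMeasure, integral_withDensity_eq_integral_toReal_smul₀]
  rotate_left
  · have := hV.continuous
    fun_prop
  · exact ae_of_all _ fun z => ENNReal.ofReal_lt_top
  have e : ∀ z : ℝ × ℝ, (ENNReal.ofReal (Real.exp (-(β / 2) * (z.2 - 0) ^ 2 - β * V z.1 +
      β * τ * z.1 - gibbsG V β τ) / s)).toReal • (z.2 ^ 2 / 2 + V z.1) =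
      (Z * s)⁻¹ * (gibbsWeight V β τ z.1 * (z.2 ^ 2 / 2 * Real.exp (-(β / 2) * z.2 ^ 2))) +
      (Z * s)⁻¹ * ((V z.1 * gibbsWeight V β τ z.1) * Real.exp (-(β / 2) * z.2 ^ 2)) := by
    intro z
    rw [ENNReal.toReal_ofReal (by positivity), hden, smul_eq_mul]
    ring
  simp only [← hs, e]
  rw [integral_add, integral_const_mul, integral_const_mul,
    show (volume : Measure (ℝ × ℝ)) = (volume : Measure ℝ).prod volume from rfl,
    integral_prod_mul (fun r => gibbsWeight V β τ r)
      (fun p : ℝ => p ^ 2 / 2 * Real.exp (-(β / 2) * p ^ 2)),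
    integral_prod_mul (fun r => V r * gibbsWeight V β τ r)
      (fun p : ℝ => Real.exp (-(β / 2) * p ^ 2))]
  · have e0 : ∫ r, gibbsWeight V β τ r = Z := by simp [hZd, gibbsIntegral]
    rw [e0, gibbsIntegral]
    generalize (∫ p : ℝ, p ^ 2 / 2 * Real.exp (-(β / 2) * p ^ 2)) = I
    generalize (∫ p : ℝ, Real.exp (-(β / 2) * p ^ 2)) = J
    field_simp
  · exact (hi.mul_prod hg1).const_mul _
  · exact (hi1.mul_prod hg0).const_mul _

lemma continuous_internalEnergy (hV : Admissible V c₁ c₂ β) :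
    Continuous (internalEnergy V β) := by
  obtain ⟨A, B, h⟩ := hV.internalEnergy_eq
  obtain ⟨C, hC0, hC⟩ := hV.exists_abs_le
  rw [show internalEnergy V β = fun τ => _ from funext h]
  refine continuous_const.add (continuous_const.mul (Continuous.div ?_ ?_ fun τ =>
    (hV.gibbsIntegral_one_pos τ).ne'))
  · exact continuous_iff_continuousAt.2 fun τ => (hV.hasDerivAt_gibbsIntegral hV.continuous
      (exists_exp_bound hC0 hC) τ).continuousAt
  · exact continuous_iff_continuousAt.2 fun τ => (hV.hasDerivAt_gibbsIntegral (h := 1)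
      continuous_const one_le_exp_abs τ).continuousAt

/-- `|V|` grows quadratically, and the second moment at mean `ρ` is `ρ²` plus a variance of at most
`1/(c₁ β)`. This growth makes the macroscopic energy an admissible test function of the block
averages. -/
lemma exists_internalEnergy_tension_le (hV : Admissible V c₁ c₂ β) :
    ∃ C, 0 ≤ C ∧ ∀ ρ, |internalEnergy V β (tension V β ρ)| ≤ C * (1 + ρ ^ 2) := by
  obtain ⟨A, B, h⟩ := hV.internalEnergy_eq
  obtain ⟨C, hC0, hC⟩ := hV.exists_abs_le
  have hβ := hV.beta_pos
  have hc := hV.pos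
  refine ⟨|A| + |B| * (C * (1 + 1 / (c₁ * β))), by positivity, fun ρ => ?_⟩
  set τ := tension V β ρ with hτ
  have hm : gibbsIntegral V β id τ / gibbsIntegral V β 1 τ = ρ := hV.gibbsMean_tension ρ
  have hZ := hV.gibbsIntegral_one_pos τ
  have hv := (hV.variance_bounds τ).1
  have hi := hV.integrable_gibbsWeight τ
  have hi2 := hV.integrable_sq_mul_gibbsWeight τ
  have hi1 : Integrable fun r => V r * gibbsWeight V β τ r :=
    hV.integrable_mul_gibbsWeight hV.continuous (exists_exp_bound hC0 hC) τ
  have e0 : ∫ r, gibbsWeight V β τ r = gibbsIntegral V β 1 τ := by simp [gibbsIntegral]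
  have hVb : |gibbsIntegral V β V τ| ≤
      C * (gibbsIntegral V β 1 τ + gibbsIntegral V β (fun r => r * r) τ) := by
    rw [← e0, gibbsIntegral, gibbsIntegral, ← integral_add hi hi2, ← integral_const_mul]
    refine abs_integral_le_integral_abs.trans (integral_mono hi1.abs
      ((hi.add hi2).const_mul C) fun r => ?_)
    have := mul_le_mul_of_nonneg_right (hC r) (gibbsWeight_pos V β τ r).le
    simp only [abs_mul, abs_of_pos (gibbsWeight_pos V β τ r)]
    nlinarith
  set Z := gibbsIntegral V β 1 τ
  set M := gibbsIntegral V β id τ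
  set S := gibbsIntegral V β (fun r => r * r) τ
  have hM : M = ρ * Z := by rw [← hm]; field_simp
  have hS : S ≤ (1 / (c₁ * β) + ρ ^ 2) * Z := by
    rw [hM] at hv
    have h1 : c₁ * β * (S - ρ ^ 2 * Z) * Z ≤ Z * Z := by nlinarith
    have h2 := le_of_mul_le_mul_right h1 hZ
    have h3 : S - ρ ^ 2 * Z ≤ Z / (c₁ * β) := by
      rw [le_div_iff₀ (by positivity)]; linarith
    have h4 : Z / (c₁ * β) = 1 / (c₁ * β) * Z := by ring
    linarith
  have hq : |gibbsIntegral V β V τ / Z| ≤ C * (1 + 1 / (c₁ * β) + ρ ^ 2) := by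
    rw [abs_div, abs_of_pos hZ, div_le_iff₀ hZ]
    refine hVb.trans ?_
    rw [mul_assoc]
    refine mul_le_mul_of_nonneg_left ?_ hC0
    linarith
  rw [h]
  refine (abs_add_le _ _).trans ?_
  rw [abs_mul]
  have h5 := mul_le_mul_of_nonneg_left hq (abs_nonneg B)
  have h6 : 0 ≤ |A| * ρ ^ 2 := by positivity
  have h7 : 0 ≤ |B| * (C * (1 / (c₁ * β) * ρ ^ 2)) := by positivity
  nlinarith

end Admissible

/-! ### Riemann–Stieltjes integrals -/

/-- The value of `∫_0^t f dg` obtained by integration by parts. -/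
noncomputable def stieltjesByParts (f g : ℝ → ℝ) (t : ℝ) : ℝ :=
  f t * g t - f 0 * g 0 - ∫ s in (0 : ℝ)..t, deriv f s * g s

lemma HasRSIntegral.unique {f g : ℝ → ℝ} {t I J : ℝ} (ht : 0 ≤ t)
    (hI : HasRSIntegral f g 0 t I) (hJ : HasRSIntegral f g 0 t J) : I = J := by
  refine eq_of_abs_sub_le_all fun ε hε => ?_
  obtain ⟨δ₁, hδ₁, h₁⟩ := hI (ε / 2) (half_pos hε)
  obtain ⟨δ₂, hδ₂, h₂⟩ := hJ (ε / 2) (half_pos hε)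
  -- A uniform partition finer than both moduli compares the two values.
  obtain ⟨n, hn⟩ := exists_nat_gt (t / min δ₁ δ₂)
  have hδ : 0 < min δ₁ δ₂ := lt_min hδ₁ hδ₂
  have hn0 : (0 : ℝ) < n := lt_of_le_of_lt (div_nonneg ht hδ.le) hn
  have hmono : Monotone fun i : ℕ => (i : ℝ) * (t / n) := fun i j hij =>
    mul_le_mul_of_nonneg_right (Nat.cast_le.2 hij) (by positivity)
  have hstep : ∀ i < n, ((i + 1 : ℕ) : ℝ) * (t / n) - (i : ℝ) * (t / n) < min δ₁ δ₂ := by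
    intro i _
    rw [div_lt_iff₀ hδ] at hn
    push_cast
    rw [← sub_mul, add_sub_cancel_left, one_mul, div_lt_iff₀ hn0]
    linarith
  have a := h₁ n _ (fun i => (i : ℝ) * (t / n)) hmono (by simp) (by field_simp)
    (fun i hi => (hstep i hi).trans_le (min_le_left _ _))
    (fun i _ => ⟨le_rfl, hmono (Nat.le_succ i)⟩)
  have b := h₂ n _ (fun i => (i : ℝ) * (t / n)) hmono (by simp) (by field_simp)
    (fun i hi => (hstep i hi).trans_le (min_le_right _ _))
    (fun i _ => ⟨le_rfl, hmono (Nat.le_succ i)⟩)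
  rw [abs_lt] at a b
  rw [abs_le]
  constructor <;> linarith

/-- A function of bounded variation on `[0, t]` is interval integrable there. -/
lemma intervalIntegrable_of_boundedVariationOn {g : ℝ → ℝ} {t : ℝ}
    (hg : BoundedVariationOn g (Icc 0 t)) {a b : ℝ} (ha : a ∈ Icc 0 t) (hb : b ∈ Icc 0 t) :
    IntervalIntegrable g volume a b := by
  obtain ⟨p, q, hp, hq, rfl⟩ := hg.locallyBoundedVariationOn.exists_monotoneOn_sub_monotoneOn
  have hsub : uIcc a b ⊆ Icc 0 t := uIcc_subset_Icc ha hb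
  exact (hp.mono hsub).intervalIntegrable.sub (hq.mono hsub).intervalIntegrable

/-- On one step `[a, b]` the error is `(f(ξ) - f(b)) (g(b) - g(a)) + ∫ f'(s) (g(s) - g(a)) ds`. Each
term is at most `sup |f'|` times the mesh times the variation of `g` over the step, and the
variations of the steps add up to the total one. -/
lemma hasRSIntegral_stieltjesByParts {f g : ℝ → ℝ} (hf : ContDiff ℝ 1 f) {t : ℝ} (ht : 0 ≤ t)
    (hg : BoundedVariationOn g (Icc 0 t)) :
    HasRSIntegral f g 0 t (stieltjesByParts f g t) := by
  have hfd : ∀ s, HasDerivAt f (deriv f s) s := fun s =>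
    (hf.differentiable one_ne_zero s).hasDerivAt
  have hfc : Continuous (deriv f) := hf.continuous_deriv le_rfl
  obtain ⟨K, hK⟩ := (isCompact_Icc (a := (0 : ℝ)) (b := t)).exists_bound_of_continuousOn
    hfc.continuousOn
  have hK0 : 0 ≤ K := (norm_nonneg _).trans (hK 0 ⟨le_rfl, ht⟩)
  set v : ℝ := (eVariationOn g (Icc 0 t)).toReal with hv
  have hv0 : 0 ≤ v := ENNReal.toReal_nonneg
  intro ε hε
  -- The two error terms add up to at most `2 K v` times the mesh; the `1` keeps the quotient
  -- meaningful when `K v = 0` and makes the final bound strict.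
  refine ⟨ε / (2 * K * v + 1), by positivity, fun n x ξ hx hx0 hxn hmesh hξ => ?_⟩
  set δ := ε / (2 * K * v + 1) with hδ
  have hxmem : ∀ i ≤ n, x i ∈ Icc 0 t := fun i hi => ⟨hx0 ▸ hx (Nat.zero_le i), hxn ▸ hx hi⟩
  have hlip : ∀ a ∈ Icc 0 t, ∀ b ∈ Icc 0 t, |f b - f a| ≤ K * |b - a| := fun a ha b hb =>
    (convex_Icc 0 t).norm_image_sub_le_of_norm_hasDerivWithin_le
      (fun s hs => (hfd s).hasDerivWithinAt) hK ha hb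
  -- the variation over one step
  set w : ℕ → ℝ := fun i => (eVariationOn g (Icc (x i) (x (i + 1)))).toReal with hw
  have hsubset : ∀ i < n, Icc (x i) (x (i + 1)) ⊆ Icc 0 t := fun i hi =>
    Icc_subset_Icc (hxmem i hi.le).1 (hxmem (i + 1) hi).2
  have hwg : ∀ i < n, ∀ a ∈ Icc (x i) (x (i + 1)), ∀ b ∈ Icc (x i) (x (i + 1)),
      |g a - g b| ≤ w i := fun i hi a ha b hb => by
    have := (hg.mono (hsubset i hi)).dist_le ha hb
    rwa [Real.dist_eq] at this
  have hwsum : ∑ i ∈ Finset.range n, w i = v := by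
    have h1 : ∀ m ≤ n, (∑ i ∈ Finset.range m, w i) =
        (eVariationOn g (Icc 0 (x m))).toReal := by
      intro m
      induction m with
      | zero => intro _; simp [hx0, eVariationOn.subsingleton]
      | succ m ih =>
        intro hm
        rw [Finset.sum_range_succ, ih (by omega), hw]
        rw [← ENNReal.toReal_add, ← hx0]
        · congr 1
          have := eVariationOn.Icc_add_Icc g (s := univ) (hx (Nat.zero_le m)) (hx (Nat.le_succ m))
            (mem_univ _)
          simpa using this
        · exact hg.mono (Icc_subset_Icc le_rfl (hxmem m (by omega)).2)
        · exact hg.mono (hsubset m (by omega))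
    rw [h1 n le_rfl, hxn]
  have hgi : ∀ i < n, IntervalIntegrable g volume (x i) (x (i + 1)) := fun i hi =>
    intervalIntegrable_of_boundedVariationOn hg (hxmem i hi.le) (hxmem (i + 1) hi)
  have hfgi : ∀ i < n, IntervalIntegrable (fun s => deriv f s * g s) volume (x i) (x (i + 1)) :=
    fun i hi => (hgi i hi).continuousOn_mul hfc.continuousOn
  have htel : stieltjesByParts f g t = ∑ i ∈ Finset.range n,
      (f (x (i + 1)) * g (x (i + 1)) - f (x i) * g (x i) -
        ∫ s in (x i)..(x (i + 1)), deriv f s * g s) := by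
    rw [Finset.sum_sub_distrib, Finset.sum_range_sub (fun i => f (x i) * g (x i)),
      intervalIntegral.sum_integral_adjacent_intervals hfgi, hx0, hxn, stieltjesByParts]
  rw [htel, ← Finset.sum_sub_distrib]
  have hterm : ∀ i ∈ Finset.range n, |f (ξ i) * (g (x (i + 1)) - g (x i)) -
      (f (x (i + 1)) * g (x (i + 1)) - f (x i) * g (x i) -
        ∫ s in (x i)..(x (i + 1)), deriv f s * g s)| ≤ 2 * K * δ * w i := by
    intro i hi
    rw [Finset.mem_range] at hi
    have hxi := hx (Nat.le_succ i)
    have hm := hmesh i hi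
    have hw0 : 0 ≤ w i := ENNReal.toReal_nonneg
    have hint : ∫ s in (x i)..(x (i + 1)), deriv f s = f (x (i + 1)) - f (x i) :=
      intervalIntegral.integral_eq_sub_of_hasDerivAt (fun s _ => hfd s)
        (hfc.intervalIntegrable _ _)
    have e1 : f (ξ i) * (g (x (i + 1)) - g (x i)) -
        (f (x (i + 1)) * g (x (i + 1)) - f (x i) * g (x i) -
          ∫ s in (x i)..(x (i + 1)), deriv f s * g s) =
        (f (ξ i) - f (x (i + 1))) * (g (x (i + 1)) - g (x i)) +
          ∫ s in (x i)..(x (i + 1)), deriv f s * (g s - g (x i)) := by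
      have : ∫ s in (x i)..(x (i + 1)), deriv f s * (g s - g (x i)) =
          (∫ s in (x i)..(x (i + 1)), deriv f s * g s) -
            (f (x (i + 1)) - f (x i)) * g (x i) := by
        rw [← hint, ← intervalIntegral.integral_mul_const, ← intervalIntegral.integral_sub
          (hfgi i hi) (by exact (hfc.mul continuous_const).intervalIntegrable _ _)]
        exact intervalIntegral.integral_congr fun s _ => by ring
      rw [this]; ring
    rw [e1]
    have b1 : |(f (ξ i) - f (x (i + 1))) * (g (x (i + 1)) - g (x i))| ≤ K * δ * w i := by
      rw [abs_mul]
      refine mul_le_mul ?_ (hwg i hi _ ⟨hxi, le_rfl⟩ _ ⟨le_rfl, hxi⟩) (abs_nonneg _)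
        (by positivity)
      refine (hlip _ (hxmem (i + 1) hi) _ (hsubset i hi (hξ i hi))).trans
        (mul_le_mul_of_nonneg_left ?_ hK0)
      have := hξ i hi
      rw [abs_le]; constructor <;> linarith [this.1, this.2]
    have b2 : |∫ s in (x i)..(x (i + 1)), deriv f s * (g s - g (x i))| ≤ K * δ * w i := by
      have := intervalIntegral.norm_integral_le_of_norm_le_const (a := x i) (b := x (i + 1))
        (f := fun s => deriv f s * (g s - g (x i))) (C := K * w i) (fun s hs => by
          rw [uIoc_of_le hxi] at hs
          have hs' : s ∈ Icc (x i) (x (i + 1)) := Ioc_subset_Icc_self hs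
          rw [norm_mul]
          exact mul_le_mul (hK s (hsubset i hi hs')) (hwg i hi s hs' _ ⟨le_rfl, hxi⟩)
            (norm_nonneg _) hK0)
      rw [Real.norm_eq_abs, abs_of_nonneg (sub_nonneg.2 hxi)] at this
      refine this.trans ?_
      have := mul_le_mul_of_nonneg_left hm.le (mul_nonneg hK0 hw0)
      linarith
    refine (abs_add_le _ _).trans ?_
    linarith
  refine (Finset.abs_sum_le_sum_abs _ _).trans_lt ((Finset.sum_le_sum hterm).trans_lt ?_)
  rw [← Finset.mul_sum, hwsum]
  have h0 : 0 < 2 * K * v + 1 := by positivity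
  have : δ * (2 * K * v + 1) = ε := by rw [hδ]; field_simp
  have hδ0 : 0 < δ := by positivity
  nlinarith

lemma HasRSIntegral.rsIntegral_eq {f g : ℝ → ℝ} {t I : ℝ} (ht : 0 ≤ t)
    (hI : HasRSIntegral f g 0 t I) : rsIntegral f g 0 t = I := by
  have h : ∃ I, HasRSIntegral f g 0 t I := ⟨I, hI⟩
  rw [rsIntegral, dif_pos h]
  exact HasRSIntegral.unique ht h.choose_spec hI

lemma HasBVLength.boundedVariationOn {r : ℝ → ℝ → ℝ} (h : HasBVLength r) {t : ℝ} (ht : 0 ≤ t) :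
    BoundedVariationOn (totalLength r) (Icc 0 t) := by
  have := h.2 0 t (mem_Ici.2 le_rfl) (mem_Ici.2 ht)
  refine this.mono fun s hs => ⟨hs.1, hs⟩

lemma HasBVLength.hasRSIntegral {τbar : ℝ → ℝ} (hτ : ContDiff ℝ 1 τbar) {r : ℝ → ℝ → ℝ}
    (h : HasBVLength r) {t : ℝ} (ht : 0 ≤ t) :
    HasRSIntegral τbar (totalLength r) 0 t (stieltjesByParts τbar (totalLength r) t) :=
  hasRSIntegral_stieltjesByParts hτ ht (h.boundedVariationOn ht)

/-- Replaces a value obtained by choice with an explicit formula, on which measurability,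
expectations and limits can be computed. -/
lemma HasBVLength.macroWork_eq {τbar : ℝ → ℝ} (hτ : ContDiff ℝ 1 τbar) {r : ℝ → ℝ → ℝ}
    (h : HasBVLength r) {t : ℝ} (ht : 0 ≤ t) :
    macroWork τbar r t = stieltjesByParts τbar (totalLength r) t :=
  (h.hasRSIntegral hτ ht).rsIntegral_eq ht


/-! ### The free energy inequality for the viscous system -/

lemma continuousOn_integral_unitInterval {f : ℝ → ℝ → ℝ}
    (hf : ContinuousOn (Function.uncurry f) (Ici 0 ×ˢ Icc 0 1)) :
    ContinuousOn (fun t => ∫ x in (0 : ℝ)..1, f t x) (Ici 0) := by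
  -- Clamping both variables extends `f` continuously to the plane and leaves it unchanged on the
  -- half-strip.
  set g : ℝ → ℝ → ℝ := fun t x => f (max t 0) (max 0 (min x 1)) with hg
  have hgc : Continuous (Function.uncurry g) := by
    have : Function.uncurry g = Function.uncurry f ∘
        fun y : ℝ × ℝ => (max y.1 0, max 0 (min y.2 1)) := rfl
    rw [this]
    refine hf.comp_continuous (by fun_prop) fun y =>
      ⟨mem_Ici.2 (le_max_right _ _), le_max_left _ _, ?_⟩
    exact max_le zero_le_one (min_le_right _ _)
  have := intervalIntegral.continuous_parametric_intervalIntegral_of_continuous'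
    (μ := volume) hgc 0 1
  refine this.continuousOn.congr fun t ht => intervalIntegral.integral_congr fun x hx => ?_
  rw [uIcc_of_le zero_le_one] at hx
  simp only [hg]
  rw [max_eq_left ht, min_eq_left hx.2, max_eq_right hx.1]

lemma intervalIntegrable_section {f : ℝ → ℝ → ℝ} {s : Set ℝ}
    (hf : ContinuousOn (Function.uncurry f) (s ×ˢ Icc 0 1)) {t : ℝ} (ht : t ∈ s) :
    IntervalIntegrable (f t) volume 0 1 := by
  refine ContinuousOn.intervalIntegrable ?_
  rw [uIcc_of_le zero_le_one]
  exact hf.comp (f := fun x => (t, x)) (by fun_prop) fun x hx => ⟨ht, hx⟩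

lemma hasDerivAt_integral_unitInterval {f f' : ℝ → ℝ → ℝ}
    (hf : ContinuousOn (Function.uncurry f) (Ici 0 ×ˢ Icc 0 1))
    (hf' : ContinuousOn (Function.uncurry f') (Ioi 0 ×ˢ Icc 0 1))
    (hd : ∀ t > 0, ∀ x ∈ Icc (0 : ℝ) 1, HasDerivAt (fun s => f s x) (f' t x) t)
    {t : ℝ} (ht : 0 < t) :
    HasDerivAt (fun s => ∫ x in (0 : ℝ)..1, f s x) (∫ x in (0 : ℝ)..1, f' t x) t := by
  -- Derivatives are continuous for positive times only, hence a compact time window away from `0`.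
  obtain ⟨C, hC⟩ := ((isCompact_Icc (a := t / 2) (b := 2 * t)).prod
    (isCompact_Icc (a := (0 : ℝ)) (b := 1))).exists_bound_of_continuousOn
    (hf'.mono (prod_mono (fun s hs => lt_of_lt_of_le (half_pos ht) hs.1) Subset.rfl))
  have hsub : ∀ x ∈ uIoc (0 : ℝ) 1, x ∈ Icc (0 : ℝ) 1 := fun x hx => by
    rw [uIoc_of_le zero_le_one] at hx; exact Ioc_subset_Icc_self hx
  refine (intervalIntegral.hasDerivAt_integral_of_dominated_loc_of_deriv_le
    (bound := fun _ => C) (s := Ioo (t / 2) (2 * t))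
    (Ioo_mem_nhds (by linarith) (by linarith)) ?_ ?_ ?_ ?_ ?_ ?_).2
  · filter_upwards [lt_mem_nhds ht] with s hs
    exact (intervalIntegrable_section hf (mem_Ici.2 hs.le)).def'.aestronglyMeasurable
  · exact intervalIntegrable_section hf (mem_Ici.2 ht.le)
  · exact (intervalIntegrable_section hf' (mem_Ioi.2 ht)).def'.aestronglyMeasurable
  · exact ae_of_all _ fun x hx s hs => hC (s, x) ⟨⟨hs.1.le, hs.2.le⟩, hsub x hx⟩
  · exact intervalIntegrable_const
  · exact ae_of_all _ fun x hx s hs => hd s (by have := hs.1; linarith) x (hsub x hx)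

namespace IsC12

variable {f : ℝ → ℝ → ℝ}

lemma hasDerivWithinAt_dx (h : IsC12 f) {t : ℝ} (ht : 0 < t) {x : ℝ} (hx : x ∈ Icc (0 : ℝ) 1) :
    HasDerivWithinAt (f t) (dx f t x) (Icc 0 1) x :=
  (h.diff_x t ht x hx).hasDerivWithinAt

lemma hasDerivWithinAt_dxx (h : IsC12 f) {t : ℝ} (ht : 0 < t) {x : ℝ} (hx : x ∈ Icc (0 : ℝ) 1) :
    HasDerivWithinAt (dx f t) (dx (dx f) t x) (Icc 0 1) x :=
  (h.diff_xx t ht x hx).hasDerivWithinAt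

lemma hasDerivAt_dt (h : IsC12 f) {t : ℝ} (ht : 0 < t) {x : ℝ} (hx : x ∈ Icc (0 : ℝ) 1) :
    HasDerivAt (fun s => f s x) (dt f t x) t :=
  (h.diff_t t ht x hx).hasDerivAt

end IsC12

/-- The fundamental theorem of calculus on `[0, 1]` with one-sided derivatives at the ends. -/
lemma integral_eq_sub_of_hasDerivWithinAt_unitInterval {u u' : ℝ → ℝ}
    (hu : ∀ x ∈ Icc (0 : ℝ) 1, HasDerivWithinAt u (u' x) (Icc 0 1) x)
    (hi : IntervalIntegrable u' volume 0 1) : ∫ x in (0 : ℝ)..1, u' x = u 1 - u 0 :=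
  intervalIntegral.integral_eq_sub_of_hasDerivAt_of_le zero_le_one
    (fun x hx => (hu x hx).continuousWithinAt)
    (fun x hx => (hu x (Ioo_subset_Icc_self hx)).hasDerivAt (Icc_mem_nhds hx.1 hx.2)) hi

lemma integral_congr_Ioo {u v : ℝ → ℝ} (h : ∀ x ∈ Ioo (0 : ℝ) 1, u x = v x) :
    ∫ x in (0 : ℝ)..1, u x = ∫ x in (0 : ℝ)..1, v x := by
  rw [intervalIntegral.integral_of_le zero_le_one, intervalIntegral.integral_of_le zero_le_one,
    integral_Ioc_eq_integral_Ioo, integral_Ioc_eq_integral_Ioo]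
  exact setIntegral_congr_fun measurableSet_Ioo h

/-- The macroscopic free energy `∫ (p²/2 + F(r)) dx`. -/
noncomputable def totalFreeEnergy (V : ℝ → ℝ) (β : ℝ) (r p : ℝ → ℝ → ℝ) (t : ℝ) : ℝ :=
  ∫ x in (0 : ℝ)..1, (p t x ^ 2 / 2 + freeEnergy V β (r t x))

namespace IsViscousSolution

variable {V : ℝ → ℝ} {c₁ c₂ β δ₁ δ₂ : ℝ} {τbar : ℝ → ℝ} {r p : ℝ → ℝ → ℝ}

lemma continuousOn_freeEnergyDensity (h : IsViscousSolution V β τbar δ₁ δ₂ r p)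
    (hV : Admissible V c₁ c₂ β) : ContinuousOn
      (Function.uncurry fun t x => p t x ^ 2 / 2 + freeEnergy V β (r t x)) (Ici 0 ×ˢ Icc 0 1) :=
  ((h.regular_p.cont.pow 2).div_const 2).add
    (hV.continuous_freeEnergy.comp_continuousOn h.regular_r.cont)

/-- The boundary condition bears on `r`. A Lipschitz function of `r` inherits a vanishing
derivative, so no derivative of `τ_β` is involved. -/
lemma dx_tension_zero (h : IsViscousSolution V β τbar δ₁ δ₂ r p) (hV : Admissible V c₁ c₂ β)
    {t : ℝ} (ht : 0 < t) : dx (fun t x => tension V β (r t x)) t 0 = 0 := by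
  have h0 : (0 : ℝ) ∈ Icc (0 : ℝ) 1 := ⟨le_rfl, zero_le_one⟩
  have h1 := h.regular_r.hasDerivWithinAt_dx ht h0
  rw [h.dr_zero t ht, hasDerivWithinAt_iff_isLittleO] at h1
  have h2 : HasDerivWithinAt (fun x => tension V β (r t x)) 0 (Icc 0 1) 0 := by
    rw [hasDerivWithinAt_iff_isLittleO]
    refine Asymptotics.IsBigO.trans_isLittleO
      (Asymptotics.IsBigO.of_bound c₂ (Eventually.of_forall fun x => ?_)) h1
    simpa using hV.abs_tension_sub_le (r t x) (r t 0)
  exact h2.derivWithin (uniqueDiffOn_Icc zero_lt_one 0 h0)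

/-- The first equation is a conservation law with flux `p + δ₁ ∂_x τ_β(r)`, which vanishes at `x =
0`; the flux at `x = 1` remains. -/
lemma hasDerivAt_totalLength (h : IsViscousSolution V β τbar δ₁ δ₂ r p)
    (hV : Admissible V c₁ c₂ β) {t : ℝ} (ht : 0 < t) :
    HasDerivAt (totalLength r)
      (p t 1 + δ₁ * dx (fun t x => tension V β (r t x)) t 1) t := by
  refine (hasDerivAt_integral_unitInterval h.regular_r.cont h.regular_r.cont_t
    (fun t ht x hx => h.regular_r.hasDerivAt_dt ht hx) ht).congr_deriv ?_
  have hFTC := integral_eq_sub_of_hasDerivWithinAt_unitInterval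
    (u := fun x => p t x + δ₁ * dx (fun t x => tension V β (r t x)) t x)
    (fun x hx => (h.regular_p.hasDerivWithinAt_dx ht hx).add
      ((h.regular_tension.hasDerivWithinAt_dxx ht hx).const_mul δ₁))
    ((intervalIntegrable_section h.regular_p.cont_x (mem_Ioi.2 ht)).add
      ((intervalIntegrable_section h.regular_tension.cont_xx (mem_Ioi.2 ht)).const_mul δ₁))
  rw [h.p_zero t ht, h.dx_tension_zero hV ht] at hFTC
  rw [integral_congr_Ioo (v := fun x => dx p t x +
    δ₁ * dx (dx fun t x => tension V β (r t x)) t x) fun x hx => by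
      have := h.eq_r t ht x hx; linarith, hFTC]
  ring

/-- The density changes at the rate `∂_x (p τ + δ₂ p ∂_x p + δ₁ τ ∂_x τ) - δ₂ (∂_x p)² - δ₁ (∂_x
τ)²`, with `τ = τ_β(r)`. The boundary conditions kill the flux at `0` and reduce it at `1` to `τbar`
times the rate of change of the length; the squares are the dissipation. -/
lemma exists_hasDerivAt_totalFreeEnergy (h : IsViscousSolution V β τbar δ₁ δ₂ r p)
    (hV : Admissible V c₁ c₂ β) (hδ₁ : 0 < δ₁) (hδ₂ : 0 < δ₂) {t : ℝ} (ht : 0 < t) :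
    ∃ d, HasDerivAt (totalFreeEnergy V β r p) d t ∧
      d ≤ τbar t * (p t 1 + δ₁ * dx (fun t x => tension V β (r t x)) t 1) := by
  set T : ℝ → ℝ → ℝ := fun t x => tension V β (r t x) with hT
  have hTc : ContinuousOn (Function.uncurry T) (Ioi 0 ×ˢ Icc 0 1) :=
    h.regular_tension.cont.mono (prod_mono Ioi_subset_Ici_self Subset.rfl)
  have hpc : ContinuousOn (Function.uncurry p) (Ioi 0 ×ˢ Icc 0 1) :=
    h.regular_p.cont.mono (prod_mono Ioi_subset_Ici_self Subset.rfl)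
  have hderiv := hasDerivAt_integral_unitInterval
    (f := fun t x => p t x ^ 2 / 2 + freeEnergy V β (r t x))
    (f' := fun t x => p t x * dt p t x + T t x * dt r t x)
    (h.continuousOn_freeEnergyDensity hV)
    ((hpc.mul h.regular_p.cont_t).add (hTc.mul h.regular_r.cont_t))
    (fun t ht x hx => by
      have h1 := ((h.regular_p.hasDerivAt_dt ht hx).pow 2).div_const 2
      have h2 := (hV.hasDerivAt_freeEnergy (r t x)).comp t (h.regular_r.hasDerivAt_dt ht hx)
      exact (h1.add h2).congr_deriv (by simp [hT]; ring)) ht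
  refine ⟨_, hderiv, ?_⟩
  set u : ℝ → ℝ := fun x => p t x * T t x + δ₂ * (p t x * dx p t x) + δ₁ * (T t x * dx T t x)
  set D : ℝ → ℝ := fun x => δ₂ * dx p t x ^ 2 + δ₁ * dx T t x ^ 2 with hD
  set u' : ℝ → ℝ := fun x => dx p t x * T t x + p t x * dx T t x +
    δ₂ * (dx p t x * dx p t x + p t x * dx (dx p) t x) +
    δ₁ * (dx T t x * dx T t x + T t x * dx (dx T) t x) with hu'
  have hDc : ContinuousOn D (Icc 0 1) := by
    have h1 : ContinuousOn (dx p t) (Icc 0 1) :=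
      h.regular_p.cont_x.comp (f := fun x => (t, x)) (by fun_prop) fun x hx => ⟨ht, hx⟩
    have h2 : ContinuousOn (dx T t) (Icc 0 1) :=
      h.regular_tension.cont_x.comp (f := fun x => (t, x)) (by fun_prop) fun x hx => ⟨ht, hx⟩
    exact (continuousOn_const.mul (h1.pow 2)).add (continuousOn_const.mul (h2.pow 2))
  have hDi : IntervalIntegrable D volume 0 1 := by
    refine ContinuousOn.intervalIntegrable ?_
    rwa [uIcc_of_le zero_le_one]
  have hi : IntervalIntegrable u' volume 0 1 := by
    refine intervalIntegrable_section (f := fun t x => dx p t x * T t x + p t x * dx T t x +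
      δ₂ * (dx p t x * dx p t x + p t x * dx (dx p) t x) +
      δ₁ * (dx T t x * dx T t x + T t x * dx (dx T) t x)) (s := Ioi 0) ?_ (mem_Ioi.2 ht)
    have a1 := h.regular_p.cont_x
    have a2 := h.regular_p.cont_xx
    have a3 := h.regular_tension.cont_x
    have a4 := h.regular_tension.cont_xx
    exact ((((a1.mul hTc).add (hpc.mul a3)).add (continuousOn_const.mul ((a1.mul a1).add
      (hpc.mul a2)))).add (continuousOn_const.mul ((a3.mul a3).add (hTc.mul a4))))
  have hFTC : ∫ x in (0 : ℝ)..1, u' x = u 1 - u 0 :=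
    integral_eq_sub_of_hasDerivWithinAt_unitInterval (fun x hx => by
      have b1 := h.regular_p.hasDerivWithinAt_dx ht hx
      have b2 := h.regular_p.hasDerivWithinAt_dxx ht hx
      have b3 : HasDerivWithinAt (T t) (dx T t x) (Icc 0 1) x :=
        h.regular_tension.hasDerivWithinAt_dx ht hx
      have b4 : HasDerivWithinAt (dx T t) (dx (dx T) t x) (Icc 0 1) x :=
        h.regular_tension.hasDerivWithinAt_dxx ht hx
      exact ((b1.mul b3).add ((b1.mul b2).const_mul δ₂)).add ((b3.mul b4).const_mul δ₁)) hi
  have e : ∫ x in (0 : ℝ)..1, (p t x * dt p t x + T t x * dt r t x) =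
      (∫ x in (0 : ℝ)..1, u' x) - ∫ x in (0 : ℝ)..1, D x := by
    rw [← intervalIntegral.integral_sub hi hDi]
    refine integral_congr_Ioo fun x hx => ?_
    have e1 := h.eq_r t ht x hx
    have e2 := h.eq_p t ht x hx
    have e3 : dt r t x = dx p t x + δ₁ * dx (dx T) t x := by rw [← e1]; ring
    have e4 : dt p t x = dx T t x + δ₂ * dx (dx p) t x := by rw [← e2]; ring
    rw [e3, e4, hu', hD]
    ring
  have hD0 : 0 ≤ ∫ x in (0 : ℝ)..1, D x :=
    intervalIntegral.integral_nonneg zero_le_one fun x _ => by positivity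
  have hu0 : u 0 = 0 := by
    simp only [u]
    rw [h.p_zero t ht, h.dx_tension_zero hV ht]; ring
  have hu1 : u 1 = τbar t * (p t 1 + δ₁ * dx T t 1) := by
    have : T t 1 = τbar t := h.tension_one t ht
    simp only [u]
    rw [h.dp_one t ht, this]; ring
  rw [e, hFTC, hu0, hu1]
  linarith

/-- The free energy inequality, integrated in time. -/
lemma totalFreeEnergy_le (h : IsViscousSolution V β τbar δ₁ δ₂ r p)
    (hV : Admissible V c₁ c₂ β) (hδ₁ : 0 < δ₁) (hδ₂ : 0 < δ₂) (hτ : ContDiff ℝ 1 τbar)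
    {t : ℝ} (ht : 0 ≤ t) :
    totalFreeEnergy V β r p t - totalFreeEnergy V β r p 0 ≤
      stieltjesByParts τbar (totalLength r) t := by
  have hτd : ∀ s, HasDerivAt τbar (deriv τbar s) s := fun s =>
    (hτ.differentiable one_ne_zero s).hasDerivAt
  have hτc : Continuous (deriv τbar) := hτ.continuous_deriv le_rfl
  have hHc : ContinuousOn (totalFreeEnergy V β r p) (Ici 0) :=
    continuousOn_integral_unitInterval (h.continuousOn_freeEnergyDensity hV)
  have hLc : ContinuousOn (totalLength r) (Ici 0) :=
    continuousOn_integral_unitInterval h.regular_r.cont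
  have hmc : ContinuousOn (fun s => deriv τbar s * totalLength r s) (Ici 0) :=
    hτc.continuousOn.mul hLc
  have hsub : ∀ {s : ℝ}, 0 ≤ s → uIcc 0 s ⊆ Ici 0 := fun {s} hs x hx => by
    rw [uIcc_of_le hs] at hx; exact hx.1
  have hic : ContinuousOn (fun s => ∫ y in (0 : ℝ)..s, deriv τbar y * totalLength r y)
      (Icc 0 t) := by
    have := intervalIntegral.continuousOn_primitive_interval' (μ := volume) (a := 0)
      (b₁ := 0) (b₂ := t) (hmc.mono (hsub ht)).intervalIntegrable left_mem_uIcc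
    rwa [uIcc_of_le ht] at this
  -- This is the free energy minus the work in by-parts form, up to a constant. Its derivative is
  -- nonpositive at positive times, and continuity includes time `0`.
  have hanti : AntitoneOn (fun s => totalFreeEnergy V β r p s - τbar s * totalLength r s +
      ∫ y in (0 : ℝ)..s, deriv τbar y * totalLength r y) (Icc 0 t) := by
    have hd : ∀ s ∈ Ioo 0 t, ∃ d ≤ 0, HasDerivAt (fun s => totalFreeEnergy V β r p s -
        τbar s * totalLength r s + ∫ y in (0 : ℝ)..s, deriv τbar y * totalLength r y) d s := by
      intro s hs
      obtain ⟨d, hd, hle⟩ := h.exists_hasDerivAt_totalFreeEnergy hV hδ₁ hδ₂ hs.1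
      have h1 := h.hasDerivAt_totalLength hV hs.1
      have hnhds : Ici (0 : ℝ) ∈ 𝓝 s := Ici_mem_nhds hs.1
      have h2 := intervalIntegral.integral_hasDerivAt_right
        (hmc.mono (hsub hs.1.le)).intervalIntegrable
        (hmc.stronglyMeasurableAtFilter_nhdsWithin measurableSet_Ici s |>.filter_mono
          (by rw [nhdsWithin_eq_nhds.2 hnhds]))
        (hmc.continuousAt hnhds)
      refine ⟨_, ?_, (hd.sub ((hτd s).mul h1)).add h2⟩
      linarith
    refine antitoneOn_of_deriv_nonpos (convex_Icc 0 t) ?_ ?_ ?_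
    · exact ((hHc.mono Icc_subset_Ici_self).sub (hτ.continuous.continuousOn.mul
        (hLc.mono Icc_subset_Ici_self))).add hic
    · rw [interior_Icc]
      intro s hs
      obtain ⟨d, -, hd⟩ := hd s hs
      exact hd.differentiableAt.differentiableWithinAt
    · rw [interior_Icc]
      intro s hs
      obtain ⟨d, hd0, hd⟩ := hd s hs
      rwa [hd.deriv]
  have := hanti ⟨le_rfl, ht⟩ ⟨ht, le_rfl⟩ ht
  simp only [intervalIntegral.integral_same] at this
  rw [stieltjesByParts]
  linarith

lemma intervalIntegrable_initialError (h : IsViscousSolution V β τbar δ₁ δ₂ r p) (c ρ : ℝ) :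
    IntervalIntegrable (fun x => p 0 x ^ 2 / 2 + c * (r 0 x - ρ) ^ 2) volume 0 1 := by
  refine intervalIntegrable_section (f := fun t x => p t x ^ 2 / 2 + c * (r t x - ρ) ^ 2)
    (s := Ici 0) ?_ (mem_Ici.2 le_rfl)
  exact ((h.regular_p.cont.pow 2).div_const 2).add (continuousOn_const.mul
    ((h.regular_r.cont.sub continuousOn_const).pow 2))

/-- A form of the free energy inequality that only involves the initial profile and the length,
and passes to the limit of vanishing viscosity. -/
lemma clausius_approx (h : IsViscousSolution V β τbar δ₁ δ₂ r p)
    (hV : Admissible V c₁ c₂ β) (hδ₁ : 0 < δ₁) (hδ₂ : 0 < δ₂) (hτ : ContDiff ℝ 1 τbar)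
    {t : ℝ} (ht : 0 ≤ t) (ρ₀ : ℝ) (hρ₀ : tension V β ρ₀ = τbar 0) (ρ₁ : ℝ)
    (hρ₁ : tension V β ρ₁ = τbar t) :
    freeEnergy V β ρ₁ - τbar t * ρ₁ ≤ freeEnergy V β ρ₀ - τbar 0 * ρ₀ +
      (∫ x in (0 : ℝ)..1, (p 0 x ^ 2 / 2 + c₂ * (r 0 x - ρ₀) ^ 2)) -
        ∫ s in (0 : ℝ)..t, deriv τbar s * totalLength r s := by
  have h1 := h.totalFreeEnergy_le hV hδ₁ hδ₂ hτ ht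
  have hri : ∀ s, 0 ≤ s → IntervalIntegrable (r s) volume 0 1 := fun s hs =>
    intervalIntegrable_section h.regular_r.cont (mem_Ici.2 hs)
  have hei : ∀ s, 0 ≤ s → IntervalIntegrable
      (fun x => p s x ^ 2 / 2 + freeEnergy V β (r s x)) volume 0 1 := fun s hs =>
    intervalIntegrable_section (h.continuousOn_freeEnergyDensity hV) (mem_Ici.2 hs)
  -- The kinetic energy is dropped and `F` is bounded below by its tangent at `ρ₁`. The slope is
  -- `τbar t`, so the length at time `t` will cancel against the boundary term of the work.
  have h2 : freeEnergy V β ρ₁ + τbar t * (totalLength r t - ρ₁) ≤ totalFreeEnergy V β r p t := by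
    have e : freeEnergy V β ρ₁ + τbar t * (totalLength r t - ρ₁) =
        ∫ x in (0 : ℝ)..1, (freeEnergy V β ρ₁ + τbar t * (r t x - ρ₁)) := by
      rw [intervalIntegral.integral_add intervalIntegrable_const
        (((hri t ht).sub intervalIntegrable_const).const_mul _),
        intervalIntegral.integral_const_mul, intervalIntegral.integral_sub (hri t ht)
        intervalIntegrable_const, totalLength]
      simp
    rw [e]
    refine intervalIntegral.integral_mono_on zero_le_one (intervalIntegrable_const.add
        (((hri t ht).sub intervalIntegrable_const).const_mul _)) (hei t ht) fun x _ => ?_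
    have := (hV.freeEnergy_sub_bounds (r t x) ρ₁).1
    rw [hρ₁] at this
    nlinarith [sq_nonneg (p t x)]
  have hqi := h.intervalIntegrable_initialError c₂ ρ₀
  -- At time `0` an upper bound is needed: tangent plus parabola at `ρ₀`. The linear part cancels
  -- the boundary term, and the quadratic part is controlled by the `L²` distance of the initial
  -- data.
  have h3 : totalFreeEnergy V β r p 0 ≤ freeEnergy V β ρ₀ + τbar 0 * (totalLength r 0 - ρ₀) +
      ∫ x in (0 : ℝ)..1, (p 0 x ^ 2 / 2 + c₂ * (r 0 x - ρ₀) ^ 2) := by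
    have e : freeEnergy V β ρ₀ + τbar 0 * (totalLength r 0 - ρ₀) +
        (∫ x in (0 : ℝ)..1, (p 0 x ^ 2 / 2 + c₂ * (r 0 x - ρ₀) ^ 2)) =
        ∫ x in (0 : ℝ)..1, ((freeEnergy V β ρ₀ + τbar 0 * (r 0 x - ρ₀)) +
          (p 0 x ^ 2 / 2 + c₂ * (r 0 x - ρ₀) ^ 2)) := by
      rw [intervalIntegral.integral_add (intervalIntegrable_const.add
        (((hri 0 le_rfl).sub intervalIntegrable_const).const_mul _)) hqi,
        intervalIntegral.integral_add intervalIntegrable_const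
        (((hri 0 le_rfl).sub intervalIntegrable_const).const_mul _),
        intervalIntegral.integral_const_mul, intervalIntegral.integral_sub (hri 0 le_rfl)
        intervalIntegrable_const, totalLength]
      simp
    rw [e]
    refine intervalIntegral.integral_mono_on zero_le_one (hei 0 le_rfl)
      ((intervalIntegrable_const.add
        (((hri 0 le_rfl).sub intervalIntegrable_const).const_mul _)).add hqi) fun x _ => ?_
    have := (hV.freeEnergy_sub_bounds (r 0 x) ρ₀).2
    rw [hρ₀] at this
    linarith
  rw [stieltjesByParts] at h1
  linarith

end IsViscousSolution

/-- The Clausius inequality for vanishing viscosity solutions. -/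
lemma IsVanishingViscositySolution.clausius {V : ℝ → ℝ} {c₁ c₂ β : ℝ} {τbar : ℝ → ℝ}
    {r p : ℝ → ℝ → ℝ} (h : IsVanishingViscositySolution V β τbar r p)
    (hV : Admissible V c₁ c₂ β) (hτ : ContDiff ℝ 1 τbar)
    (hstart : StartsAtEquilibrium V β (τbar 0) r p) (hBV : HasBVLength r) {t : ℝ} (ht : 0 ≤ t) :
    freeEnergy V β (tensionInv V β (τbar t)) - τbar t * tensionInv V β (τbar t) ≤
      freeEnergy V β (tensionInv V β (τbar 0)) - τbar 0 * tensionInv V β (τbar 0) -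
        ∫ s in (0 : ℝ)..t, deriv τbar s * totalLength r s := by
  obtain ⟨δ₁, δ₂, rδ, pδ, hδ₁, hδ₂, -, -, hsol, hinit, hlim⟩ := h
  set ρ₀ := tensionInv V β (τbar 0)
  have hτc : Continuous (deriv τbar) := hτ.continuous_deriv le_rfl
  have hc₂ := hV.upper_pos
  -- the initial error
  have herr : Tendsto (fun n => ∫ x in (0 : ℝ)..1,
      (pδ n 0 x ^ 2 / 2 + c₂ * (rδ n 0 x - ρ₀) ^ 2)) atTop (𝓝 0) := by
    -- `1/2 + c₂` exceeds both coefficients of the initial error.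
    have hmul := ENNReal.Tendsto.const_mul (a := ENNReal.ofReal (1 / 2 + c₂)) hinit
      (Or.inr ENNReal.ofReal_ne_top)
    rw [mul_zero] at hmul
    have hinit' := (ENNReal.tendsto_toReal ENNReal.zero_ne_top).comp hmul
    have hfin : ∀ᶠ n in atTop, ENNReal.ofReal (1 / 2 + c₂) * ∫⁻ x in Icc (0 : ℝ) 1,
        ENNReal.ofReal ((rδ n 0 x - r 0 x) ^ 2 + (pδ n 0 x - p 0 x) ^ 2) < ∞ := by
      filter_upwards [hinit.eventually (gt_mem_nhds one_pos)] with n hn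
      exact ENNReal.mul_lt_top ENNReal.ofReal_lt_top (hn.trans ENNReal.one_lt_top)
    rw [ENNReal.toReal_zero] at hinit'
    refine squeeze_zero' (Eventually.of_forall fun n =>
      intervalIntegral.integral_nonneg zero_le_one fun x _ => by positivity) ?_ hinit'
    filter_upwards [hfin] with n hn
    rw [intervalIntegral.integral_of_le zero_le_one, ← integral_Icc_eq_integral_Ioc,
      integral_eq_lintegral_of_nonneg_ae (ae_of_all _ fun x => by positivity)]
    · refine ENNReal.toReal_mono hn.ne ?_
      simp only
      rw [← lintegral_const_mul' _ _ ENNReal.ofReal_ne_top]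
      refine lintegral_mono_ae ?_
      filter_upwards [hstart] with x hx
      rw [← ENNReal.ofReal_mul (by positivity), hx.1, hx.2]
      refine ENNReal.ofReal_le_ofReal ?_
      nlinarith [sq_nonneg (pδ n 0 x), sq_nonneg (rδ n 0 x - ρ₀),
        mul_nonneg hc₂.le (sq_nonneg (pδ n 0 x))]
    · have := (hsol n).intervalIntegrable_initialError c₂ ρ₀
      rw [intervalIntegrable_iff_integrableOn_Icc_of_le zero_le_one] at this
      exact this.aestronglyMeasurable
  -- the work
  have hLi : IntervalIntegrable (fun s => deriv τbar s * totalLength r s) volume 0 t :=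
    (intervalIntegrable_of_boundedVariationOn (hBV.boundedVariationOn ht) ⟨le_rfl, ht⟩
      ⟨ht, le_rfl⟩).continuousOn_mul hτc.continuousOn
  have hLδi : ∀ n, IntervalIntegrable (fun s => deriv τbar s * totalLength (rδ n) s)
      volume 0 t := fun n => by
    refine ContinuousOn.intervalIntegrable ?_
    rw [uIcc_of_le ht]
    exact hτc.continuousOn.mul ((continuousOn_integral_unitInterval
      (hsol n).regular_r.cont).mono Icc_subset_Ici_self)
  obtain ⟨K, hK⟩ := (isCompact_Icc (a := (0 : ℝ)) (b := t)).exists_bound_of_continuousOn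
    hτc.continuousOn
  -- The difference is at most `sup |τbar'|` times the `L¹` distance of the profiles on `[0, t] ×
  -- [0, 1]`.
  have hwork : Tendsto (fun n => ∫ s in (0 : ℝ)..t, deriv τbar s * totalLength (rδ n) s) atTop
      (𝓝 (∫ s in (0 : ℝ)..t, deriv τbar s * totalLength r s)) := by
    rw [tendsto_iff_edist_tendsto_0]
    have hlim' := ENNReal.Tendsto.const_mul (a := ENNReal.ofReal K) (hlim t)
      (Or.inr ENNReal.ofReal_ne_top)
    rw [mul_zero] at hlim'
    refine tendsto_of_tendsto_of_tendsto_of_le_of_le tendsto_const_nhds hlim'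
      (fun _ => zero_le) fun n => ?_
    simp only
    rw [edist_eq_enorm_sub, ← intervalIntegral.integral_sub (hLδi n) hLi,
      intervalIntegral.integral_of_le ht]
    refine (enorm_integral_le_lintegral_enorm _).trans ?_
    rw [← lintegral_const_mul' _ _ ENNReal.ofReal_ne_top]
    refine setLIntegral_mono' measurableSet_Ioc fun s hs => ?_
    have hs0 : 0 ≤ s := hs.1.le
    rw [← mul_sub, enorm_mul]
    refine mul_le_mul' ?_ ?_
    · rw [← ofReal_norm]
      exact ENNReal.ofReal_le_ofReal (hK s (Ioc_subset_Icc_self hs))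
    · have hri : IntervalIntegrable (r s) volume 0 1 := by
        rw [intervalIntegrable_iff_integrableOn_Icc_of_le zero_le_one]
        exact hBV.1 s hs0
      rw [totalLength, totalLength, ← intervalIntegral.integral_sub
        (intervalIntegrable_section (hsol n).regular_r.cont (mem_Ici.2 hs0)) hri,
        intervalIntegral.integral_of_le zero_le_one, ← integral_Icc_eq_integral_Ioc]
      refine (enorm_integral_le_lintegral_enorm _).trans (lintegral_mono fun x => ?_)
      rw [← ofReal_norm]
      exact ENNReal.ofReal_le_ofReal (le_add_of_nonneg_right (abs_nonneg _))
  have := le_of_tendsto_of_tendsto' tendsto_const_nhds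
    ((tendsto_const_nhds (x := freeEnergy V β ρ₀ - τbar 0 * ρ₀)).add herr |>.sub hwork)
    fun n => (hsol n).clausius_approx hV (hδ₁ n) (hδ₂ n) hτ ht ρ₀
      (hV.tension_tensionInv _) (tensionInv V β (τbar t)) (hV.tension_tensionInv _)
  simpa using this


/-! ### Calculus for the generator -/

section Calculus

variable {N : ℕ} {f g : Phase N → ℝ}

lemma dirDeriv_mul (hf : Differentiable ℝ f) (hg : Differentiable ℝ g) (v z : Phase N) :
    dirDeriv v (fun z => f z * g z) z = f z * dirDeriv v g z + g z * dirDeriv v f z := by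
  rw [dirDeriv, fderiv_fun_mul (hf z) (hg z)]
  simp [dirDeriv]

lemma dirDeriv_add (hf : Differentiable ℝ f) (hg : Differentiable ℝ g) (v z : Phase N) :
    dirDeriv v (fun z => f z + g z) z = dirDeriv v f z + dirDeriv v g z := by
  rw [dirDeriv, fderiv_fun_add (hf z) (hg z)]
  simp [dirDeriv]

lemma dirDeriv_comp {k : ℝ → ℝ} (hk : Differentiable ℝ k) (hf : Differentiable ℝ f)
    (v z : Phase N) : dirDeriv v (fun z => k (f z)) z = deriv k (f z) * dirDeriv v f z := by
  have := ((hk (f z)).hasDerivAt.comp_hasFDerivAt z (hf z).hasFDerivAt).fderiv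
  rw [dirDeriv, show (fun z => k (f z)) = k ∘ f from rfl, this]
  simp [dirDeriv]

lemma contDiff_dirDeriv (hf : ContDiff ℝ 2 f) (v : Phase N) : ContDiff ℝ 1 (dirDeriv v f) :=
  (hf.fderiv_right (m := 1) (by norm_num)).clm_apply contDiff_const

lemma differentiable_dirDeriv (hf : ContDiff ℝ 2 f) (v : Phase N) :
    Differentiable ℝ (dirDeriv v f) :=
  (contDiff_dirDeriv hf v).differentiable one_ne_zero

lemma dirDeriv_dirDeriv_mul (hf : ContDiff ℝ 2 f) (hg : ContDiff ℝ 2 g) (v z : Phase N) :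
    dirDeriv v (dirDeriv v fun z => f z * g z) z =
      f z * dirDeriv v (dirDeriv v g) z + g z * dirDeriv v (dirDeriv v f) z +
        2 * (dirDeriv v f z * dirDeriv v g z) := by
  have hfd := hf.differentiable two_ne_zero
  have hgd := hg.differentiable two_ne_zero
  have hf' := differentiable_dirDeriv hf v
  have hg' := differentiable_dirDeriv hg v
  rw [show (dirDeriv v fun z => f z * g z) =
    fun z => f z * dirDeriv v g z + g z * dirDeriv v f z from funext (dirDeriv_mul hfd hgd v),
    dirDeriv_add (hfd.fun_mul hg') (hgd.fun_mul hf'), dirDeriv_mul hfd hg', dirDeriv_mul hgd hf']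
  ring

lemma dirDeriv_dirDeriv_comp {k : ℝ → ℝ} (hk : ContDiff ℝ 2 k) (hf : ContDiff ℝ 2 f)
    (v z : Phase N) :
    dirDeriv v (dirDeriv v fun z => k (f z)) z =
      deriv k (f z) * dirDeriv v (dirDeriv v f) z +
        deriv (deriv k) (f z) * (dirDeriv v f z * dirDeriv v f z) := by
  have hfd := hf.differentiable two_ne_zero
  have hkd := hk.differentiable two_ne_zero
  have hk' : ContDiff ℝ 1 (deriv k) := (contDiff_succ_iff_deriv (n := 1)).1 hk |>.2.2
  have hf' := differentiable_dirDeriv hf v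
  have hkd' := hk'.differentiable one_ne_zero
  rw [show (dirDeriv v fun z => k (f z)) = fun z => deriv k (f z) * dirDeriv v f z from
    funext (dirDeriv_comp hkd hfd v), dirDeriv_mul (f := fun z => deriv k (f z)) (hkd'.comp hfd) hf',
    dirDeriv_comp hkd' hfd]
  ring

/-- The vector field of the Liouville operator. -/
noncomputable def drift (V : ℝ → ℝ) (N : ℕ) (τ : ℝ) (z : Phase N) : Phase N :=
  (∑ i ∈ Finset.Icc 1 N, (site z.2 i - site z.2 (i - 1)) • dirR N i) +
  (∑ i ∈ Finset.Ico 1 N,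
    (deriv V (site z.1 (i + 1)) - deriv V (site z.1 i)) • dirP N i) +
  (τ - deriv V (site z.1 N)) • dirP N N

/-- With the vector field frozen at `z` the operator is a single directional derivative, and obeys
the Leibniz and chain rules. -/
lemma liouville_eq (V : ℝ → ℝ) (τ : ℝ) (f : Phase N → ℝ) (z : Phase N) :
    liouville V N τ f z = dirDeriv (drift V N τ z) f z := by
  simp only [liouville, drift, dirDeriv, map_add, map_sum, map_smul, smul_eq_mul]

/-- The common form of the operators `S_N` and `S~_N`. -/
noncomputable def thermostat (N : ℕ) (β : ℝ) (a : ℕ → ℝ) (v : ℕ → Phase N) (f : Phase N → ℝ)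
    (z : Phase N) : ℝ :=
  -∑ i ∈ Finset.Ico 1 N, (a i * dirDeriv (v i) f z - β⁻¹ * dirDeriv (v i) (dirDeriv (v i) f) z)

lemma opS_eq (β : ℝ) (f : Phase N → ℝ) (z : Phase N) : opS β N f z =
    thermostat N β (fun i => site z.2 (i + 1) - site z.2 i)
      (fun i => dirP N (i + 1) - dirP N i) f z := rfl

lemma opSt_eq (V : ℝ → ℝ) (β : ℝ) (f : Phase N → ℝ) (z : Phase N) : opSt V β N f z =
    thermostat N β (fun i => deriv V (site z.1 (i + 1)) - deriv V (site z.1 i))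
      (fun i => dirR N (i + 1) - dirR N i) f z := rfl

lemma thermostat_mul (β : ℝ) (a : ℕ → ℝ) (v : ℕ → Phase N) (hf : ContDiff ℝ 2 f)
    (hg : ContDiff ℝ 2 g) (z : Phase N) :
    thermostat N β a v (fun z => f z * g z) z =
      f z * thermostat N β a v g z + g z * thermostat N β a v f z +
        2 * β⁻¹ * ∑ i ∈ Finset.Ico 1 N, dirDeriv (v i) f z * dirDeriv (v i) g z := by
  simp only [thermostat, ← Finset.sum_neg_distrib, Finset.mul_sum, ← Finset.sum_add_distrib]
  refine Finset.sum_congr rfl fun i _ => ?_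
  rw [dirDeriv_mul (hf.differentiable two_ne_zero) (hg.differentiable two_ne_zero),
    dirDeriv_dirDeriv_mul hf hg]
  ring

lemma thermostat_comp (β : ℝ) (a : ℕ → ℝ) (v : ℕ → Phase N) {k : ℝ → ℝ} (hk : ContDiff ℝ 2 k)
    (hf : ContDiff ℝ 2 f) (z : Phase N) :
    thermostat N β a v (fun z => k (f z)) z = deriv k (f z) * thermostat N β a v f z +
      deriv (deriv k) (f z) * (β⁻¹ *
        ∑ i ∈ Finset.Ico 1 N, dirDeriv (v i) f z * dirDeriv (v i) f z) := by
  simp only [thermostat, ← Finset.sum_neg_distrib, Finset.mul_sum, ← Finset.sum_add_distrib]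
  refine Finset.sum_congr rfl fun i _ => ?_
  rw [dirDeriv_comp (hk.differentiable two_ne_zero) (hf.differentiable two_ne_zero),
    dirDeriv_dirDeriv_comp hk hf]
  ring

/-- The carré du champ of the thermostats. -/
noncomputable def carre (N : ℕ) (f g : Phase N → ℝ) (z : Phase N) : ℝ :=
  (∑ i ∈ Finset.Ico 1 N, opD i f z * opD i g z) + ∑ i ∈ Finset.Ico 1 N, opDt i f z * opDt i g z

/-- The first order part is a derivation; the defect in the Leibniz rule comes from the second
derivatives of the thermostats. -/
lemma generator_mul (V : ℝ → ℝ) (β σ τ : ℝ) (hf : ContDiff ℝ 2 f) (hg : ContDiff ℝ 2 g)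
    (z : Phase N) :
    generator V β σ N τ (fun z => f z * g z) z =
      f z * generator V β σ N τ g z + g z * generator V β σ N τ f z +
        2 * (N * σ * β⁻¹) * carre N f g z := by
  simp only [generator, liouville_eq, opS_eq, opSt_eq, carre, opD, opDt]
  rw [thermostat_mul _ _ _ hf hg, thermostat_mul _ _ _ hf hg,
    dirDeriv_mul (hf.differentiable two_ne_zero) (hg.differentiable two_ne_zero)]
  ring

lemma generator_comp (V : ℝ → ℝ) (β σ τ : ℝ) {k : ℝ → ℝ} (hk : ContDiff ℝ 2 k)
    (hf : ContDiff ℝ 2 f) (z : Phase N) :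
    generator V β σ N τ (fun z => k (f z)) z =
      deriv k (f z) * generator V β σ N τ f z +
        deriv (deriv k) (f z) * ((N * σ * β⁻¹) * carre N f f z) := by
  simp only [generator, liouville_eq, opS_eq, opSt_eq, carre, opD, opDt]
  rw [thermostat_comp _ _ _ hk hf, thermostat_comp _ _ _ hk hf,
    dirDeriv_comp (hk.differentiable two_ne_zero) (hf.differentiable two_ne_zero)]
  ring

lemma carre_comp {k : ℝ → ℝ} (hk : Differentiable ℝ k) (hg : Differentiable ℝ g) (z : Phase N) :
    carre N f (fun z => k (g z)) z = deriv k (g z) * carre N f g z := by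
  simp only [carre, opD, opDt, dirDeriv_comp hk hg, mul_add, Finset.mul_sum]
  congr 1 <;> exact Finset.sum_congr rfl fun i _ => by ring

end Calculus

/-! ### Sites -/

/-- The entry number `k` as a continuous linear form. -/
noncomputable def siteL (N k : ℕ) : (Fin N → ℝ) →L[ℝ] ℝ :=
  if h : 1 ≤ k ∧ k ≤ N then ContinuousLinearMap.proj ⟨k - 1, by omega⟩ else 0

lemma siteL_apply {N : ℕ} (k : ℕ) (q : Fin N → ℝ) : siteL N k q = site q k := by
  unfold siteL site
  split_ifs <;> simp

/-- The coordinate `r_k` as a continuous linear form. -/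
noncomputable def siteR (N k : ℕ) : Phase N →L[ℝ] ℝ :=
  (siteL N k).comp (ContinuousLinearMap.fst ℝ _ _)

/-- The coordinate `p_k` as a continuous linear form. -/
noncomputable def siteP (N k : ℕ) : Phase N →L[ℝ] ℝ :=
  (siteL N k).comp (ContinuousLinearMap.snd ℝ _ _)

section Sites

variable {N : ℕ}

lemma siteR_apply (k : ℕ) (z : Phase N) : siteR N k z = site z.1 k := by
  simp [siteR, siteL_apply]

lemma siteP_apply (k : ℕ) (z : Phase N) : siteP N k z = site z.2 k := by
  simp [siteP, siteL_apply]

lemma siteR_dirP (k i : ℕ) : siteR N k (dirP N i) = 0 := by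
  simp [siteR, dirP]

lemma siteP_dirR (k i : ℕ) : siteP N k (dirR N i) = 0 := by
  simp [siteP, dirR]

lemma siteR_dirR {k : ℕ} (hk : 1 ≤ k ∧ k ≤ N) (i : ℕ) :
    siteR N k (dirR N i) = if k = i then 1 else 0 := by
  rw [siteR_apply, site, dif_pos hk, dirR]
  simp only [Nat.sub_add_cancel hk.1]

lemma siteP_dirP {k : ℕ} (hk : 1 ≤ k ∧ k ≤ N) (i : ℕ) :
    siteP N k (dirP N i) = if k = i then 1 else 0 := by
  rw [siteP_apply, site, dif_pos hk, dirP]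
  simp only [Nat.sub_add_cancel hk.1]

lemma site_zero (q : Fin N → ℝ) : site q 0 = 0 := by simp [site]

/-- The total energy. -/
noncomputable def hamiltonian (V : ℝ → ℝ) (N : ℕ) (z : Phase N) : ℝ :=
  ∑ i ∈ Finset.Icc 1 N, (siteP N i z ^ 2 / 2 + V (siteR N i z))

/-- The total length. -/
noncomputable def length (N : ℕ) : Phase N →L[ℝ] ℝ := ∑ i ∈ Finset.Icc 1 N, siteR N i

lemma energy_eq (V : ℝ → ℝ) (z : Phase N) : energy V N z = (1 / (N : ℝ)) * hamiltonian V N z := by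
  simp only [energy, hamiltonian, siteP_apply, siteR_apply]

lemma meanLength_eq (z : Phase N) : meanLength N z = (1 / (N : ℝ)) * length N z := by
  simp [meanLength, length, siteR_apply]

variable {V : ℝ → ℝ} {c₁ c₂ β : ℝ}

lemma contDiff_hamiltonian (hV : Admissible V c₁ c₂ β) : ContDiff ℝ 2 (hamiltonian V N) := by
  unfold hamiltonian
  refine ContDiff.sum fun i _ => ?_
  exact (((siteP N i).contDiff.pow 2).div_const 2).add (hV.contDiff.comp (siteR N i).contDiff)

lemma dirDeriv_hamiltonian (hV : Admissible V c₁ c₂ β) (v z : Phase N) :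
    dirDeriv v (hamiltonian V N) z = ∑ i ∈ Finset.Icc 1 N,
      (siteP N i z * siteP N i v + deriv V (siteR N i z) * siteR N i v) := by
  have h1 : ∀ i ∈ Finset.Icc 1 N, HasFDerivAt
      (fun z : Phase N => siteP N i z ^ 2 / 2 + V (siteR N i z))
      ((siteP N i z) • siteP N i + deriv V (siteR N i z) • siteR N i) z := by
    intro i _
    have a : HasFDerivAt (fun z : Phase N => siteP N i z ^ 2 / 2)
        ((siteP N i z) • siteP N i) z := by
      have := ((hasDerivAt_pow 2 (siteP N i z)).div_const 2).comp_hasFDerivAt z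
        (siteP N i).hasFDerivAt
      refine this.congr_fderiv ?_
      congr 1
      simp
    exact a.add ((hV.hasDerivAt _).comp_hasFDerivAt z (siteR N i).hasFDerivAt)
  have h2 := HasFDerivAt.fun_sum h1
  rw [dirDeriv, show hamiltonian V N = fun z => ∑ i ∈ Finset.Icc 1 N,
    (siteP N i z ^ 2 / 2 + V (siteR N i z)) from rfl, h2.fderiv]
  simp

lemma dirDeriv_clm (L : Phase N →L[ℝ] ℝ) (v z : Phase N) : dirDeriv v L z = L v := by
  simp [dirDeriv]

lemma sum_Icc_mul_ite (a : ℕ → ℝ) {k : ℕ} (hk : 1 ≤ k ∧ k ≤ N) :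
    ∑ i ∈ Finset.Icc 1 N, a i * (if i = k then 1 else 0) = a k := by
  rw [Finset.sum_eq_single k]
  · simp
  · intro i _ hi; simp [hi]
  · intro h; exact absurd (Finset.mem_Icc.2 hk) h

lemma dirDeriv_dirP_hamiltonian (hV : Admissible V c₁ c₂ β) {k : ℕ} (hk : 1 ≤ k ∧ k ≤ N)
    (z : Phase N) : dirDeriv (dirP N k) (hamiltonian V N) z = siteP N k z := by
  rw [dirDeriv_hamiltonian hV, ← sum_Icc_mul_ite (fun i => siteP N i z) hk]
  refine Finset.sum_congr rfl fun i hi => ?_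
  rw [siteP_dirP (Finset.mem_Icc.1 hi), siteR_dirP]
  ring

lemma dirDeriv_dirR_hamiltonian (hV : Admissible V c₁ c₂ β) {k : ℕ} (hk : 1 ≤ k ∧ k ≤ N)
    (z : Phase N) : dirDeriv (dirR N k) (hamiltonian V N) z = deriv V (siteR N k z) := by
  rw [dirDeriv_hamiltonian hV, ← sum_Icc_mul_ite (fun i => deriv V (siteR N i z)) hk]
  refine Finset.sum_congr rfl fun i hi => ?_
  rw [siteR_dirR (Finset.mem_Icc.1 hi), siteP_dirR]
  ring

lemma dirDeriv_sub (v w : Phase N) (f : Phase N → ℝ) (z : Phase N) :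
    dirDeriv (v - w) f z = dirDeriv v f z - dirDeriv w f z := by
  simp [dirDeriv]

lemma opD_hamiltonian (hV : Admissible V c₁ c₂ β) {i : ℕ} (hi : i ∈ Finset.Ico 1 N) :
    opD i (hamiltonian V N) = fun z => siteP N (i + 1) z - siteP N i z := by
  rw [Finset.mem_Ico] at hi
  ext z
  rw [opD, dirDeriv_sub, dirDeriv_dirP_hamiltonian hV ⟨by omega, by omega⟩,
    dirDeriv_dirP_hamiltonian hV ⟨by omega, by omega⟩]

lemma opDt_hamiltonian (hV : Admissible V c₁ c₂ β) {i : ℕ} (hi : i ∈ Finset.Ico 1 N) :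
    opDt i (hamiltonian V N) =
      fun z => deriv V (siteR N (i + 1) z) - deriv V (siteR N i z) := by
  rw [Finset.mem_Ico] at hi
  ext z
  rw [opDt, dirDeriv_sub, dirDeriv_dirR_hamiltonian hV ⟨by omega, by omega⟩,
    dirDeriv_dirR_hamiltonian hV ⟨by omega, by omega⟩]

lemma opD_opD_hamiltonian (hV : Admissible V c₁ c₂ β) {i : ℕ} (hi : i ∈ Finset.Ico 1 N)
    (z : Phase N) : opD i (opD i (hamiltonian V N)) z = 2 := by
  rw [opD_hamiltonian hV hi, opD, show (fun z => siteP N (i + 1) z - siteP N i z) =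
    ⇑(siteP N (i + 1) - siteP N i) from by ext; simp, dirDeriv_clm]
  rw [Finset.mem_Ico] at hi
  simp only [sub_apply, map_sub]
  rw [siteP_dirP ⟨by omega, by omega⟩, siteP_dirP ⟨by omega, by omega⟩,
    siteP_dirP ⟨by omega, by omega⟩, siteP_dirP ⟨by omega, by omega⟩]
  simp
  norm_num

lemma opDt_opDt_hamiltonian (hV : Admissible V c₁ c₂ β) {i : ℕ} (hi : i ∈ Finset.Ico 1 N)
    (z : Phase N) : opDt i (opDt i (hamiltonian V N)) z =
      deriv (deriv V) (siteR N (i + 1) z) + deriv (deriv V) (siteR N i z) := by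
  rw [opDt_hamiltonian hV hi, opDt]
  have h := (((hV.hasDerivAt_deriv (siteR N (i + 1) z)).comp_hasFDerivAt z
    (siteR N (i + 1)).hasFDerivAt).sub ((hV.hasDerivAt_deriv (siteR N i z)).comp_hasFDerivAt z
    (siteR N i).hasFDerivAt)).fderiv
  rw [dirDeriv, show (fun z => deriv V (siteR N (i + 1) z) - deriv V (siteR N i z)) =
    deriv V ∘ (siteR N (i + 1)) - deriv V ∘ (siteR N i) from rfl, h]
  rw [Finset.mem_Ico] at hi
  simp only [sub_apply, smul_apply, map_sub, smul_eq_mul]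
  rw [siteR_dirR ⟨by omega, by omega⟩, siteR_dirR ⟨by omega, by omega⟩,
    siteR_dirR ⟨by omega, by omega⟩, siteR_dirR ⟨by omega, by omega⟩]
  simp

/-- Summation by parts: `a 0 = 0` leaves one boundary term. With `b = V'(r)` it gives the power
received by the chain, with `b = 1` the rate of elongation. -/
lemma sum_mul_add_sum_mul (a b : ℕ → ℝ) (ha : a 0 = 0) {M : ℕ} (hM : 1 ≤ M) :
    (∑ i ∈ Finset.Icc 1 M, (a i - a (i - 1)) * b i) +
      (∑ i ∈ Finset.Ico 1 M, (b (i + 1) - b i) * a i) = b M * a M := by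
  induction M, hM using Nat.le_induction with
  | base => simp [ha]; ring
  | succ M hM ih =>
    rw [Finset.sum_Icc_succ_top (by omega), Finset.sum_Ico_succ_top hM, Nat.add_sub_cancel]
    linarith

lemma liouville_hamiltonian (hV : Admissible V c₁ c₂ β) (hN : 1 ≤ N) (τ : ℝ) (z : Phase N) :
    liouville V N τ (hamiltonian V N) z = τ * site z.2 N := by
  have h := sum_mul_add_sum_mul (fun i => site z.2 i) (fun i => deriv V (site z.1 i))
    (site_zero _) hN
  have e1 : ∑ i ∈ Finset.Icc 1 N, (site z.2 i - site z.2 (i - 1)) *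
      dirDeriv (dirR N i) (hamiltonian V N) z = ∑ i ∈ Finset.Icc 1 N,
        (site z.2 i - site z.2 (i - 1)) * deriv V (site z.1 i) :=
    Finset.sum_congr rfl fun i hi => by
      rw [dirDeriv_dirR_hamiltonian hV (Finset.mem_Icc.1 hi), siteR_apply]
  have e2 : ∑ i ∈ Finset.Ico 1 N, (deriv V (site z.1 (i + 1)) - deriv V (site z.1 i)) *
      dirDeriv (dirP N i) (hamiltonian V N) z = ∑ i ∈ Finset.Ico 1 N,
        (deriv V (site z.1 (i + 1)) - deriv V (site z.1 i)) * site z.2 i :=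
    Finset.sum_congr rfl fun i hi => by
      rw [Finset.mem_Ico] at hi
      rw [dirDeriv_dirP_hamiltonian hV ⟨hi.1, by omega⟩, siteP_apply]
  rw [liouville, e1, e2, dirDeriv_dirP_hamiltonian hV ⟨hN, le_rfl⟩, siteP_apply]
  linarith

/-- The density of the heat exchanged with the thermostats. -/
noncomputable def heatRate (V : ℝ → ℝ) (β : ℝ) (N : ℕ) (z : Phase N) : ℝ :=
  ∑ i ∈ Finset.Ico 1 N,
    (((site z.2 (i + 1) - site z.2 i) ^ 2 - 2 * β⁻¹) +
      ((deriv V (site z.1 (i + 1)) - deriv V (site z.1 i)) ^ 2 -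
        β⁻¹ * (deriv (deriv V) (site z.1 (i + 1)) + deriv (deriv V) (site z.1 i))))

lemma generator_hamiltonian (hV : Admissible V c₁ c₂ β) (hN : 1 ≤ N) (σ τ : ℝ) (z : Phase N) :
    generator V β σ N τ (hamiltonian V N) z =
      N * (τ * site z.2 N) - N * σ * heatRate V β N z := by
  have e1 : opS β N (hamiltonian V N) z =
      -∑ i ∈ Finset.Ico 1 N, ((site z.2 (i + 1) - site z.2 i) ^ 2 - 2 * β⁻¹) := by
    rw [opS]
    congr 1
    refine Finset.sum_congr rfl fun i hi => ?_
    rw [opDstar, opD_opD_hamiltonian hV hi, opD_hamiltonian hV hi]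
    simp only [siteP_apply]; ring
  have e2 : opSt V β N (hamiltonian V N) z =
      -∑ i ∈ Finset.Ico 1 N, ((deriv V (site z.1 (i + 1)) - deriv V (site z.1 i)) ^ 2 -
        β⁻¹ * (deriv (deriv V) (site z.1 (i + 1)) + deriv (deriv V) (site z.1 i))) := by
    rw [opSt]
    congr 1
    refine Finset.sum_congr rfl fun i hi => ?_
    rw [opDtstar, opDt_opDt_hamiltonian hV hi, opDt_hamiltonian hV hi]
    simp only [siteR_apply]; ring
  rw [generator, liouville_hamiltonian hV hN, e1, e2, heatRate, Finset.sum_add_distrib]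
  ring

lemma opD_length {i : ℕ} : opD i (length N) = 0 := by
  ext z
  rw [opD, dirDeriv_clm, length]
  simp [siteR_dirP]

/-- The noise moves `r_i` and `r_{i+1}` by opposite amounts, which preserves the sum; the length
therefore has no martingale part from the thermostats. -/
lemma opDt_length {i : ℕ} (hi : i ∈ Finset.Ico 1 N) : opDt i (length N) = 0 := by
  ext z
  rw [Finset.mem_Ico] at hi
  have h : ∀ k, 1 ≤ k ∧ k ≤ N → length N (dirR N k) = 1 := by
    intro k hk
    have := sum_Icc_mul_ite (fun _ => 1) hk
    simp only [one_mul] at this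
    rw [length, sum_apply, ← this]
    exact Finset.sum_congr rfl fun i hi => siteR_dirR (Finset.mem_Icc.1 hi) k
  rw [opDt, dirDeriv_clm, map_sub, h _ ⟨by omega, by omega⟩, h _ ⟨by omega, by omega⟩]
  simp

lemma carre_length (g : Phase N → ℝ) (z : Phase N) : carre N (length N) g z = 0 := by
  rw [carre]
  simp only [opD_length, Pi.zero_apply, zero_mul, Finset.sum_const_zero, zero_add]
  exact Finset.sum_eq_zero fun i hi => by rw [opDt_length hi]; simp

lemma generator_length (hN : 1 ≤ N) (σ τ : ℝ) (z : Phase N) :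
    generator V β σ N τ (length N) z = N * site z.2 N := by
  have hz : ∀ v : Phase N, dirDeriv v (0 : Phase N → ℝ) z = 0 := fun v => by
    rw [dirDeriv, fderiv_zero]; simp
  have e1 : opS β N (length N) z = 0 := by
    rw [opS, Finset.sum_eq_zero fun i hi => ?_, neg_zero]
    rw [opDstar, opD_length, opD, hz]; simp
  have e2 : opSt V β N (length N) z = 0 := by
    rw [opSt, Finset.sum_eq_zero fun i hi => ?_, neg_zero]
    rw [opDtstar, opDt_length hi, opDt, hz]; simp
  have e3 : liouville V N τ (length N) z = site z.2 N := by
    have h1 : ∀ k, length N (dirP N k) = 0 := fun k => by rw [length]; simp [siteR_dirP]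
    rw [liouville]
    simp only [dirDeriv_clm, h1, mul_zero, Finset.sum_const_zero, add_zero]
    have h2 : ∀ i ∈ Finset.Icc 1 N, (site z.2 i - site z.2 (i - 1)) * length N (dirR N i) =
        (site z.2 i - site z.2 (i - 1)) * 1 := fun i hi => by
      have := sum_Icc_mul_ite (N := N) (fun _ => 1) (Finset.mem_Icc.1 hi)
      simp only [one_mul] at this
      rw [← this, length, sum_apply]
      congr 1
      exact Finset.sum_congr rfl fun j hj => siteR_dirR (Finset.mem_Icc.1 hj) i
    have h3 := sum_mul_add_sum_mul (fun i => site z.2 i) (fun _ => 1) (site_zero _) hN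
    rw [Finset.sum_congr rfl h2]
    simpa using h3
  rw [generator, e1, e2, e3]
  ring

end Sites


/-! ### A Lyapunov function and cutoffs -/

/-- The energy, shifted so as to be at least `1`. -/
noncomputable def lyapunov (V : ℝ → ℝ) (C : ℝ) (N : ℕ) (z : Phase N) : ℝ :=
  hamiltonian V N z + (N * C + 1)

/-- The constant `C` turns the potential into a positive function that dominates the square. -/
def DominatesSq (V : ℝ → ℝ) (C : ℝ) : Prop := 0 ≤ C ∧ ∀ r, r ^ 2 ≤ C * (V r + C)

lemma DominatesSq.add_nonneg {V : ℝ → ℝ} {C : ℝ} (h : DominatesSq V C) (r : ℝ) : 0 ≤ V r + C := by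
  have hC : 0 < C := by
    rcases h.1.lt_or_eq with h0 | h0
    · exact h0
    · have := h.2 1
      rw [← h0] at this
      norm_num at this
  exact nonneg_of_mul_nonneg_right ((sq_nonneg r).trans (h.2 r)) hC

section Lyapunov

variable {V : ℝ → ℝ} {c₁ c₂ β C : ℝ} {N : ℕ}

lemma lyapunov_eq_sum (z : Phase N) : lyapunov V C N z =
    (∑ i ∈ Finset.Icc 1 N, (siteP N i z ^ 2 / 2 + (V (siteR N i z) + C))) + 1 := by
  rw [lyapunov, hamiltonian]
  simp only [Finset.sum_add_distrib, Finset.sum_const, Nat.card_Icc, nsmul_eq_mul,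
    Nat.add_sub_cancel]
  ring

lemma one_le_lyapunov (hC : DominatesSq V C) (z : Phase N) : 1 ≤ lyapunov V C N z := by
  rw [lyapunov_eq_sum]
  have : 0 ≤ ∑ i ∈ Finset.Icc 1 N, (siteP N i z ^ 2 / 2 + (V (siteR N i z) + C)) :=
    Finset.sum_nonneg fun i _ => by have := hC.add_nonneg (siteR N i z); positivity
  linarith

lemma siteP_sq_le_lyapunov (hC : DominatesSq V C) (z : Phase N) (i : ℕ) :
    siteP N i z ^ 2 ≤ 2 * lyapunov V C N z := by
  by_cases hi : 1 ≤ i ∧ i ≤ N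
  · have := Finset.single_le_sum (f := fun i => siteP N i z ^ 2 / 2 + (V (siteR N i z) + C))
      (fun i _ => by have := hC.add_nonneg (siteR N i z); positivity) (Finset.mem_Icc.2 hi)
    rw [lyapunov_eq_sum]
    have := hC.add_nonneg (siteR N i z)
    linarith
  · rw [siteP_apply, site, dif_neg hi]
    have := one_le_lyapunov hC z
    linarith

lemma siteR_sq_le_lyapunov (hC : DominatesSq V C) (z : Phase N) (i : ℕ) :
    siteR N i z ^ 2 ≤ C * lyapunov V C N z := by
  by_cases hi : 1 ≤ i ∧ i ≤ N
  · have := Finset.single_le_sum (f := fun i => siteP N i z ^ 2 / 2 + (V (siteR N i z) + C))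
      (fun i _ => by have := hC.add_nonneg (siteR N i z); positivity) (Finset.mem_Icc.2 hi)
    refine (hC.2 _).trans (mul_le_mul_of_nonneg_left ?_ hC.1)
    rw [lyapunov_eq_sum]
    nlinarith [sq_nonneg (siteP N i z)]
  · rw [siteR_apply, site, dif_neg hi]
    have h1 := one_le_lyapunov hC z
    have h2 := hC.1
    rw [zero_pow two_ne_zero]
    exact mul_nonneg h2 (zero_le_one.trans h1)

lemma contDiff_lyapunov (hV : Admissible V c₁ c₂ β) : ContDiff ℝ 2 (lyapunov V C N) :=
  (contDiff_hamiltonian hV).add contDiff_const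

lemma dirDeriv_lyapunov (v : Phase N) :
    dirDeriv v (lyapunov V C N) = dirDeriv v (hamiltonian V N) := by
  ext z
  rw [dirDeriv, show lyapunov V C N = fun z => hamiltonian V N z + (N * C + 1) from rfl,
    fderiv_add_const, dirDeriv]

lemma generator_lyapunov (hV : Admissible V c₁ c₂ β) (hN : 1 ≤ N) (σ τ : ℝ) (z : Phase N) :
    generator V β σ N τ (lyapunov V C N) z =
      N * (τ * site z.2 N) - N * σ * heatRate V β N z := by
  rw [← generator_hamiltonian hV hN σ τ z]
  simp only [generator, liouville, opS, opSt, opDstar, opDtstar, opD, opDt, dirDeriv_lyapunov]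

lemma carre_lyapunov (hV : Admissible V c₁ c₂ β) (z : Phase N) :
    carre N (lyapunov V C N) (lyapunov V C N) z =
      (∑ i ∈ Finset.Ico 1 N, (siteP N (i + 1) z - siteP N i z) ^ 2) +
        ∑ i ∈ Finset.Ico 1 N, (deriv V (siteR N (i + 1) z) - deriv V (siteR N i z)) ^ 2 := by
  rw [carre]
  congr 1
  · refine Finset.sum_congr rfl fun i hi => ?_
    rw [opD, dirDeriv_lyapunov, ← opD, opD_hamiltonian hV hi]; ring
  · refine Finset.sum_congr rfl fun i hi => ?_
    rw [opDt, dirDeriv_lyapunov, ← opDt, opDt_hamiltonian hV hi]; ring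

lemma abs_site_le_lyapunov (hC : DominatesSq V C) (z : Phase N) (i : ℕ) :
    |site z.2 i| ≤ 2 * lyapunov V C N z := by
  have h1 := siteP_sq_le_lyapunov hC z i
  have h2 := one_le_lyapunov hC z
  rw [siteP_apply] at h1
  rw [abs_le]
  constructor <;> nlinarith [sq_nonneg (site z.2 i - 1), sq_nonneg (site z.2 i + 1)]

lemma exists_deriv_sub_sq_le (hV : Admissible V c₁ c₂ β) (hC : DominatesSq V C) :
    ∃ B, 0 ≤ B ∧ ∀ (N : ℕ) (z : Phase N) (i j : ℕ),
      (deriv V (siteR N i z) - deriv V (siteR N j z)) ^ 2 ≤ B * lyapunov V C N z := by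
  have hc := hV.upper_pos
  refine ⟨c₂ ^ 2 * (4 * C), by have := hC.1; positivity, fun N z i j => ?_⟩
  have h1 := hV.deriv_sub_mul_bounds (siteR N i z) (siteR N j z)
  set a := siteR N i z
  set b := siteR N j z
  have h2 : (deriv V a - deriv V b) ^ 2 ≤ c₂ ^ 2 * (a - b) ^ 2 := by
    rcases eq_or_ne a b with h | h
    · simp [h]
    · have h3 : 0 < (a - b) ^ 2 := by have := sub_ne_zero.2 h; positivity
      have h4 : 0 ≤ (deriv V a - deriv V b) * (a - b) :=
        (mul_nonneg hV.pos.le h3.le).trans h1.1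
      have h5 := mul_self_le_mul_self h4 h1.2
      have h6 : (deriv V a - deriv V b) ^ 2 * (a - b) ^ 2 ≤
          c₂ ^ 2 * (a - b) ^ 2 * (a - b) ^ 2 := by nlinarith
      exact le_of_mul_le_mul_right h6 h3
  have h3 := siteR_sq_le_lyapunov hC z i
  have h4 := siteR_sq_le_lyapunov hC z j
  have h5 : (a - b) ^ 2 ≤ 4 * C * lyapunov V C N z := by nlinarith [sq_nonneg (a + b)]
  calc _ ≤ c₂ ^ 2 * (a - b) ^ 2 := h2
    _ ≤ c₂ ^ 2 * (4 * C * lyapunov V C N z) := mul_le_mul_of_nonneg_left h5 (sq_nonneg _)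
    _ = _ := by ring

/-- Both quantities are quadratic in differences of `p` and of `V'(r)`, up to bounded terms in
`V''`, hence linear in the energy. This is what closes Gronwall's inequality and controls
truncations; the constant may depend on `N`. -/
lemma exists_rate_bounds (hV : Admissible V c₁ c₂ β) (hC : DominatesSq V C) (N : ℕ) :
    ∃ B, 0 ≤ B ∧ ∀ z : Phase N, |heatRate V β N z| ≤ B * lyapunov V C N z ∧
      |carre N (lyapunov V C N) (lyapunov V C N) z| ≤ B * lyapunov V C N z := by
  obtain ⟨B, hB0, hB⟩ := exists_deriv_sub_sq_le hV hC
  have hβ := hV.beta_pos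
  have hc := hV.upper_pos
  have hβ' : 0 < β⁻¹ := inv_pos.2 hβ
  refine ⟨N * (8 + B + 2 * β⁻¹ + β⁻¹ * (2 * c₂)), by positivity, fun z => ?_⟩
  have h1 := one_le_lyapunov hC z
  have hL : 0 ≤ lyapunov V C N z := by linarith
  have hP : ∀ i, (siteP N (i + 1) z - siteP N i z) ^ 2 ≤ 8 * lyapunov V C N z := fun i => by
    have h2 := siteP_sq_le_lyapunov hC z i
    have h3 := siteP_sq_le_lyapunov hC z (i + 1)
    nlinarith [sq_nonneg (siteP N (i + 1) z + siteP N i z)]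
  have hsum : ∀ (e : ℕ → ℝ), (∀ i, |e i| ≤ (8 + B + 2 * β⁻¹ + β⁻¹ * (2 * c₂)) *
      lyapunov V C N z) → |∑ i ∈ Finset.Ico 1 N, e i| ≤
        N * (8 + B + 2 * β⁻¹ + β⁻¹ * (2 * c₂)) * lyapunov V C N z := by
    intro e he
    refine (Finset.abs_sum_le_sum_abs _ _).trans ((Finset.sum_le_sum fun i _ => he i).trans ?_)
    rw [Finset.sum_const, Nat.card_Ico, nsmul_eq_mul, mul_assoc]
    refine mul_le_mul_of_nonneg_right ?_ (by positivity)
    exact_mod_cast Nat.sub_le N 1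
  constructor
  · refine hsum _ fun i => ?_
    have h2 := hP i
    have h3 := hB N z (i + 1) i
    simp only [siteP_apply, siteR_apply] at h2 h3
    have h4 := hV.bounds (site z.1 (i + 1))
    have h5 := hV.bounds (site z.1 i)
    have hc₁ := hV.pos
    have h6 : 0 ≤ β⁻¹ * (deriv (deriv V) (site z.1 (i + 1)) + deriv (deriv V) (site z.1 i)) :=
      mul_nonneg hβ'.le (by linarith [h4.1, h5.1])
    have h7 : β⁻¹ * (deriv (deriv V) (site z.1 (i + 1)) + deriv (deriv V) (site z.1 i)) ≤
        β⁻¹ * (2 * c₂) := mul_le_mul_of_nonneg_left (by linarith [h4.2, h5.2]) hβ'.le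
    have h8 : β⁻¹ * (2 * c₂) ≤ β⁻¹ * (2 * c₂) * lyapunov V C N z :=
      le_mul_of_one_le_right (by positivity) h1
    have h9 : 2 * β⁻¹ ≤ 2 * β⁻¹ * lyapunov V C N z := le_mul_of_one_le_right (by positivity) h1
    have h10 : 0 ≤ B * lyapunov V C N z := by positivity
    have h11 := sq_nonneg (site z.2 (i + 1) - site z.2 i)
    have h12 := sq_nonneg (deriv V (site z.1 (i + 1)) - deriv V (site z.1 i))
    have h13 : (8 + B + 2 * β⁻¹ + β⁻¹ * (2 * c₂)) * lyapunov V C N z = 8 * lyapunov V C N z +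
      B * lyapunov V C N z + 2 * β⁻¹ * lyapunov V C N z +
        β⁻¹ * (2 * c₂) * lyapunov V C N z := by ring
    rw [h13, abs_le]
    constructor <;> linarith
  · rw [carre_lyapunov hV, ← Finset.sum_add_distrib]
    refine hsum _ fun i => ?_
    rw [abs_of_nonneg (by positivity)]
    have h2 := hP i
    have h3 := hB N z (i + 1) i
    have h4 : 0 ≤ (2 * β⁻¹ + β⁻¹ * (2 * c₂)) * lyapunov V C N z := by positivity
    nlinarith

lemma exists_abs_generator_lyapunov_le (hV : Admissible V c₁ c₂ β) (hC : DominatesSq V C)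
    (hN : 1 ≤ N) (σ K : ℝ) : ∃ A, 0 ≤ A ∧ ∀ τ, |τ| ≤ K → ∀ z : Phase N,
      |generator V β σ N τ (lyapunov V C N) z| ≤ A * lyapunov V C N z := by
  obtain ⟨B, hB0, hB⟩ := exists_rate_bounds hV hC N
  refine ⟨N * (|K| * 2) + N * |σ| * B, by positivity, fun τ hτ z => ?_⟩
  rw [generator_lyapunov hV hN]
  have h1 := abs_site_le_lyapunov hC z N
  refine (abs_sub _ _).trans ?_
  rw [abs_mul, abs_mul, abs_mul, abs_mul, Nat.abs_cast, add_mul]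
  refine add_le_add ?_ ?_
  · rw [mul_assoc]
    refine mul_le_mul_of_nonneg_left ?_ (Nat.cast_nonneg _)
    rw [mul_assoc]
    exact mul_le_mul (hτ.trans (le_abs_self K)) h1 (abs_nonneg _) (abs_nonneg _)
  · rw [mul_assoc (↑N * |σ|)]
    exact mul_le_mul_of_nonneg_left (hB z).1 (by positivity)

lemma isBounded_lyapunov_le (hC : DominatesSq V C) (R : ℝ) :
    Bornology.IsBounded {z : Phase N | lyapunov V C N z ≤ R} := by
  refine (Metric.isBounded_closedBall (x := (0 : Phase N)) (r := 1 + 2 * |R| + C * |R|)).subset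
    fun z hz => ?_
  have hz' : lyapunov V C N z ≤ |R| := le_trans hz (le_abs_self R)
  have hC0 := hC.1
  rw [mem_closedBall_zero_iff]
  have hsite : ∀ (q : Fin N → ℝ) (j : Fin N), site q (j + 1) = q j := fun q j => by
    rw [site, dif_pos ⟨by omega, by omega⟩]; simp
  have hab : ∀ a b : ℝ, a ^ 2 ≤ b → |a| ≤ 1 + b := fun a b hab => by
    rw [abs_le]
    constructor <;> nlinarith [sq_nonneg (a - 1), sq_nonneg (a + 1)]
  have h0 : 0 ≤ C * |R| := by positivity
  have h0' : 0 ≤ 2 * |R| := by positivity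
  refine max_le ?_ ?_
  · refine (pi_norm_le_iff_of_nonneg (by positivity)).2 fun j => ?_
    have h1 := siteR_sq_le_lyapunov hC z (j + 1)
    rw [siteR_apply, hsite] at h1
    have h2 := hab _ _ (h1.trans (mul_le_mul_of_nonneg_left hz' hC0))
    rw [Real.norm_eq_abs]; linarith
  · refine (pi_norm_le_iff_of_nonneg (by positivity)).2 fun j => ?_
    have h1 := siteP_sq_le_lyapunov hC z (j + 1)
    rw [siteP_apply, hsite] at h1
    have h2 := hab _ _ (h1.trans (mul_le_mul_of_nonneg_left hz' zero_le_two))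
    rw [Real.norm_eq_abs]; linarith

end Lyapunov

/-- A smooth function equal to `1` on `(-∞, 1]` and to `0` on `[2, ∞)`. -/
noncomputable def cutoff (x : ℝ) : ℝ := Real.smoothTransition (2 - x)

lemma contDiff_cutoff {n : ℕ∞} : ContDiff ℝ n cutoff :=
  Real.smoothTransition.contDiff.comp (contDiff_const.sub contDiff_id)

lemma cutoff_eq_one {x : ℝ} (hx : x ≤ 1) : cutoff x = 1 :=
  Real.smoothTransition.one_of_one_le (by linarith)

lemma cutoff_eq_zero {x : ℝ} (hx : 2 ≤ x) : cutoff x = 0 :=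
  Real.smoothTransition.zero_of_nonpos (by linarith)

lemma abs_cutoff_le (x : ℝ) : |cutoff x| ≤ 1 := by
  rw [cutoff, abs_of_nonneg (Real.smoothTransition.nonneg _)]
  exact Real.smoothTransition.le_one _

lemma deriv_eq_zero_of_eqOn {f : ℝ → ℝ} {c : ℝ} {s : Set ℝ} (hs : IsOpen s)
    (h : ∀ y ∈ s, f y = c) {x : ℝ} (hx : x ∈ s) : deriv f x = 0 := by
  have : f =ᶠ[𝓝 x] fun _ => c := by filter_upwards [hs.mem_nhds hx] with y hy using h y hy
  rw [this.deriv_eq]; simp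

lemma deriv_cutoff_of_lt_one {x : ℝ} (hx : x < 1) : deriv cutoff x = 0 :=
  deriv_eq_zero_of_eqOn isOpen_Iio (fun _ hy => cutoff_eq_one (le_of_lt hy)) hx

lemma deriv_deriv_cutoff_of_lt_one {x : ℝ} (hx : x < 1) : deriv (deriv cutoff) x = 0 :=
  deriv_eq_zero_of_eqOn isOpen_Iio (fun _ hy => deriv_cutoff_of_lt_one hy) hx

lemma deriv_cutoff_of_two_lt {x : ℝ} (hx : 2 < x) : deriv cutoff x = 0 :=
  deriv_eq_zero_of_eqOn isOpen_Ioi (fun _ hy => cutoff_eq_zero (le_of_lt hy)) hx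

lemma deriv_deriv_cutoff_of_two_lt {x : ℝ} (hx : 2 < x) : deriv (deriv cutoff) x = 0 :=
  deriv_eq_zero_of_eqOn isOpen_Ioi (fun _ hy => deriv_cutoff_of_two_lt hy) hx

lemma exists_bound_of_eq_zero_outside {f : ℝ → ℝ} (hf : Continuous f) (h1 : ∀ x < 1, f x = 0)
    (h2 : ∀ x > 2, f x = 0) : ∃ K, 0 ≤ K ∧ ∀ x, |f x| ≤ K ∧ |f x * x| ≤ K := by
  obtain ⟨K, hK⟩ := (isCompact_Icc (a := (1 : ℝ)) (b := 2)).exists_bound_of_continuousOn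
    hf.continuousOn
  have hK0 : 0 ≤ K := (norm_nonneg _).trans (hK 1 (by norm_num))
  refine ⟨2 * K, by positivity, fun x => ?_⟩
  by_cases hx : x ∈ Icc (1 : ℝ) 2
  · have h3 : |f x| ≤ K := hK x hx
    refine ⟨by linarith, ?_⟩
    rw [abs_mul, abs_of_nonneg (by linarith [hx.1] : 0 ≤ x), mul_comm 2 K]
    exact mul_le_mul h3 hx.2 (by linarith [hx.1]) hK0
  · have : f x = 0 := by
      by_cases hx1 : x < 1
      · exact h1 x hx1
      · exact h2 x (by by_contra h; exact hx ⟨by linarith, by linarith⟩)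
    rw [this]; simp [hK0]

/-- The derivatives live on `[1, 2]`, where a factor `x` is harmless; it compensates the linear
growth of the energy when the cutoff is evaluated at energy over `R`. -/
lemma exists_cutoff_bounds : ∃ K, 0 ≤ K ∧ ∀ x, |deriv cutoff x| ≤ K ∧ |deriv cutoff x * x| ≤ K ∧
    |deriv (deriv cutoff) x * x| ≤ K := by
  have h2 : ContDiff ℝ 2 cutoff := contDiff_cutoff (n := 2)
  have h1 : ContDiff ℝ 1 (deriv cutoff) := (contDiff_succ_iff_deriv (n := 1)).1 h2 |>.2.2
  obtain ⟨K₁, hK₁, h3⟩ := exists_bound_of_eq_zero_outside h1.continuous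
    (fun _ => deriv_cutoff_of_lt_one) (fun _ => deriv_cutoff_of_two_lt)
  obtain ⟨K₂, hK₂, h4⟩ := exists_bound_of_eq_zero_outside (h1.continuous_deriv le_rfl)
    (fun _ => deriv_deriv_cutoff_of_lt_one) (fun _ => deriv_deriv_cutoff_of_two_lt)
  exact ⟨K₁ + K₂, by positivity, fun x =>
    ⟨(h3 x).1.trans (by linarith), (h3 x).2.trans (by linarith), (h4 x).2.trans (by linarith)⟩⟩

lemma deriv_comp_div (k : ℝ → ℝ) (R : ℝ) :
    deriv (fun x => k (x / R)) = fun x => deriv k (x / R) / R := by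
  ext x
  have := deriv_comp_mul_left (c := R⁻¹) (f := k) (x := x)
  simp only [smul_eq_mul] at this
  rw [show (fun x => k (x / R)) = fun x => k (R⁻¹ * x) from by ext y; rw [div_eq_inv_mul], this,
    div_eq_inv_mul, div_eq_inv_mul]

lemma deriv_deriv_comp_div (k : ℝ → ℝ) (R : ℝ) :
    deriv (deriv (fun x => k (x / R))) = fun x => deriv (deriv k) (x / R) / R / R := by
  rw [deriv_comp_div]
  ext x
  rw [deriv_div_const, deriv_comp_div]

/-! ### Truncation of observables at a given energy. -/

section Truncation

variable {V : ℝ → ℝ} {c₁ c₂ β C : ℝ} {N : ℕ}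

/-- The truncation of `f` at energy `R`. -/
noncomputable def truncate (V : ℝ → ℝ) (C : ℝ) (f : Phase N → ℝ) (R : ℝ) (z : Phase N) : ℝ :=
  f z * cutoff (lyapunov V C N z / R)

lemma contDiff_cutoff_lyapunov (hV : Admissible V c₁ c₂ β) (R : ℝ) :
    ContDiff ℝ 2 fun z => cutoff (lyapunov V C N z / R) :=
  (contDiff_cutoff (n := 2)).comp ((contDiff_lyapunov hV).div_const R)

lemma contDiff_truncate (hV : Admissible V c₁ c₂ β) {f : Phase N → ℝ} (hf : ContDiff ℝ 2 f)
    (R : ℝ) : ContDiff ℝ 2 (truncate V C f R) :=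
  hf.mul (contDiff_cutoff_lyapunov hV R)

lemma hasCompactSupport_truncate (hC : DominatesSq V C) (f : Phase N → ℝ) {R : ℝ} (hR : 0 < R) :
    HasCompactSupport (truncate V C f R) := by
  refine HasCompactSupport.of_support_subset_isCompact
    (isBounded_lyapunov_le hC (2 * R)).isCompact_closure fun z hz => subset_closure ?_
  by_contra h
  refine hz ?_
  rw [mem_ofPred_eq, not_le] at h
  rw [truncate, cutoff_eq_zero (by rw [le_div_iff₀ hR]; exact h.le), mul_zero]

lemma generator_truncate (hV : Admissible V c₁ c₂ β) {f : Phase N → ℝ} (hf : ContDiff ℝ 2 f)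
    (σ τ R : ℝ) (z : Phase N) :
    generator V β σ N τ (truncate V C f R) z =
      f z * (deriv cutoff (lyapunov V C N z / R) / R *
          generator V β σ N τ (lyapunov V C N) z +
        deriv (deriv cutoff) (lyapunov V C N z / R) / R / R *
          (N * σ * β⁻¹ * carre N (lyapunov V C N) (lyapunov V C N) z)) +
      cutoff (lyapunov V C N z / R) * generator V β σ N τ f z +
      2 * (N * σ * β⁻¹) * (deriv cutoff (lyapunov V C N z / R) / R *
        carre N f (lyapunov V C N) z) := by
  have hk : ContDiff ℝ 2 fun x : ℝ => cutoff (x / R) :=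
    (contDiff_cutoff (n := 2)).comp (contDiff_id.div_const R)
  have h1 := generator_mul V β σ τ hf (contDiff_cutoff_lyapunov (C := C) hV R) z
  have h2 := generator_comp V β σ τ hk (contDiff_lyapunov (C := C) (N := N) hV) z
  have h3 := carre_comp (f := f) (hk.differentiable two_ne_zero)
    ((contDiff_lyapunov (C := C) (N := N) hV).differentiable two_ne_zero) z
  rw [deriv_deriv_comp_div, deriv_comp_div] at h2
  rw [deriv_comp_div] at h3
  simp only at h1 h2 h3
  rw [h2, h3] at h1
  exact h1

/-- The generator applied to truncations is dominated, uniformly in the level of truncation. -/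
lemma exists_abs_generator_truncate_le (hV : Admissible V c₁ c₂ β) (hC : DominatesSq V C)
    {σ : ℝ} {f : Phase N → ℝ} (hf : ContDiff ℝ 2 f) {D : Phase N → ℝ} {A : ℝ} {τs : Set ℝ}
    (hA : 0 ≤ A)
    (hgen : ∀ τ ∈ τs, ∀ z, |generator V β σ N τ (lyapunov V C N) z| ≤ A * lyapunov V C N z)
    (hcar : ∀ z : Phase N,
      |carre N (lyapunov V C N) (lyapunov V C N) z| ≤ A * lyapunov V C N z)
    (hfD : ∀ z, |f z| ≤ D z) (hgD : ∀ τ ∈ τs, ∀ z, |generator V β σ N τ f z| ≤ D z)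
    (hcD : ∀ z, |carre N f (lyapunov V C N) z| ≤ D z) :
    ∃ B, ∀ τ ∈ τs, ∀ R ≥ 1, ∀ z, |generator V β σ N τ (truncate V C f R) z| ≤ B * D z := by
  obtain ⟨K, hK0, hK⟩ := exists_cutoff_bounds
  set c := N * σ * β⁻¹ with hc
  refine ⟨(A * K + |c| * (A * K)) + 1 + 2 * |c| * K, fun τ hτ R hR z => ?_⟩
  rw [generator_truncate hV hf, ← hc]
  clear_value c
  set L := lyapunov V C N z with hL
  set x := L / R with hx
  have hR0 : 0 < R := by linarith
  have hLx : L = x * R := by rw [hx]; field_simp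
  have hL0 : 0 ≤ L := zero_le_one.trans (one_le_lyapunov hC z)
  have hx0 : 0 ≤ x := div_nonneg hL0 hR0.le
  have hD0 : 0 ≤ D z := (abs_nonneg _).trans (hfD z)
  obtain ⟨k1, k2, k3⟩ := hK x
  -- With `x = L / R`, the growth `A L` divided by `R` is `A x`, and the cutoff derivative times `x`
  -- is bounded independently of `R`.
  have b1 : |deriv cutoff x / R * generator V β σ N τ (lyapunov V C N) z| ≤ A * K := by
    rw [abs_mul, abs_div, abs_of_pos hR0]
    calc |deriv cutoff x| / R * |generator V β σ N τ (lyapunov V C N) z|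
        ≤ |deriv cutoff x| / R * (A * L) :=
          mul_le_mul_of_nonneg_left (hgen τ hτ z) (by positivity)
      _ = A * |deriv cutoff x * x| := by
          rw [abs_mul, abs_of_nonneg hx0, hLx]; field_simp
      _ ≤ _ := mul_le_mul_of_nonneg_left k2 hA
  have b2 : |deriv (deriv cutoff) x / R / R *
      (c * carre N (lyapunov V C N) (lyapunov V C N) z)| ≤ |c| * (A * K) := by
    rw [abs_mul, abs_div, abs_div, abs_of_pos hR0, abs_mul]
    calc |deriv (deriv cutoff) x| / R / R *
          (|c| * |carre N (lyapunov V C N) (lyapunov V C N) z|)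
        ≤ |deriv (deriv cutoff) x| / R / R * (|c| * (A * L)) :=
          mul_le_mul_of_nonneg_left (mul_le_mul_of_nonneg_left (hcar z) (abs_nonneg _))
            (by positivity)
      _ = |c| * (A * |deriv (deriv cutoff) x * x|) / R := by
          rw [abs_mul, abs_of_nonneg hx0, hLx]; field_simp
      _ ≤ |c| * (A * |deriv (deriv cutoff) x * x|) := div_le_self (by positivity) hR
      _ ≤ _ := mul_le_mul_of_nonneg_left (mul_le_mul_of_nonneg_left k3 hA) (abs_nonneg _)
  have b3 : |deriv cutoff x / R * carre N f (lyapunov V C N) z| ≤ K * D z := by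
    rw [abs_mul, abs_div, abs_of_pos hR0]
    refine mul_le_mul ((div_le_self (abs_nonneg _) hR).trans k1) (hcD z) (abs_nonneg _) hK0
  have b4 := abs_cutoff_le x
  refine (abs_add_three _ _ _).trans ?_
  have e1 : |f z * (deriv cutoff x / R * generator V β σ N τ (lyapunov V C N) z +
      deriv (deriv cutoff) x / R / R *
        (c * carre N (lyapunov V C N) (lyapunov V C N) z))| ≤ D z * (A * K + |c| * (A * K)) := by
    rw [abs_mul]
    exact mul_le_mul (hfD z) ((abs_add_le _ _).trans (add_le_add b1 b2)) (abs_nonneg _) hD0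
  have e2 : |cutoff x * generator V β σ N τ f z| ≤ 1 * D z := by
    rw [abs_mul]
    exact mul_le_mul b4 (hgD τ hτ z) (abs_nonneg _) zero_le_one
  have e3 : |2 * c * (deriv cutoff x / R * carre N f (lyapunov V C N) z)| ≤
      2 * |c| * (K * D z) := by
    rw [abs_mul, abs_mul, abs_two]
    exact mul_le_mul_of_nonneg_left b3 (by positivity)
  linarith

lemma eventually_generator_truncate_eq (hV : Admissible V c₁ c₂ β)
    {f : Phase N → ℝ} (hf : ContDiff ℝ 2 f) (σ τ : ℝ) (z : Phase N) :
    ∀ᶠ n : ℕ in atTop, truncate V C f (n + 1) z = f z ∧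
      generator V β σ N τ (truncate V C f (n + 1)) z = generator V β σ N τ f z := by
  filter_upwards [(tendsto_natCast_atTop_atTop (R := ℝ)).eventually_gt_atTop
    (lyapunov V C N z)] with n hn
  have h0 : (0 : ℝ) < n + 1 := by positivity
  have hx : lyapunov V C N z / (n + 1) < 1 := by rw [div_lt_one h0]; linarith
  refine ⟨by rw [truncate, cutoff_eq_one hx.le, mul_one], ?_⟩
  rw [generator_truncate hV hf, cutoff_eq_one hx.le, deriv_cutoff_of_lt_one hx,
    deriv_deriv_cutoff_of_lt_one hx]
  ring

lemma generator_eq_add (V : ℝ → ℝ) (β σ τ : ℝ) (f : Phase N → ℝ) (z : Phase N) :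
    generator V β σ N τ f z =
      generator V β σ N 0 f z + τ * (N * dirDeriv (dirP N N) f z) := by
  simp only [generator, liouville]; ring

lemma continuous_generator (hV : Admissible V c₁ c₂ β) {f : Phase N → ℝ} (hf : ContDiff ℝ 2 f)
    (σ τ : ℝ) : Continuous (generator V β σ N τ f) := by
  have h1 : ∀ v : Phase N, Continuous (dirDeriv v f) := fun v => (contDiff_dirDeriv hf v).continuous
  have h2 : ∀ v : Phase N, Continuous (dirDeriv v (dirDeriv v f)) := fun v =>
    ((contDiff_dirDeriv hf v).continuous_fderiv one_ne_zero).clm_apply continuous_const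
  have h3 : ∀ k, Continuous fun z : Phase N => site z.1 k := fun k =>
    (siteR N k).continuous.congr (siteR_apply k)
  have h4 : ∀ k, Continuous fun z : Phase N => site z.2 k := fun k =>
    (siteP N k).continuous.congr (siteP_apply k)
  have h5 : ∀ k, Continuous fun z : Phase N => deriv V (site z.1 k) := fun k =>
    hV.continuous_deriv.comp (h3 k)
  unfold generator liouville opS opSt opDstar opDtstar opD opDt
  fun_prop

end Truncation


/-! ### Dynkin's formula -/

/-- The product of the Lebesgue measure on `(0, T]` and of the law of the paths. -/
noncomputable def pathMeasure {Ω : Type*} [MeasurableSpace Ω] (μ : Measure Ω) (T : ℝ) :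
    Measure (ℝ × Ω) :=
  (volume.restrict (Ioc 0 T)).prod μ

section PathMeasure

variable {Ω : Type*} [MeasurableSpace Ω] {μ : Measure Ω}

lemma ae_pathMeasure_mem [SFinite μ] (T : ℝ) : ∀ᵐ y ∂(pathMeasure μ T), y.1 ∈ Ioc (0 : ℝ) T :=
  Measure.quasiMeasurePreserving_fst.ae (ae_restrict_mem measurableSet_Ioc)

variable [IsProbabilityMeasure μ]

instance (T : ℝ) : IsFiniteMeasure (pathMeasure μ T) := by
  unfold pathMeasure; infer_instance

lemma integral_pathMeasure {T : ℝ} (hT : 0 ≤ T) {F : ℝ × Ω → ℝ}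
    (hF : Integrable F (pathMeasure μ T)) :
    ∫ y, F y ∂(pathMeasure μ T) = ∫ s in (0 : ℝ)..T, ∫ ω, F (s, ω) ∂μ := by
  rw [intervalIntegral.integral_of_le hT]
  exact integral_prod F hF

lemma integral_pathMeasure_symm {T : ℝ} (hT : 0 ≤ T) {F : ℝ × Ω → ℝ}
    (hF : Integrable F (pathMeasure μ T)) :
    ∫ y, F y ∂(pathMeasure μ T) = ∫ ω, (∫ s in (0 : ℝ)..T, F (s, ω)) ∂μ := by
  simp_rw [intervalIntegral.integral_of_le hT]
  exact integral_prod_symm F hF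

lemma integrable_intervalIntegral {T : ℝ} (hT : 0 ≤ T) {F : ℝ × Ω → ℝ}
    (hF : Integrable F (pathMeasure μ T)) :
    Integrable (fun ω => ∫ s in (0 : ℝ)..T, F (s, ω)) μ := by
  simp_rw [intervalIntegral.integral_of_le hT]
  exact hF.integral_prod_right

lemma intervalIntegrable_expectation {T : ℝ} (hT : 0 ≤ T) {F : ℝ × Ω → ℝ}
    (hF : Integrable F (pathMeasure μ T)) :
    IntervalIntegrable (fun s => ∫ ω, F (s, ω) ∂μ) volume 0 T := by
  rw [intervalIntegrable_iff_integrableOn_Ioc_of_le hT]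
  exact hF.integral_prod_left

/-- A nonnegative function whose expectations are bounded in time is integrable. -/
lemma integrable_pathMeasure_of_bound {T B : ℝ} {F : ℝ × Ω → ℝ} (hF : Measurable F)
    (hF0 : ∀ y, 0 ≤ F y)
    (hB : ∀ s ∈ Ioc 0 T, Integrable (fun ω => F (s, ω)) μ ∧ ∫ ω, F (s, ω) ∂μ ≤ B) :
    Integrable F (pathMeasure μ T) := by
  refine ⟨hF.aestronglyMeasurable, ?_⟩
  rw [hasFiniteIntegral_iff_ofReal (ae_of_all _ hF0), pathMeasure,
    lintegral_prod _ hF.ennreal_ofReal.aemeasurable]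
  calc ∫⁻ s in Ioc 0 T, ∫⁻ ω, ENNReal.ofReal (F (s, ω)) ∂μ
      ≤ ∫⁻ _ in Ioc 0 T, ENNReal.ofReal B := by
        refine setLIntegral_mono' measurableSet_Ioc fun s hs => ?_
        rw [← ofReal_integral_eq_lintegral_ofReal (hB s hs).1 (ae_of_all _ fun ω => hF0 _)]
        exact ENNReal.ofReal_le_ofReal (hB s hs).2
    _ < ∞ := by
        rw [setLIntegral_const]
        exact ENNReal.mul_lt_top ENNReal.ofReal_lt_top (by simp)

end PathMeasure

namespace IsChain

variable {Ω : Type*} [mΩ : MeasurableSpace Ω] {μ : Measure Ω}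
  {V : ℝ → ℝ} {c₁ c₂ β C σ : ℝ} {τbar : ℝ → ℝ} {N : ℕ} {X : ℝ≥0 → Ω → Phase N}

lemma measurable (h : IsChain μ V β σ τbar N X) (t : ℝ≥0) : Measurable (X t) := by
  obtain ⟨ℱ, hm, -⟩ := h.martingale_problem
  exact (hm t).mono (ℱ.le t) le_rfl

lemma measurable_uncurry (h : IsChain μ V β σ τbar N X) :
    Measurable fun y : ℝ × Ω => X y.1.toNNReal y.2 := by
  have h1 : Measurable (Function.uncurry X) :=
    measurable_uncurry_of_continuous_of_measurable h.continuous_paths h.measurable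
  exact h1.comp ((measurable_real_toNNReal.comp measurable_fst).prodMk measurable_snd)

lemma measurable_generator (h : IsChain μ V β σ τbar N X) (hV : Admissible V c₁ c₂ β)
    (hτ : Continuous τbar) {f : Phase N → ℝ} (hf : ContDiff ℝ 2 f) :
    Measurable fun y : ℝ × Ω => generator V β σ N (τbar y.1) f (X y.1.toNNReal y.2) := by
  simp_rw [generator_eq_add V β σ (τbar _) f]
  have h1 := h.measurable_uncurry
  exact ((continuous_generator hV hf σ 0).measurable.comp h1).add
    ((hτ.measurable.comp measurable_fst).mul
      (((contDiff_dirDeriv hf _).continuous.measurable.comp h1).const_mul _))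

variable [IsProbabilityMeasure μ]

lemma dynkin_of_hasCompactSupport (h : IsChain μ V β σ τbar N X) {f : Phase N → ℝ}
    (hf : ContDiff ℝ 2 f) (hfc : HasCompactSupport f) (T : ℝ≥0)
    (hint : Integrable (fun y : ℝ × Ω => generator V β σ N (τbar y.1) f (X y.1.toNNReal y.2))
      (pathMeasure μ T)) :
    (∫ ω, f (X T ω) ∂μ) - ∫ ω, f (X 0 ω) ∂μ =
      ∫ y, generator V β σ N (τbar y.1) f (X y.1.toNNReal y.2) ∂(pathMeasure μ T) := by
  obtain ⟨ℱ, hm, hmart⟩ := h.martingale_problem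
  have hM := hmart f hf hfc
  have hE := hM.setIntegral_eq (zero_le (a := T)) MeasurableSet.univ
  rw [setIntegral_univ, setIntegral_univ] at hE
  have hfi : Integrable (fun ω => f (X T ω)) μ := by
    obtain ⟨K, hK⟩ := hf.continuous.bounded_above_of_compact_support hfc
    exact Integrable.of_bound (hf.continuous.measurable.comp (h.measurable T)).aestronglyMeasurable
      K (ae_of_all _ fun ω => hK _)
  rw [integral_sub hfi (integrable_intervalIntegral T.coe_nonneg hint)] at hE
  simp only [NNReal.coe_zero, intervalIntegral.integral_same, sub_zero] at hE
  rw [integral_pathMeasure_symm T.coe_nonneg hint, hE]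
  ring

/-- Dynkin's formula for functions dominated by an integrable function. -/
lemma dynkin (h : IsChain μ V β σ τbar N X) (hV : Admissible V c₁ c₂ β) (hC : DominatesSq V C)
    (hτ : Continuous τbar) {f D : Phase N → ℝ} (hf : ContDiff ℝ 2 f) (T : ℝ≥0) {A : ℝ}
    (hA : 0 ≤ A)
    (hgen : ∀ s ∈ Icc (0 : ℝ) T, ∀ z,
      |generator V β σ N (τbar s) (lyapunov V C N) z| ≤ A * lyapunov V C N z)
    (hcar : ∀ z : Phase N,
      |carre N (lyapunov V C N) (lyapunov V C N) z| ≤ A * lyapunov V C N z)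
    (hfD : ∀ z, |f z| ≤ D z)
    (hgD : ∀ s ∈ Icc (0 : ℝ) T, ∀ z, |generator V β σ N (τbar s) f z| ≤ D z)
    (hcD : ∀ z, |carre N f (lyapunov V C N) z| ≤ D z)
    (hD0 : Integrable (fun ω => D (X 0 ω)) μ) (hDT : Integrable (fun ω => D (X T ω)) μ)
    (hDν : Integrable (fun y : ℝ × Ω => D (X y.1.toNNReal y.2)) (pathMeasure μ T)) :
    Integrable (fun y : ℝ × Ω => generator V β σ N (τbar y.1) f (X y.1.toNNReal y.2))
      (pathMeasure μ T) ∧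
    (∫ ω, f (X T ω) ∂μ) - ∫ ω, f (X 0 ω) ∂μ =
      ∫ y, generator V β σ N (τbar y.1) f (X y.1.toNNReal y.2) ∂(pathMeasure μ T) := by
  obtain ⟨B, hB⟩ := exists_abs_generator_truncate_le hV hC (σ := σ) hf (τs := τbar '' Icc 0 T)
    hA (by rintro _ ⟨s, hs, rfl⟩; exact hgen s hs) hcar hfD
    (by rintro _ ⟨s, hs, rfl⟩; exact hgD s hs) hcD
  have hR : ∀ n : ℕ, (1 : ℝ) ≤ n + 1 := fun n => by
    have : (0 : ℝ) ≤ n := Nat.cast_nonneg n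
    linarith
  have hbound : ∀ n : ℕ, ∀ᵐ y ∂(pathMeasure μ T),
      ‖generator V β σ N (τbar y.1) (truncate V C f (n + 1)) (X y.1.toNNReal y.2)‖ ≤
        B * D (X y.1.toNNReal y.2) := fun n => by
    filter_upwards [ae_pathMeasure_mem (μ := μ) (T : ℝ)] with y hy
    exact hB _ ⟨y.1, Ioc_subset_Icc_self hy, rfl⟩ _ (hR n) _
  have hmeas : ∀ n : ℕ, AEStronglyMeasurable (fun y : ℝ × Ω =>
      generator V β σ N (τbar y.1) (truncate V C f (n + 1)) (X y.1.toNNReal y.2))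
        (pathMeasure μ T) := fun n =>
    (h.measurable_generator hV hτ (contDiff_truncate hV hf _)).aestronglyMeasurable
  -- The martingale problem covers the truncations. They and their generators are dominated by
  -- multiples of `D` and agree with the originals once the level exceeds the energy, so both sides
  -- converge.
  have hdyn : ∀ n : ℕ, (∫ ω, truncate V C f (n + 1) (X T ω) ∂μ) -
      ∫ ω, truncate V C f (n + 1) (X 0 ω) ∂μ = ∫ y, generator V β σ N (τbar y.1)
        (truncate V C f (n + 1)) (X y.1.toNNReal y.2) ∂(pathMeasure μ T) := fun n =>
    h.dynkin_of_hasCompactSupport (contDiff_truncate hV hf _)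
      (hasCompactSupport_truncate hC f (zero_lt_one.trans_le (hR n))) T
      ((hDν.const_mul B).mono' (hmeas n) (hbound n))
  have hlim : ∀ t : ℝ≥0, Integrable (fun ω => D (X t ω)) μ → Tendsto
      (fun n : ℕ => ∫ ω, truncate V C f (n + 1) (X t ω) ∂μ) atTop (𝓝 (∫ ω, f (X t ω) ∂μ)) := by
    intro t ht
    refine tendsto_integral_of_dominated_convergence _ (fun n =>
      ((contDiff_truncate hV hf _).continuous.measurable.comp
        (h.measurable t)).aestronglyMeasurable) ht (fun n => ae_of_all _ fun ω => ?_)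
      (ae_of_all _ fun ω => ?_)
    · rw [truncate, norm_mul]
      calc ‖f (X t ω)‖ * ‖cutoff _‖ ≤ ‖f (X t ω)‖ * 1 :=
            mul_le_mul_of_nonneg_left (abs_cutoff_le _) (norm_nonneg _)
        _ ≤ _ := by rw [mul_one]; exact hfD _
    · refine tendsto_const_nhds.congr' ?_
      filter_upwards [eventually_generator_truncate_eq (C := C) hV hf σ 0 (X t ω)] with n hn
      exact hn.1.symm
  have hlimν := tendsto_integral_of_dominated_convergence _ hmeas (hDν.const_mul B) hbound
    (f := fun y : ℝ × Ω => generator V β σ N (τbar y.1) f (X y.1.toNNReal y.2))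
    (ae_of_all _ fun y => by
      refine tendsto_const_nhds.congr' ?_
      filter_upwards [eventually_generator_truncate_eq (C := C) hV hf σ (τbar y.1)
        (X y.1.toNNReal y.2)] with n hn
      exact hn.2.symm)
  refine ⟨hDν.mono' (h.measurable_generator hV hτ hf).aestronglyMeasurable ?_,
    tendsto_nhds_unique ((hlim T hDT).sub (hlim 0 hD0)) (hlimν.congr fun n => (hdyn n).symm)⟩
  filter_upwards [ae_pathMeasure_mem (μ := μ) (T : ℝ)] with y hy
  exact hgD _ (Ioc_subset_Icc_self hy) _

end IsChain

/-! ### Moment bounds -/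

/-- If `v` denotes the right-hand side, `v' = K (u + 1) ≤ K (v + 1)`, so `(v + 1) exp (-K t)`
decreases. -/
lemma gronwall_integral {u : ℝ → ℝ} (hu : Continuous u) {K a T : ℝ} (hK : 0 ≤ K) (hT : 0 ≤ T)
    (h : ∀ t ∈ Icc 0 T, u t ≤ a + ∫ s in (0 : ℝ)..t, K * (u s + 1)) :
    u T ≤ (a + 1) * Real.exp (K * T) := by
  set v : ℝ → ℝ := fun t => a + ∫ s in (0 : ℝ)..t, K * (u s + 1) with hv
  have hc : Continuous fun s => K * (u s + 1) := by fun_prop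
  have hvd : ∀ t, HasDerivAt v (K * (u t + 1)) t := fun t =>
    (hc.integral_hasStrictDerivAt 0 t).hasDerivAt.const_add a
  have hwd : ∀ t, HasDerivAt (fun t => (v t + 1) * Real.exp (-(K * t)))
      ((K * (u t + 1)) * Real.exp (-(K * t)) + (v t + 1) * (Real.exp (-(K * t)) * (-K))) t :=
    fun t => ((hvd t).add_const 1).mul (((hasDerivAt_id t).const_mul K).neg.exp.congr_deriv
      (by simp))
  have hanti : AntitoneOn (fun t => (v t + 1) * Real.exp (-(K * t))) (Icc 0 T) := by
    refine antitoneOn_of_deriv_nonpos (convex_Icc 0 T)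
      (fun t _ => (hwd t).continuousAt.continuousWithinAt)
      (fun t _ => (hwd t).differentiableAt.differentiableWithinAt) fun t ht => ?_
    rw [interior_Icc] at ht
    rw [(hwd t).deriv]
    have h1 := h t (Ioo_subset_Icc_self ht)
    have h2 : 0 ≤ (v t - u t) * (K * Real.exp (-(K * t))) :=
      mul_nonneg (by linarith) (by positivity)
    linarith
  have h1 := hanti ⟨le_rfl, hT⟩ ⟨hT, le_rfl⟩ hT
  simp only [mul_zero, neg_zero, Real.exp_zero, mul_one] at h1
  have h2 : v 0 = a := by simp [hv]
  have h3 := h T ⟨hT, le_rfl⟩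
  rw [h2, Real.exp_neg, ← div_eq_mul_inv, div_le_iff₀ (Real.exp_pos _)] at h1
  linarith

/-- A smooth bounded increasing function close to the identity. -/
noncomputable def softCap (M x : ℝ) : ℝ := M * (1 - Real.exp (-x / M))

section SoftCap

variable {M x : ℝ}

lemma contDiff_softCap {n : ℕ∞} (M : ℝ) : ContDiff ℝ n (softCap M) := by
  unfold softCap; fun_prop

lemma deriv_softCap (hM : 0 < M) : deriv (softCap M) = fun x => Real.exp (-x / M) := by
  ext x
  have : HasDerivAt (softCap M) (M * -(Real.exp (-x / M) * (-1 / M))) x :=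
    ((((hasDerivAt_id x).neg.div_const M).exp.const_sub 1).const_mul M)
  rw [this.deriv]
  field_simp

lemma deriv_deriv_softCap (hM : 0 < M) :
    deriv (deriv (softCap M)) = fun x => -(Real.exp (-x / M) / M) := by
  rw [deriv_softCap hM]
  ext x
  have : HasDerivAt (fun x => Real.exp (-x / M)) (Real.exp (-x / M) * (-1 / M)) x :=
    ((hasDerivAt_id x).neg.div_const M).exp
  rw [this.deriv]
  ring

lemma softCap_nonneg (hM : 0 < M) (hx : 0 ≤ x) : 0 ≤ softCap M x := by
  refine mul_nonneg hM.le (sub_nonneg.2 (Real.exp_le_one_iff.2 ?_))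
  rw [neg_div]
  exact neg_nonpos.2 (div_nonneg hx hM.le)

lemma softCap_le_cap (hM : 0 < M) (x : ℝ) : softCap M x ≤ M := by
  have := Real.exp_pos (-x / M)
  rw [softCap]
  nlinarith

lemma softCap_le_self (hM : 0 < M) (x : ℝ) : softCap M x ≤ x := by
  have h1 := Real.add_one_le_exp (-x / M)
  have h2 : M * (-x / M) = -x := by field_simp
  rw [softCap]
  nlinarith

/-- This is `exp (-y) (1 + y) ≤ 1` at `y = x / M`. As `exp (-x / M)` is the derivative of the cap, a
generator bounded by the energy becomes bounded by the capped energy, uniformly in `M`. -/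
lemma mul_exp_le_softCap (hM : 0 < M) (x : ℝ) : x * Real.exp (-x / M) ≤ softCap M x := by
  have h1 := Real.add_one_le_exp (x / M)
  have h2 : Real.exp (-x / M) * Real.exp (x / M) = 1 := by
    rw [← Real.exp_add, neg_div, neg_add_cancel, Real.exp_zero]
  have h3 := mul_le_mul_of_nonneg_left h1 (Real.exp_pos (-x / M)).le
  rw [h2] at h3
  have h4 := mul_le_mul_of_nonneg_left h3 hM.le
  have h5 : M * (Real.exp (-x / M) * (x / M + 1)) =
      x * Real.exp (-x / M) + M * Real.exp (-x / M) := by field_simp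
  rw [softCap]
  linarith

lemma half_le_softCap (hM : 0 < M) (hx : 0 ≤ x) (hxM : x ≤ M) : x / 2 ≤ softCap M x := by
  have h1 := mul_exp_le_softCap hM x
  have hy : x = M * (x / M) := by field_simp
  set e := Real.exp (-x / M) with he
  have h2 : softCap M x = M * (1 - e) := rfl
  have h3 : 0 < e := Real.exp_pos _
  -- Either `e ≤ 1/2` and `M (1 - e) ≥ M/2 ≥ x/2`, or `x e ≥ x/2`.
  by_cases h4 : e ≤ 1 / 2
  · nlinarith
  · push Not at h4
    nlinarith

end SoftCap

lemma carre_comm {N : ℕ} (f g : Phase N → ℝ) (z : Phase N) : carre N f g z = carre N g f z := by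
  simp only [carre, mul_comm]

namespace IsChain

variable {Ω : Type*} [mΩ : MeasurableSpace Ω] {μ : Measure Ω} [IsProbabilityMeasure μ]
  {V : ℝ → ℝ} {c₁ c₂ β C σ : ℝ} {τbar : ℝ → ℝ} {N : ℕ} {X : ℝ≥0 → Ω → Phase N}

lemma exists_lyapunov_rates (hV : Admissible V c₁ c₂ β) (hC : DominatesSq V C)
    (hN : 1 ≤ N) (σ : ℝ) (hτ : Continuous τbar) (T : ℝ) : ∃ A, 0 ≤ A ∧
      (∀ s ∈ Icc (0 : ℝ) T, ∀ z : Phase N,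
        |generator V β σ N (τbar s) (lyapunov V C N) z| ≤ A * lyapunov V C N z) ∧
      (∀ z : Phase N, |carre N (lyapunov V C N) (lyapunov V C N) z| ≤ A * lyapunov V C N z) := by
  obtain ⟨K, hK⟩ := (isCompact_Icc (a := (0 : ℝ)) (b := T)).exists_bound_of_continuousOn
    hτ.continuousOn
  obtain ⟨A₁, hA₁, h1⟩ := exists_abs_generator_lyapunov_le hV hC hN σ K
  obtain ⟨A₂, hA₂, h2⟩ := exists_rate_bounds hV hC N
  refine ⟨A₁ + A₂, by positivity, fun s hs z => (h1 _ (hK s hs) z).trans ?_,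
    fun z => (h2 z).2.trans ?_⟩ <;>
  · have := one_le_lyapunov hC z
    nlinarith

/-- The capped energy `f` satisfies `|generator f| ≤ K (f + 1)` with `K` independent of `M`. The
first order part is at most `A L exp (-L / M) ≤ A f`; in the second order part the factor `1/M`
meets `L exp (-L / M) ≤ M`. Gronwall's inequality does the rest. -/
lemma expectation_softCap_le (h : IsChain μ V β σ τbar N X) (hV : Admissible V c₁ c₂ β)
    (hC : DominatesSq V C) (hτ : Continuous τbar)
    (h0 : Integrable (fun ω => lyapunov V C N (X 0 ω)) μ) (T : ℝ≥0) {A : ℝ} (hA : 0 ≤ A)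
    (hgen : ∀ s ∈ Icc (0 : ℝ) T, ∀ z,
      |generator V β σ N (τbar s) (lyapunov V C N) z| ≤ A * lyapunov V C N z)
    (hcar : ∀ z : Phase N,
      |carre N (lyapunov V C N) (lyapunov V C N) z| ≤ A * lyapunov V C N z)
    {M : ℝ} (hM : 1 ≤ M) :
    ∫ ω, softCap M (lyapunov V C N (X T ω)) ∂μ ≤
      ((∫ ω, lyapunov V C N (X 0 ω) ∂μ) + 1) *
        Real.exp (A * (1 + |N * σ * β⁻¹|) * T) := by
  have hM0 : 0 < M := by linarith
  set c := N * σ * β⁻¹ with hc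
  set K := A * (1 + |c|) with hK
  have hK0 : 0 ≤ K := by positivity
  set f : Phase N → ℝ := fun z => softCap M (lyapunov V C N z) with hf
  have hL := contDiff_lyapunov (C := C) (N := N) hV
  have hfC : ContDiff ℝ 2 f := (contDiff_softCap (n := 2) M).comp hL
  have hL0 : ∀ z : Phase N, 0 ≤ lyapunov V C N z := fun z =>
    zero_le_one.trans (one_le_lyapunov hC z)
  have hf0 : ∀ z, 0 ≤ f z := fun z => softCap_nonneg hM0 (hL0 z)
  have hfM : ∀ z, f z ≤ M := fun z => softCap_le_cap hM0 _
  have hgenf : ∀ s ∈ Icc (0 : ℝ) T, ∀ z,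
      |generator V β σ N (τbar s) f z| ≤ K * (f z + 1) := by
    intro s hs z
    rw [hf, generator_comp V β σ (τbar s) (contDiff_softCap (n := 2) M) hL z,
      deriv_deriv_softCap hM0, deriv_softCap hM0, ← hc]
    clear_value c
    set e := Real.exp (-lyapunov V C N z / M)
    have he : 0 < e := Real.exp_pos _
    have h1 : lyapunov V C N z * e ≤ f z := mul_exp_le_softCap hM0 _
    have h2 : |e * generator V β σ N (τbar s) (lyapunov V C N) z| ≤ A * f z := by
      rw [abs_mul, abs_of_pos he]
      calc _ ≤ e * (A * lyapunov V C N z) := mul_le_mul_of_nonneg_left (hgen s hs z) he.le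
        _ = A * (lyapunov V C N z * e) := by ring
        _ ≤ _ := mul_le_mul_of_nonneg_left h1 hA
    have h3 : |-(e / M) * (c * carre N (lyapunov V C N) (lyapunov V C N) z)| ≤
        A * |c| * 1 := by
      rw [abs_mul, abs_neg, abs_div, abs_of_pos he, abs_of_pos hM0, abs_mul]
      calc _ ≤ e / M * (|c| * (A * lyapunov V C N z)) :=
            mul_le_mul_of_nonneg_left (mul_le_mul_of_nonneg_left (hcar z) (abs_nonneg _))
              (by positivity)
        _ = A * |c| * (lyapunov V C N z * e / M) := by ring
        _ ≤ _ := by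
          refine mul_le_mul_of_nonneg_left ?_ (by positivity)
          rw [div_le_one hM0]
          exact h1.trans (hfM z)
    refine (abs_add_le _ _).trans ?_
    have h4 : 0 ≤ A * |c| * f z := mul_nonneg (by positivity) (hf0 z)
    have h5 := hf0 z
    simp only [hf] at h2 h4 h5 ⊢
    rw [hK]
    nlinarith
  have hcarf : ∀ z, |carre N f (lyapunov V C N) z| ≤ A * M := by
    intro z
    rw [carre_comm, hf, carre_comp ((contDiff_softCap (n := 1) M).differentiable one_ne_zero)
      (hL.differentiable two_ne_zero), deriv_softCap hM0]
    have h1 : lyapunov V C N z * Real.exp (-lyapunov V C N z / M) ≤ f z :=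
      mul_exp_le_softCap hM0 _
    rw [abs_mul, abs_of_pos (Real.exp_pos _)]
    calc _ ≤ Real.exp (-lyapunov V C N z / M) * (A * lyapunov V C N z) :=
          mul_le_mul_of_nonneg_left (hcar z) (Real.exp_pos _).le
      _ = A * (lyapunov V C N z * Real.exp (-lyapunov V C N z / M)) := by ring
      _ ≤ _ := mul_le_mul_of_nonneg_left (h1.trans (hfM z)) hA
  have hfi : ∀ t, Integrable (fun ω => f (X t ω)) μ := fun t =>
    Integrable.of_bound (hfC.continuous.measurable.comp (h.measurable t)).aestronglyMeasurable M
      (ae_of_all _ fun ω => by rw [Real.norm_of_nonneg (hf0 _)]; exact hfM _)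
  set u : ℝ → ℝ := fun s => ∫ ω, f (X s.toNNReal ω) ∂μ with hu
  have hucont : Continuous u := by
    refine continuous_of_dominated (bound := fun _ => M) (fun s => (hfi _).aestronglyMeasurable)
      (fun s => ae_of_all _ fun ω => by rw [Real.norm_of_nonneg (hf0 _)]; exact hfM _)
      (integrable_const _) (ae_of_all _ fun ω => ?_)
    exact hfC.continuous.comp ((h.continuous_paths ω).comp continuous_real_toNNReal)
  have hmain : ∀ t ∈ Icc (0 : ℝ) T, u t ≤ u 0 + ∫ s in (0 : ℝ)..t, K * (u s + 1) := by
    intro t ht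
    lift t to ℝ≥0 using ht.1
    have hsub : ∀ s ∈ Icc (0 : ℝ) t, s ∈ Icc (0 : ℝ) T := fun s hs => ⟨hs.1, hs.2.trans ht.2⟩
    have hAM : 0 ≤ A * M := by positivity
    have hKM : 0 ≤ K * (M + 1) := by positivity
    -- The dominating constant depends on `M`; it only licenses Dynkin's formula and does not enter
    -- the Gronwall bound.
    have hd := h.dynkin hV hC hτ (D := fun _ => M + K * (M + 1) + A * M) hfC t hA
      (fun s hs => hgen s (hsub s hs)) hcar
      (fun z => by rw [abs_of_nonneg (hf0 z)]; linarith [hfM z])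
      (fun s hs z => (hgenf s (hsub s hs) z).trans (by
        have := mul_le_mul_of_nonneg_left (add_le_add (hfM z) (le_refl (1 : ℝ))) hK0
        linarith))
      (fun z => (hcarf z).trans (by linarith))
      (integrable_const _) (integrable_const _) (integrable_const _)
    have hint : Integrable (fun y : ℝ × Ω => K * (f (X y.1.toNNReal y.2) + 1))
        (pathMeasure μ t) :=
      ((Integrable.of_bound (hfC.continuous.measurable.comp
        h.measurable_uncurry).aestronglyMeasurable M (ae_of_all _ fun y => by
          rw [Function.comp_apply, Real.norm_of_nonneg (hf0 _)]; exact hfM _)).add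
        (integrable_const 1)).const_mul K
    have h1 : ∫ y, generator V β σ N (τbar y.1) f (X y.1.toNNReal y.2) ∂(pathMeasure μ t) ≤
        ∫ s in (0 : ℝ)..t, K * (u s + 1) := by
      calc _ ≤ ∫ y, K * (f (X y.1.toNNReal y.2) + 1) ∂(pathMeasure μ t) := by
            refine integral_mono_ae hd.1 hint ?_
            filter_upwards [ae_pathMeasure_mem (μ := μ) (t : ℝ)] with y hy
            exact (le_abs_self _).trans (hgenf _ (hsub _ (Ioc_subset_Icc_self hy)) _)
        _ = _ := by
            rw [integral_pathMeasure t.coe_nonneg hint]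
            refine intervalIntegral.integral_congr fun s _ => ?_
            simp only [hu]
            rw [integral_const_mul, integral_add (hfi _) (integrable_const _)]
            simp
    have h2 : u t = ∫ ω, f (X t ω) ∂μ := by simp [hu]
    have h3 : u 0 = ∫ ω, f (X 0 ω) ∂μ := by simp [hu]
    rw [h2, h3]
    linarith [hd.2]
  have hfin := gronwall_integral hucont hK0 T.coe_nonneg hmain
  have h2 : u T = ∫ ω, f (X T ω) ∂μ := by simp [hu]
  have h3 : u 0 ≤ ∫ ω, lyapunov V C N (X 0 ω) ∂μ := by
    simp only [hu, Real.toNNReal_zero]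
    exact integral_mono (hfi 0) h0 fun ω => softCap_le_self hM0 _
  have h4 : ∫ ω, f (X T ω) ∂μ ≤ (u 0 + 1) * Real.exp (K * T) := h2 ▸ hfin
  refine h4.trans (mul_le_mul_of_nonneg_right (by linarith) (Real.exp_pos _).le)

/-- The energy has bounded expectation on bounded time intervals. -/
lemma exists_expectation_lyapunov_le (h : IsChain μ V β σ τbar N X) (hV : Admissible V c₁ c₂ β)
    (hC : DominatesSq V C) (hN : 1 ≤ N) (hτ : Continuous τbar)
    (h0 : Integrable (fun ω => lyapunov V C N (X 0 ω)) μ) (T : ℝ) :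
    ∃ B, ∀ t : ℝ≥0, t ≤ T → Integrable (fun ω => lyapunov V C N (X t ω)) μ ∧
      ∫ ω, lyapunov V C N (X t ω) ∂μ ≤ B := by
  obtain ⟨A, hA, hgen, hcar⟩ := exists_lyapunov_rates hV hC hN σ hτ T
  have hL0 : ∀ z : Phase N, 0 ≤ lyapunov V C N z := fun z =>
    zero_le_one.trans (one_le_lyapunov hC z)
  set K := A * (1 + |N * σ * β⁻¹|) with hK
  have hK0 : 0 ≤ K := by positivity
  set E := (∫ ω, lyapunov V C N (X 0 ω) ∂μ) + 1 with hE
  have hE0 : 0 ≤ E := by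
    have : 0 ≤ ∫ ω, lyapunov V C N (X 0 ω) ∂μ := integral_nonneg fun ω => hL0 _
    linarith
  refine ⟨2 * (E * Real.exp (K * T)), fun t ht => ?_⟩
  have hmeas : Measurable fun ω => lyapunov V C N (X t ω) :=
    (contDiff_lyapunov hV).continuous.measurable.comp (h.measurable t)
  have hbound : ∫⁻ ω, ENNReal.ofReal (lyapunov V C N (X t ω) / 2) ∂μ ≤
      ENNReal.ofReal (E * Real.exp (K * T)) := by
    have hcap : ∀ n : ℕ, ∫⁻ ω, ENNReal.ofReal (softCap (n + 1) (lyapunov V C N (X t ω))) ∂μ ≤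
        ENNReal.ofReal (E * Real.exp (K * T)) := by
      intro n
      have hn : (1 : ℝ) ≤ n + 1 := by
        have : (0 : ℝ) ≤ n := Nat.cast_nonneg n
        linarith
      have hn0 : (0 : ℝ) < n + 1 := by linarith
      have h1 := h.expectation_softCap_le hV hC hτ h0 t hA
        (fun s hs => hgen s ⟨hs.1, hs.2.trans ht⟩) hcar hn
      rw [← ofReal_integral_eq_lintegral_ofReal]
      · refine ENNReal.ofReal_le_ofReal (h1.trans (mul_le_mul_of_nonneg_left ?_ hE0))
        exact Real.exp_le_exp.2 (mul_le_mul_of_nonneg_left ht hK0)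
      · refine Integrable.of_bound ((contDiff_softCap (n := 1) _).continuous.measurable.comp
          hmeas).aestronglyMeasurable (n + 1) (ae_of_all _ fun ω => ?_)
        rw [Real.norm_of_nonneg (softCap_nonneg hn0 (hL0 _))]
        exact softCap_le_cap hn0 _
      · exact ae_of_all _ fun ω => softCap_nonneg hn0 (hL0 _)
    -- Fatou's lemma: half of the energy lies below the cap at every level above the energy.
    calc ∫⁻ ω, ENNReal.ofReal (lyapunov V C N (X t ω) / 2) ∂μ
        ≤ ∫⁻ ω, liminf (fun n : ℕ =>
            ENNReal.ofReal (softCap (n + 1) (lyapunov V C N (X t ω)))) atTop ∂μ := by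
          refine lintegral_mono fun ω => ?_
          refine le_liminf_of_le (by isBoundedDefault) ?_
          filter_upwards [(tendsto_natCast_atTop_atTop (R := ℝ)).eventually_ge_atTop
            (lyapunov V C N (X t ω))] with n hn
          exact ENNReal.ofReal_le_ofReal
            (half_le_softCap (by positivity) (hL0 _) (by linarith))
      _ ≤ liminf (fun n : ℕ => ∫⁻ ω,
            ENNReal.ofReal (softCap (n + 1) (lyapunov V C N (X t ω))) ∂μ) atTop :=
          lintegral_liminf_le fun n => ((contDiff_softCap (n := 1)
            _).continuous.measurable.comp hmeas).ennreal_ofReal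
      _ ≤ _ := liminf_le_of_le (by isBoundedDefault) fun b hb => by
          obtain ⟨n, hn⟩ := hb.exists
          exact hn.trans (hcap n)
  have hint2 : Integrable (fun ω => lyapunov V C N (X t ω) / 2) μ := by
    refine ⟨(hmeas.div_const 2).aestronglyMeasurable, ?_⟩
    rw [hasFiniteIntegral_iff_ofReal (ae_of_all _ fun ω => div_nonneg (hL0 _) zero_le_two)]
    exact hbound.trans_lt ENNReal.ofReal_lt_top
  have hint : Integrable (fun ω => lyapunov V C N (X t ω)) μ := by
    refine (hint2.mul_const 2).congr (ae_of_all _ fun ω => ?_)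
    simp
  refine ⟨hint, ?_⟩
  have h1 : ∫ ω, lyapunov V C N (X t ω) / 2 ∂μ ≤ E * Real.exp (K * T) := by
    rw [← ofReal_integral_eq_lintegral_ofReal hint2
      (ae_of_all _ fun ω => div_nonneg (hL0 _) zero_le_two)] at hbound
    exact (ENNReal.ofReal_le_ofReal_iff (by positivity)).1 hbound
  rw [integral_div] at h1
  linarith

lemma integrable_pathMeasure_lyapunov (h : IsChain μ V β σ τbar N X) (hV : Admissible V c₁ c₂ β)
    (hC : DominatesSq V C) (hN : 1 ≤ N) (hτ : Continuous τbar)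
    (h0 : Integrable (fun ω => lyapunov V C N (X 0 ω)) μ) (T : ℝ) :
    Integrable (fun y : ℝ × Ω => lyapunov V C N (X y.1.toNNReal y.2)) (pathMeasure μ T) := by
  obtain ⟨B, hB⟩ := h.exists_expectation_lyapunov_le hV hC hN hτ h0 T
  refine integrable_pathMeasure_of_bound (B := B)
    ((contDiff_lyapunov hV).continuous.measurable.comp h.measurable_uncurry)
    (fun y => zero_le_one.trans (one_le_lyapunov hC _)) fun s hs => ?_
  exact hB s.toNNReal (by rw [Real.coe_toNNReal _ hs.1.le]; exact hs.2)

end IsChain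


/-! ### The microscopic balance of energy and length -/

lemma Admissible.exists_dominatesSq {V : ℝ → ℝ} {c₁ c₂ β : ℝ} (hV : Admissible V c₁ c₂ β) :
    ∃ C, DominatesSq V C := hV.exists_sq_le

/-- Integration by parts against the primitive of an integrable function. -/
lemma stieltjesByParts_eq_integral {f q m : ℝ → ℝ} (hf : ContDiff ℝ 1 f) {t : ℝ} (ht : 0 ≤ t)
    (hq : IntervalIntegrable q volume 0 t)
    (hm : ∀ s ∈ Icc 0 t, m s = m 0 + ∫ y in (0 : ℝ)..s, q y) :
    stieltjesByParts f m t = ∫ s in (0 : ℝ)..t, f s * q s := by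
  set g : ℝ → ℝ := fun s => ∫ y in (0 : ℝ)..s, q y with hg
  have hfc : Continuous (deriv f) := hf.continuous_deriv le_rfl
  -- `q` is merely integrable, so its primitive is differentiable only almost everywhere, and
  -- absolute continuity carries the integration by parts.
  have hgac : AbsolutelyContinuousOnInterval g 0 t :=
    hq.absolutelyContinuousOnInterval_intervalIntegral left_mem_uIcc
  have h1 := AbsolutelyContinuousOnInterval.integral_mul_deriv_eq_deriv_mul
    (hf.contDiffOn.absolutelyContinuousOnInterval (a := 0) (b := t)) hgac
  have h2 : ∫ s in (0 : ℝ)..t, f s * deriv g s = ∫ s in (0 : ℝ)..t, f s * q s := by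
    refine intervalIntegral.integral_congr_ae ?_
    filter_upwards [hq.ae_hasDerivAt_integral] with x hx hxt
    rw [(hx (uIoc_subset_uIcc hxt) 0 left_mem_uIcc).deriv]
  have h3 : ∫ s in (0 : ℝ)..t, deriv f s * m s =
      m 0 * (f t - f 0) + ∫ s in (0 : ℝ)..t, deriv f s * g s := by
    have h4 : ∫ s in (0 : ℝ)..t, deriv f s = f t - f 0 :=
      intervalIntegral.integral_eq_sub_of_hasDerivAt (fun s _ =>
        (hf.differentiable one_ne_zero s).hasDerivAt) (hfc.intervalIntegrable _ _)
    rw [← h4, ← intervalIntegral.integral_const_mul, ← intervalIntegral.integral_add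
      ((hfc.intervalIntegrable _ _).const_mul _)
      (by exact (hfc.continuousOn.mul hgac.continuousOn).intervalIntegrable)]
    refine intervalIntegral.integral_congr fun s hs => ?_
    rw [uIcc_of_le ht] at hs
    simp only [hm s hs, hg]
    ring
  have h5 : m t = m 0 + g t := hm t ⟨ht, le_rfl⟩
  have h6 : g 0 = 0 := by simp [hg]
  rw [stieltjesByParts, h3, h5, ← h2, h1, h6]
  ring

namespace IsChain

variable {Ω : Type*} [mΩ : MeasurableSpace Ω] {μ : Measure Ω} [IsProbabilityMeasure μ]
  {V : ℝ → ℝ} {c₁ c₂ β C σ : ℝ} {τbar : ℝ → ℝ} {N : ℕ} {X : ℝ≥0 → Ω → Phase N}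

lemma lyapunov_eq_energy (hN : 1 ≤ N) (z : Phase N) :
    lyapunov V C N z = N * energy V N z + (N * C + 1) := by
  have : (N : ℝ) ≠ 0 := by positivity
  rw [energy_eq, lyapunov]
  field_simp

lemma integrable_lyapunov_of_energy (hN : 1 ≤ N) {Y : Ω → Phase N}
    (h : Integrable (fun ω => energy V N (Y ω)) μ) :
    Integrable (fun ω => lyapunov V C N (Y ω)) μ := by
  simp_rw [lyapunov_eq_energy hN]
  exact (h.const_mul _).add (integrable_const _)

lemma integrable_energy_of_lyapunov (hN : 1 ≤ N) {Y : Ω → Phase N}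
    (h : Integrable (fun ω => lyapunov V C N (Y ω)) μ) :
    Integrable (fun ω => energy V N (Y ω)) μ := by
  have hN0 : (N : ℝ) ≠ 0 := by positivity
  refine ((h.sub (integrable_const (N * C + 1))).const_mul (N : ℝ)⁻¹).congr
    (ae_of_all _ fun ω => ?_)
  simp only [Pi.sub_apply, lyapunov_eq_energy hN, add_sub_cancel_right]
  field_simp

/-- A measurable function dominated by the energy is integrable along the paths. -/
lemma integrable_of_abs_le_lyapunov (h : IsChain μ V β σ τbar N X) (hV : Admissible V c₁ c₂ β)
    (hC : DominatesSq V C) (hN : 1 ≤ N) (hτ : Continuous τbar)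
    (h0 : Integrable (fun ω => energy V N (X 0 ω)) μ) {f : Phase N → ℝ} (hf : Continuous f) {A : ℝ}
    (hfA : ∀ z, |f z| ≤ A * lyapunov V C N z) :
    (∀ t, Integrable (fun ω => f (X t ω)) μ) ∧
      ∀ T, Integrable (fun y : ℝ × Ω => f (X y.1.toNNReal y.2)) (pathMeasure μ T) := by
  have h0' := integrable_lyapunov_of_energy (C := C) hN h0
  refine ⟨fun t => ?_, fun T => ?_⟩
  · obtain ⟨B, hB⟩ := h.exists_expectation_lyapunov_le hV hC hN hτ h0' t
    exact ((hB t le_rfl).1.const_mul A).mono'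
      (hf.measurable.comp (h.measurable t)).aestronglyMeasurable (ae_of_all _ fun ω => hfA _)
  · exact ((h.integrable_pathMeasure_lyapunov hV hC hN hτ h0' T).const_mul A).mono'
      (hf.measurable.comp h.measurable_uncurry).aestronglyMeasurable (ae_of_all _ fun y => hfA _)

lemma continuous_site_snd (k : ℕ) : Continuous fun z : Phase N => site z.2 k :=
  (siteP N k).continuous.congr (siteP_apply k)

lemma continuous_site_fst (k : ℕ) : Continuous fun z : Phase N => site z.1 k :=
  (siteR N k).continuous.congr (siteR_apply k)

lemma continuous_heatRate (hV : Admissible V c₁ c₂ β) : Continuous (heatRate V β N) := by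
  have h3 := fun k => continuous_site_fst (N := N) k
  have h4 := fun k => continuous_site_snd (N := N) k
  have h5 : ∀ k, Continuous fun z : Phase N => deriv V (site z.1 k) := fun k =>
    hV.continuous_deriv.comp (h3 k)
  have h6 : ∀ k, Continuous fun z : Phase N => deriv (deriv V) (site z.1 k) := fun k =>
    hV.continuous_deriv_deriv.comp (h3 k)
  unfold heatRate
  fun_prop

/-- The integrand of the work is integrable. -/
lemma integrable_workRate (h : IsChain μ V β σ τbar N X) (hV : Admissible V c₁ c₂ β)
    (hN : 1 ≤ N) (hτ : Continuous τbar) (h0 : Integrable (fun ω => energy V N (X 0 ω)) μ)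
    (T : ℝ) : Integrable (fun y : ℝ × Ω => τbar y.1 * site (X y.1.toNNReal y.2).2 N)
      (pathMeasure μ T) := by
  obtain ⟨C, hC⟩ := hV.exists_dominatesSq
  obtain ⟨K, hK⟩ := (isCompact_Icc (a := (0 : ℝ)) (b := T)).exists_bound_of_continuousOn
    hτ.continuousOn
  refine ((h.integrable_of_abs_le_lyapunov hV hC hN hτ h0 (continuous_site_snd N)
    (fun z => abs_site_le_lyapunov hC z N)).2 T).bdd_mul (c := K)
    (hτ.measurable.comp measurable_fst).aestronglyMeasurable ?_
  filter_upwards [ae_pathMeasure_mem (μ := μ) T] with y hy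
  exact hK _ (Ioc_subset_Icc_self hy)

/-- The balance of the mean energy. -/
theorem energy_balance (h : IsChain μ V β σ τbar N X) (hV : Admissible V c₁ c₂ β)
    (hN : 1 ≤ N) (hτ : Continuous τbar) (h0 : Integrable (fun ω => energy V N (X 0 ω)) μ)
    (t : ℝ≥0) :
    Integrable (fun ω => energy V N (X t ω)) μ ∧
      Integrable (fun ω => microWork τbar N (fun s => X s ω) t) μ ∧
      Integrable (fun ω => microHeat V β σ N (fun s => X s ω) t) μ ∧
      (∫ ω, energy V N (X t ω) ∂μ) - (∫ ω, energy V N (X 0 ω) ∂μ) =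
        (∫ ω, microWork τbar N (fun s => X s ω) t ∂μ) +
          ∫ ω, microHeat V β σ N (fun s => X s ω) t ∂μ := by
  obtain ⟨C, hC⟩ := hV.exists_dominatesSq
  have hN0 : (N : ℝ) ≠ 0 := by positivity
  have hL : Continuous (lyapunov V C N) := (contDiff_lyapunov hV).continuous
  obtain ⟨A, hA, hgen, hcar⟩ := exists_lyapunov_rates hV hC hN σ hτ t
  have hL1 := one_le_lyapunov (V := V) (N := N) hC
  have hLA : ∀ z : Phase N, |lyapunov V C N z| ≤ (1 + A) * lyapunov V C N z := fun z => by
    rw [abs_of_nonneg (by linarith [hL1 z])]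
    have := mul_nonneg hA (zero_le_one.trans (hL1 z))
    linarith
  have hAA : ∀ z : Phase N, A * lyapunov V C N z ≤ (1 + A) * lyapunov V C N z := fun z =>
    mul_le_mul_of_nonneg_right (by linarith) (zero_le_one.trans (hL1 z))
  obtain ⟨i1, i2⟩ := h.integrable_of_abs_le_lyapunov hV hC hN hτ h0 hL hLA
  have hwork := h.integrable_workRate hV hN hτ h0 t
  obtain ⟨B, hB0, hB⟩ := exists_rate_bounds hV hC N
  have hheat := (h.integrable_of_abs_le_lyapunov hV hC hN hτ h0 (continuous_heatRate hV)
    fun z => (hB z).1).2 t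
  -- Dynkin's formula for the shifted energy `N E_N + N C + 1`: the shift cancels between the two
  -- times, and the factor `N` is divided out at the end.
  have hd := (h.dynkin hV hC hτ (contDiff_lyapunov hV) t hA hgen hcar hLA
    (fun s hs z => (hgen s hs z).trans (hAA z)) (fun z => (hcar z).trans (hAA z))
    ((i1 0).const_mul _) ((i1 t).const_mul _) ((i2 t).const_mul _)).2
  have e1 : ∫ y, generator V β σ N (τbar y.1) (lyapunov V C N) (X y.1.toNNReal y.2)
      ∂(pathMeasure μ t) = N * (∫ ω, microWork τbar N (fun s => X s ω) t ∂μ) -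
        N * σ * ∫ ω, (∫ s in (0 : ℝ)..t, heatRate V β N (X s.toNNReal ω)) ∂μ := by
    simp_rw [generator_lyapunov hV hN]
    rw [integral_sub (hwork.const_mul _) (hheat.const_mul _), integral_const_mul,
      integral_const_mul, integral_pathMeasure_symm t.coe_nonneg hwork,
      integral_pathMeasure_symm t.coe_nonneg hheat]
    rfl
  have hQ : (fun ω => microHeat V β σ N (fun s => X s ω) t) =
      fun ω => -σ * ∫ s in (0 : ℝ)..t, heatRate V β N (X s.toNNReal ω) := rfl
  have hE := fun s => integrable_energy_of_lyapunov hN (i1 s)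
  refine ⟨hE t, integrable_intervalIntegral t.coe_nonneg hwork, ?_, ?_⟩
  · rw [hQ]
    exact (integrable_intervalIntegral t.coe_nonneg hheat).const_mul _
  · rw [hQ, integral_const_mul]
    rw [e1] at hd
    simp_rw [lyapunov_eq_energy hN] at hd
    rw [integral_add ((hE t).const_mul _) (integrable_const _),
      integral_add ((hE 0).const_mul _) (integrable_const _), integral_const_mul,
      integral_const_mul] at hd
    refine mul_left_cancel₀ hN0 ?_
    linarith

lemma exists_abs_meanLength_le (hC : DominatesSq V C) (hN : 1 ≤ N) :
    ∃ A, 0 ≤ A ∧ ∀ z : Phase N, |length N z| ≤ A * lyapunov V C N z ∧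
      |meanLength N z| ≤ A * lyapunov V C N z := by
  have hN0 : (1 : ℝ) ≤ N := by exact_mod_cast hN
  have hC0 := hC.1
  have h1 : ∀ z : Phase N, |length N z| ≤ N * (1 + C) * lyapunov V C N z := fun z => by
    rw [length, sum_apply]
    refine (Finset.abs_sum_le_sum_abs _ _).trans ?_
    calc _ ≤ ∑ i ∈ Finset.Icc 1 N, (1 + C) * lyapunov V C N z :=
          Finset.sum_le_sum fun i _ => by
            have h1 := siteR_sq_le_lyapunov hC z i
            have h2 := one_le_lyapunov hC z
            rw [abs_le]
            constructor <;> nlinarith [sq_nonneg (siteR N i z - 1), sq_nonneg (siteR N i z + 1)]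
      _ = _ := by simp; ring
  refine ⟨N * (1 + C), by positivity, fun z => ⟨h1 z, ?_⟩⟩
  rw [meanLength_eq, abs_mul, abs_of_nonneg (by positivity)]
  refine le_trans ?_ (h1 z)
  exact mul_le_of_le_one_left (abs_nonneg _) ((div_le_one (by linarith)).2 hN0)

/-- The balance of the mean length. -/
theorem length_balance (h : IsChain μ V β σ τbar N X) (hV : Admissible V c₁ c₂ β)
    (hN : 1 ≤ N) (hτ : Continuous τbar) (h0 : Integrable (fun ω => energy V N (X 0 ω)) μ)
    (t : ℝ≥0) :
    ∫ ω, meanLength N (X t ω) ∂μ = (∫ ω, meanLength N (X 0 ω) ∂μ) +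
      ∫ s in (0 : ℝ)..t, ∫ ω, site (X s.toNNReal ω).2 N ∂μ := by
  obtain ⟨C, hC⟩ := hV.exists_dominatesSq
  have hN0 : (N : ℝ) ≠ 0 := by positivity
  obtain ⟨A₁, hA₁, hgen, hcar⟩ := exists_lyapunov_rates hV hC hN σ hτ t
  obtain ⟨A₂, hA₂, hlen⟩ := exists_abs_meanLength_le (V := V) hC hN
  have hL1 := one_le_lyapunov (V := V) (N := N) hC
  set D : ℝ := A₂ + N * 2 with hD
  have hle : ∀ (z : Phase N) (a : ℝ), a ≤ D → a * lyapunov V C N z ≤ D * lyapunov V C N z :=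
    fun z a ha => mul_le_mul_of_nonneg_right ha (zero_le_one.trans (hL1 z))
  obtain ⟨i1, i2⟩ := h.integrable_of_abs_le_lyapunov (A := 1) hV hC hN hτ h0
    (contDiff_lyapunov hV).continuous fun z => by
      rw [abs_of_nonneg (zero_le_one.trans (hL1 z)), one_mul]
  obtain ⟨j1, -⟩ := h.integrable_of_abs_le_lyapunov hV hC hN hτ h0
    (length N).continuous fun z => (hlen z).1
  have hp := (h.integrable_of_abs_le_lyapunov hV hC hN hτ h0
    (continuous_site_snd N) fun z => abs_site_le_lyapunov hC z N).2 t
  have hd := (h.dynkin hV hC hτ (f := length N) (D := fun z => D * lyapunov V C N z)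
    (length N).contDiff t hA₁ hgen hcar
    (fun z => (hlen z).1.trans (hle z _ (by rw [hD]; linarith [Nat.cast_nonneg (α := ℝ) N])))
    (fun s _ z => by
      rw [generator_length hN, abs_mul, Nat.abs_cast]
      refine (mul_le_mul_of_nonneg_left (abs_site_le_lyapunov hC z N)
        (Nat.cast_nonneg N)).trans ?_
      rw [← mul_assoc]
      exact hle z _ (by rw [hD]; linarith))
    (fun z => by
      rw [carre_length, abs_zero]
      have := hL1 z
      positivity)
    ((i1 0).const_mul _) ((i1 t).const_mul _) ((i2 t).const_mul _)).2
  simp_rw [generator_length hN] at hd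
  rw [integral_const_mul, integral_pathMeasure t.coe_nonneg hp] at hd
  simp_rw [meanLength_eq]
  rw [integral_const_mul, integral_const_mul]
  have := sub_eq_iff_eq_add'.1 hd
  rw [this]
  field_simp

/-- The mean work is a functional of the mean length. -/
theorem expectation_microWork (h : IsChain μ V β σ τbar N X) (hV : Admissible V c₁ c₂ β)
    (hN : 1 ≤ N) (hτ : ContDiff ℝ 1 τbar) (h0 : Integrable (fun ω => energy V N (X 0 ω)) μ)
    (t : ℝ≥0) :
    ∫ ω, microWork τbar N (fun s => X s ω) t ∂μ =
      stieltjesByParts τbar (fun s => ∫ ω, meanLength N (X s.toNNReal ω) ∂μ) t := by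
  obtain ⟨C, hC⟩ := hV.exists_dominatesSq
  have hp := (h.integrable_of_abs_le_lyapunov hV hC hN hτ.continuous h0
    (continuous_site_snd N) fun z => abs_site_le_lyapunov hC z N).2 t
  have hw := h.integrable_workRate hV hN hτ.continuous h0 t
  -- The mean length is the primitive of the mean end velocity, by the balance of length.
  rw [stieltjesByParts_eq_integral hτ t.coe_nonneg
    (intervalIntegrable_expectation t.coe_nonneg hp) fun s hs => ?_]
  · have := integral_pathMeasure_symm t.coe_nonneg hw
    rw [integral_pathMeasure t.coe_nonneg hw] at this
    rw [show (fun ω => microWork τbar N (fun s => X s ω) t) =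
      fun ω => ∫ s in (0 : ℝ)..t, τbar s * site (X s.toNNReal ω).2 N from rfl, ← this]
    exact intervalIntegral.integral_congr fun s _ =>
      integral_const_mul (τbar s) fun ω => site (X s.toNNReal ω).2 N
  · have := h.length_balance hV hN hτ.continuous h0 s.toNNReal
    rw [Real.coe_toNNReal _ hs.1] at this
    simpa using this

end IsChain


/-! ### Weak limits in time -/

lemma exists_time_horizon {ψ : ℝ → ℝ} (hψ : HasCompactSupport ψ) :
    ∃ T, 0 < T ∧ ∀ t, T ≤ t → ψ t = 0 := by
  obtain ⟨R, hR⟩ := hψ.isCompact.isBounded.subset_closedBall 0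
  refine ⟨|R| + 1, by positivity, fun t ht => ?_⟩
  by_contra h
  have := hR (subset_tsupport _ h)
  rw [Metric.mem_closedBall, dist_zero_right, Real.norm_eq_abs] at this
  linarith [le_abs_self t, le_abs_self R]

lemma setIntegral_Ioi_eq_intervalIntegral {g : ℝ → ℝ} {T : ℝ} (hT : 0 ≤ T)
    (hg : ∀ t, T ≤ t → g t = 0) : ∫ t in Ioi (0 : ℝ), g t = ∫ t in (0 : ℝ)..T, g t := by
  rw [intervalIntegral.integral_of_le hT]
  exact setIntegral_eq_of_subset_of_forall_sdiff_eq_zero measurableSet_Ioi Ioc_subset_Ioi_self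
    fun t ht => hg t (not_lt.1 fun h => ht.2 ⟨ht.1, h.le⟩)

lemma intervalIntegrable_stieltjesByParts {f m : ℝ → ℝ} (hf : ContDiff ℝ 1 f) {T : ℝ}
    (hm : IntervalIntegrable m volume 0 T) :
    IntervalIntegrable (stieltjesByParts f m) volume 0 T := by
  have hq : IntervalIntegrable (fun s => deriv f s * m s) volume 0 T :=
    hm.continuousOn_mul (hf.continuous_deriv le_rfl).continuousOn
  refine ((hm.continuousOn_mul hf.continuous.continuousOn).sub
    (intervalIntegrable_const (c := f 0 * m 0))).sub ?_
  refine ContinuousOn.intervalIntegrable ?_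
  exact intervalIntegral.continuousOn_primitive_interval' hq left_mem_uIcc

/-- The weak limits of Riemann–Stieltjes integrals in time are governed by those of the
integrator. -/
lemma exists_weak_stieltjesByParts {f ψ : ℝ → ℝ} (hf : ContDiff ℝ 1 f) (hψ : Continuous ψ)
    (hψc : HasCompactSupport ψ) :
    ∃ χ : ℝ → ℝ, Continuous χ ∧ HasCompactSupport χ ∧ ∀ m : ℝ → ℝ,
      (∀ T, 0 ≤ T → IntervalIntegrable m volume 0 T) →
      ∫ t in Ioi (0 : ℝ), ψ t * stieltjesByParts f m t =
        (∫ t in Ioi (0 : ℝ), χ t * m t) - f 0 * m 0 * ∫ t in Ioi (0 : ℝ), ψ t := by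
  obtain ⟨T, hT, hψT⟩ := exists_time_horizon hψc
  have hfc : Continuous (deriv f) := hf.continuous_deriv le_rfl
  -- `Ψ(t) = ∫_t^T ψ`. Integration by parts turns `∫ ψ(t) ∫_0^t f' m` into `∫ Ψ f' m`, so that `m`
  -- is tested against a function of time.
  set Ψ : ℝ → ℝ := fun t => -∫ s in T..t, ψ s with hΨ
  have hΨd : ∀ t, HasDerivAt Ψ (-ψ t) t := fun t =>
    (intervalIntegral.integral_hasDerivAt_right (hψ.intervalIntegrable _ _)
      (hψ.stronglyMeasurableAtFilter _ _) hψ.continuousAt).neg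
  have hΨ' : deriv Ψ = fun t => -ψ t := funext fun t => (hΨd t).deriv
  have hΨ1 : ContDiff ℝ 1 Ψ := by
    rw [contDiff_one_iff_deriv, hΨ']
    exact ⟨fun t => (hΨd t).differentiableAt, hψ.neg⟩
  have hΨT : ∀ t, T ≤ t → Ψ t = 0 := fun t ht => by
    rw [hΨ, neg_eq_zero]
    refine intervalIntegral.integral_zero_ae (ae_of_all _ fun s hs => hψT s ?_)
    rw [uIoc_of_le ht] at hs
    exact hs.1.le
  -- `Ψ` need not vanish at negative times; the factor `κ`, equal to `1` on `[0, ∞)`, restores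
  -- compact support.
  set κ : ℝ → ℝ := fun t => max 0 (min 1 (t + 1)) with hκ
  have hκ1 : ∀ t, 0 ≤ t → κ t = 1 := fun t ht => by
    rw [hκ]; simp only; rw [min_eq_left (by linarith)]; exact max_eq_right zero_le_one
  have hκ0 : ∀ t, t ≤ -1 → κ t = 0 := fun t ht => by
    rw [hκ]; simp only; rw [max_eq_left]; exact (min_le_right _ _).trans (by linarith)
  have hκc : Continuous κ := by fun_prop
  refine ⟨fun t => ψ t * f t - deriv f t * (κ t * Ψ t),
    (hψ.mul hf.continuous).sub (hfc.mul (hκc.mul hΨ1.continuous)), ?_, fun m hm => ?_⟩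
  · refine HasCompactSupport.sub hψc.mul_right (HasCompactSupport.mul_left ?_)
    refine HasCompactSupport.intro (isCompact_Icc (a := -1) (b := T)) fun t ht => ?_
    rcases lt_or_ge t (-1) with h | h
    · rw [hκ0 t h.le, zero_mul]
    · rw [hΨT t (not_lt.1 fun h' => ht ⟨h, h'.le⟩), mul_zero]
  · have hmT := hm T hT.le
    have hq : IntervalIntegrable (fun s => deriv f s * m s) volume 0 T :=
      hmT.continuousOn_mul hfc.continuousOn
    rw [setIntegral_Ioi_eq_intervalIntegral hT.le (fun t ht => by rw [hψT t ht, zero_mul]),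
      setIntegral_Ioi_eq_intervalIntegral hT.le
        (fun t ht => by simp only [hψT t ht, hΨT t ht]; ring),
      setIntegral_Ioi_eq_intervalIntegral hT.le hψT]
    set G : ℝ → ℝ := fun t => ∫ s in (0 : ℝ)..t, deriv f s * m s with hG
    have hGc : ContinuousOn G (uIcc 0 T) :=
      intervalIntegral.continuousOn_primitive_interval' hq left_mem_uIcc
    have hG0 : G 0 = 0 := by simp [hG]
    have key := stieltjesByParts_eq_integral hΨ1 hT.le hq (m := G)
      fun s _ => by rw [hG0, zero_add]
    rw [stieltjesByParts, hΨT T le_rfl, hG0, hΨ'] at key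
    have i1 : IntervalIntegrable (fun t => ψ t * (f t * m t)) volume 0 T :=
      (hmT.continuousOn_mul hf.continuous.continuousOn).continuousOn_mul hψ.continuousOn
    have i2 : IntervalIntegrable (fun t => ψ t * (f 0 * m 0)) volume 0 T :=
      (hψ.mul continuous_const).intervalIntegrable _ _
    have i3 : IntervalIntegrable (fun t => ψ t * G t) volume 0 T :=
      (hψ.continuousOn.mul hGc).intervalIntegrable
    have i4 : IntervalIntegrable (fun t => Ψ t * (deriv f t * m t)) volume 0 T :=
      hq.continuousOn_mul hΨ1.continuous.continuousOn
    have e1 : ∫ t in (0 : ℝ)..T, ψ t * stieltjesByParts f m t =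
        (∫ t in (0 : ℝ)..T, ψ t * (f t * m t)) - (∫ t in (0 : ℝ)..T, ψ t * (f 0 * m 0)) -
          ∫ t in (0 : ℝ)..T, ψ t * G t := by
      rw [← intervalIntegral.integral_sub i1 i2, ← intervalIntegral.integral_sub (i1.sub i2) i3]
      refine intervalIntegral.integral_congr fun t _ => ?_
      simp only [stieltjesByParts, hG]
      ring
    have e2 : ∫ t in (0 : ℝ)..T, (ψ t * f t - deriv f t * (κ t * Ψ t)) * m t =
        (∫ t in (0 : ℝ)..T, ψ t * (f t * m t)) -
          ∫ t in (0 : ℝ)..T, Ψ t * (deriv f t * m t) := by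
      rw [← intervalIntegral.integral_sub i1 i4]
      refine intervalIntegral.integral_congr fun t ht => ?_
      rw [uIcc_of_le hT.le] at ht
      simp only [hκ1 t ht.1]
      ring
    have e3 : ∫ t in (0 : ℝ)..T, -ψ t * G t = -∫ t in (0 : ℝ)..T, ψ t * G t := by
      rw [← intervalIntegral.integral_neg]
      exact intervalIntegral.integral_congr fun t _ => by ring
    rw [e1, e2, ← key, intervalIntegral.integral_mul_const, e3]
    ring

/-- Weak convergence does not see a single time, whereas the by-parts formula involves `m 0`; its
convergence is therefore required separately, which is where the initial mean length enters. -/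
lemma tendsto_weak_stieltjesByParts {f ψ : ℝ → ℝ} (hf : ContDiff ℝ 1 f) (hψ : Continuous ψ)
    (hψc : HasCompactSupport ψ) {m : ℕ → ℝ → ℝ} {m' : ℝ → ℝ}
    (hm : ∀ᶠ k in atTop, ∀ T, 0 ≤ T → IntervalIntegrable (m k) volume 0 T)
    (hm' : ∀ T, 0 ≤ T → IntervalIntegrable m' volume 0 T)
    (h0 : Tendsto (fun k => m k 0) atTop (𝓝 (m' 0)))
    (h : ∀ χ : ℝ → ℝ, Continuous χ → HasCompactSupport χ →
      Tendsto (fun k => ∫ t in Ioi (0 : ℝ), χ t * m k t) atTop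
        (𝓝 (∫ t in Ioi (0 : ℝ), χ t * m' t))) :
    Tendsto (fun k => ∫ t in Ioi (0 : ℝ), ψ t * stieltjesByParts f (m k) t) atTop
      (𝓝 (∫ t in Ioi (0 : ℝ), ψ t * stieltjesByParts f m' t)) := by
  obtain ⟨χ, hχ, hχc, e⟩ := exists_weak_stieltjesByParts hf hψ hψc
  rw [e m' hm']
  refine ((h χ hχ hχc).sub ((h0.const_mul (f 0)).mul_const _)).congr' ?_
  filter_upwards [hm] with k hk
  rw [e _ hk]

/-! ### Interchange of the integrals over time, space and probability -/

section Fubini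

variable {Ω : Type*} [MeasurableSpace Ω]

/-- The product of Lebesgue measure on `(0, T]`, of a probability measure and of Lebesgue measure
on `(0, 1]`. -/
noncomputable def fieldMeasure (μ : Measure Ω) (T : ℝ) : Measure (ℝ × Ω × ℝ) :=
  (volume.restrict (Ioc 0 T)).prod (μ.prod (volume.restrict (Ioc 0 1)))

variable {μ : Measure Ω} [IsProbabilityMeasure μ] {F : ℝ × Ω × ℝ → ℝ} {T : ℝ}

instance : IsFiniteMeasure (fieldMeasure μ T) := by
  unfold fieldMeasure; infer_instance

lemma _root_.MeasureTheory.MeasurePreserving.integral_comp_of_integrable {α γ : Type*}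
    [MeasurableSpace α] [MeasurableSpace γ] {ν₁ : Measure α} {ν₂ : Measure γ} {e : α → γ}
    (he : MeasurePreserving e ν₁ ν₂) {g : γ → ℝ} (hg : Integrable g ν₂) :
    ∫ a, g (e a) ∂ν₁ = ∫ y, g y ∂ν₂ := by
  rw [← he.map_eq] at hg ⊢
  exact (integral_map he.aemeasurable hg.aestronglyMeasurable).symm

/-- Integration over space. -/
lemma integrable_integral_space (hF : Integrable F (fieldMeasure μ T)) :
    Integrable (fun y : ℝ × Ω => ∫ x in (0 : ℝ)..1, F (y.1, y.2, x)) (pathMeasure μ T) := by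
  simp_rw [intervalIntegral.integral_of_le zero_le_one]
  have h := (measurePreserving_prodAssoc (volume.restrict (Ioc 0 T)) μ
    (volume.restrict (Ioc (0 : ℝ) 1))).integrable_comp_of_integrable hF
  exact h.integral_prod_left

/-- Interchange of the integrals over time, probability and space. -/
lemma integral_space_time_expectation (hT : 0 ≤ T) (hF : Integrable F (fieldMeasure μ T)) :
    ∫ x in (0 : ℝ)..1, ∫ t in (0 : ℝ)..T, ∫ ω, F (t, ω, x) ∂μ =
      ∫ t in (0 : ℝ)..T, ∫ ω, (∫ x in (0 : ℝ)..1, F (t, ω, x)) ∂μ := by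
  have e := ((MeasurePreserving.id (volume.restrict (Ioc 0 T))).prod
    (Measure.measurePreserving_swap (μ := volume.restrict (Ioc (0 : ℝ) 1)) (ν := μ))).comp
      (measurePreserving_prodAssoc _ _ _)
  have e' := measurePreserving_prodAssoc (volume.restrict (Ioc 0 T)) μ
    (volume.restrict (Ioc (0 : ℝ) 1))
  have hH := e.integrable_comp_of_integrable hF
  have hH' := e'.integrable_comp_of_integrable hF
  have h1 := integral_prod _ hH
  rw [integral_prod_symm _ hH.integral_prod_left] at h1
  have h2 := integral_prod _ hH'
  rw [integral_prod _ hH'.integral_prod_left] at h2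
  simp_rw [intervalIntegral.integral_of_le hT, intervalIntegral.integral_of_le zero_le_one]
  exact h1.symm.trans ((e.integral_comp_of_integrable hF).trans
    ((e'.integral_comp_of_integrable hF).symm.trans h2))

/-- Converts test functions of `(t, x)`, with space outermost, into test functions of time alone
applied to space integrals. The factor `η` only makes the test function compactly supported in
space. -/
lemma integral_weak_field {ψ η : ℝ → ℝ} (hψ : Continuous ψ) (hψc : HasCompactSupport ψ)
    (hη : ∀ x ∈ Icc (0 : ℝ) 1, η x = 1) (hF : ∀ T, Integrable F (fieldMeasure μ T)) :
    ∫ x in (0 : ℝ)..1, ∫ t in Ioi (0 : ℝ), (ψ t * η x) * ∫ ω, F (t, ω, x) ∂μ =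
      ∫ t in Ioi (0 : ℝ), ψ t * ∫ ω, (∫ x in (0 : ℝ)..1, F (t, ω, x)) ∂μ := by
  obtain ⟨T, hT, hψT⟩ := exists_time_horizon hψc
  obtain ⟨K, hK⟩ := hψ.bounded_above_of_compact_support hψc
  have hG : Integrable (fun y : ℝ × Ω × ℝ => ψ y.1 * F y) (fieldMeasure μ T) :=
    (hF T).bdd_mul (hψ.measurable.comp measurable_fst).aestronglyMeasurable
      (ae_of_all _ fun y => hK _)
  have h := integral_space_time_expectation hT.le hG
  rw [setIntegral_Ioi_eq_intervalIntegral hT.le fun t ht => by rw [hψT t ht, zero_mul]]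
  simp only [integral_const_mul, intervalIntegral.integral_const_mul] at h
  rw [← h]
  refine intervalIntegral.integral_congr fun x hx => ?_
  rw [uIcc_of_le zero_le_one] at hx
  simp only [hη x hx, mul_one]
  exact setIntegral_Ioi_eq_intervalIntegral hT.le fun t ht => by rw [hψT t ht, zero_mul]

end Fubini

/-- A continuous compactly supported function equal to `1` on the unit interval. -/
noncomputable def spaceCutoff (x : ℝ) : ℝ := max 0 (min 1 (2 - |x|))

lemma continuous_spaceCutoff : Continuous spaceCutoff := by
  unfold spaceCutoff; fun_prop

lemma spaceCutoff_eq_one {x : ℝ} (hx : x ∈ Icc (0 : ℝ) 1) : spaceCutoff x = 1 := by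
  rw [spaceCutoff, abs_of_nonneg hx.1, min_eq_left (by linarith [hx.2])]
  exact max_eq_right zero_le_one

lemma hasCompactSupport_mul_spaceCutoff {ψ : ℝ → ℝ} (hψ : HasCompactSupport ψ) :
    HasCompactSupport fun y : ℝ × ℝ => ψ y.1 * spaceCutoff y.2 := by
  refine HasCompactSupport.intro (hψ.isCompact.prod (isCompact_Icc (a := (-2 : ℝ)) (b := 2)))
    fun y hy => ?_
  by_cases h1 : y.1 ∈ tsupport ψ
  · have h2 : 2 ≤ |y.2| := by
      by_contra h
      exact hy ⟨h1, abs_le.1 (not_le.1 h).le⟩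
    rw [spaceCutoff, max_eq_left, mul_zero]
    exact (min_le_right _ _).trans (by linarith)
  · rw [image_eq_zero_of_notMem_tsupport h1, zero_mul]

lemma continuous_mul_spaceCutoff {ψ : ℝ → ℝ} (hψ : Continuous ψ) :
    Continuous fun y : ℝ × ℝ => ψ y.1 * spaceCutoff y.2 :=
  (hψ.comp continuous_fst).mul (continuous_spaceCutoff.comp continuous_snd)

namespace IsLimitProfile

variable {Ω : ℕ → Type*} [∀ N, MeasurableSpace (Ω N)]
  {P : ∀ N, Measure (Ω N)} [∀ N, IsProbabilityMeasure (P N)]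
  {X : ∀ N, ℝ≥0 → Ω N → Phase N} {φ : ℕ → ℕ}
  {Ω' : Type*} [MeasurableSpace Ω'] {P' : Measure Ω'} [IsProbabilityMeasure P']
  {r p : Ω' → ℝ → ℝ → ℝ}

lemma integrable_field_sq (h : IsLimitProfile P X φ P' r p) (T : ℝ) :
    Integrable (fun y : ℝ × Ω' × ℝ => r y.2.1 y.1 y.2.2 ^ 2 + p y.2.1 y.1 y.2.2 ^ 2)
      (fieldMeasure P' T) := by
  have hm : Measurable fun y : ℝ × Ω' × ℝ => r y.2.1 y.1 y.2.2 ^ 2 + p y.2.1 y.1 y.2.2 ^ 2 := by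
    have hs : Measurable fun y : ℝ × Ω' × ℝ => (y.2.1, y.1, y.2.2) := by fun_prop
    exact ((h.measurable_r.comp hs).pow_const 2).add ((h.measurable_p.comp hs).pow_const 2)
  refine ⟨hm.aestronglyMeasurable, ?_⟩
  rw [hasFiniteIntegral_iff_ofReal (ae_of_all _ fun y => by positivity), fieldMeasure,
    lintegral_prod _ hm.ennreal_ofReal.aemeasurable]
  have h1 : ∀ t, ∫⁻ y : Ω' × ℝ, ENNReal.ofReal (r y.1 t y.2 ^ 2 + p y.1 t y.2 ^ 2)
      ∂(P'.prod (volume.restrict (Ioc 0 1))) = ∫⁻ ω, (∫⁻ x in Icc (0 : ℝ) 1,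
        ENNReal.ofReal (r ω t x ^ 2 + p ω t x ^ 2)) ∂P' := fun t => by
    rw [restrict_Ioc_eq_restrict_Icc, lintegral_prod]
    exact (hm.comp measurable_prodMk_left).ennreal_ofReal.aemeasurable
  simp_rw [h1]
  rw [lintegral_lintegral_swap]
  · exact h.square_integrable T
  · refine Measurable.aemeasurable (Measurable.lintegral_prod_right'
      (f := fun y : (ℝ × Ω') × ℝ =>
        ENNReal.ofReal (r y.1.2 y.1.1 y.2 ^ 2 + p y.1.2 y.1.1 y.2 ^ 2)) ?_)
    have hs : Measurable fun y : (ℝ × Ω') × ℝ => (y.1.1, y.1.2, y.2) := by fun_prop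
    exact (hm.comp hs).ennreal_ofReal

/-- Continuous functions of quadratic growth of the limit profile are integrable. -/
lemma integrable_field (h : IsLimitProfile P X φ P' r p) (T : ℝ) {f : ℝ × ℝ → ℝ}
    (hf : Continuous f) {C : ℝ} (hfC : ∀ y, |f y| ≤ C * (1 + y.1 ^ 2 + y.2 ^ 2)) :
    Integrable (fun y : ℝ × Ω' × ℝ => f (r y.2.1 y.1 y.2.2, p y.2.1 y.1 y.2.2))
      (fieldMeasure P' T) := by
  have hs : Measurable fun y : ℝ × Ω' × ℝ => (y.2.1, y.1, y.2.2) := by fun_prop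
  refine (((integrable_const 1).add (h.integrable_field_sq T)).const_mul C).mono'
    (hf.measurable.comp ((h.measurable_r.comp hs).prodMk
      (h.measurable_p.comp hs))).aestronglyMeasurable (ae_of_all _ fun y => ?_)
  rw [Pi.add_apply, ← add_assoc]
  exact hfC _

end IsLimitProfile


/-! ### Convergence of the energy and of the length -/

lemma expectation_weak {Ω : Type*} [MeasurableSpace Ω] {μ : Measure Ω} [IsProbabilityMeasure μ]
    {ψ : ℝ → ℝ} (hψ : Continuous ψ) (hψc : HasCompactSupport ψ) {G : ℝ × Ω → ℝ}
    (hG : ∀ T, Integrable G (pathMeasure μ T)) :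
    Integrable (fun ω => ∫ t in Ioi (0 : ℝ), ψ t * G (t, ω)) μ ∧
      ∫ ω, (∫ t in Ioi (0 : ℝ), ψ t * G (t, ω)) ∂μ =
        ∫ t in Ioi (0 : ℝ), ψ t * ∫ ω, G (t, ω) ∂μ := by
  obtain ⟨T, hT, hψT⟩ := exists_time_horizon hψc
  obtain ⟨K, hK⟩ := hψ.bounded_above_of_compact_support hψc
  have hG' : Integrable (fun y : ℝ × Ω => ψ y.1 * G y) (pathMeasure μ T) :=
    (hG T).bdd_mul (hψ.measurable.comp measurable_fst).aestronglyMeasurable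
      (ae_of_all _ fun y => hK _)
  have e : ∀ g : ℝ → ℝ, ∫ t in Ioi (0 : ℝ), ψ t * g t = ∫ t in (0 : ℝ)..T, ψ t * g t := fun g =>
    setIntegral_Ioi_eq_intervalIntegral hT.le fun t ht => by rw [hψT t ht, zero_mul]
  simp_rw [e]
  refine ⟨integrable_intervalIntegral hT.le hG', ?_⟩
  rw [← integral_pathMeasure_symm hT.le hG', integral_pathMeasure hT.le hG']
  exact intervalIntegral.integral_congr fun t _ => integral_const_mul (ψ t) fun ω => G (t, ω)

/-! ### Bounds and measurability of the block averages. -/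

section Blocks

variable {V : ℝ → ℝ} {C : ℝ} {N : ℕ}

/-- A crude bound, with a constant depending on `N` and `l`. It serves integrability at fixed `N`,
where no uniformity is needed. -/
lemma exists_abs_blockProfile_le (N l : ℕ) :
    ∃ A : ℝ, 0 ≤ A ∧ ∀ (q : Fin N → ℝ) (S : ℝ), (∀ k, |site q k| ≤ S) →
      ∀ x, |blockProfile l q x| ≤ A * S := by
  set A : ℝ := |1 / (l : ℝ)| * ∑ j ∈ Finset.Ioo (-(l : ℤ)) (l : ℤ),
    |((l : ℝ) - |(j : ℝ)|) / l| with hA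
  have hA0 : 0 ≤ A := mul_nonneg (abs_nonneg _) (Finset.sum_nonneg fun _ _ => abs_nonneg _)
  refine ⟨((Finset.Icc l (N + 1 - l)).card : ℝ) * A, by positivity, fun q S hS x => ?_⟩
  have hS0 : 0 ≤ S := (abs_nonneg _).trans (hS 0)
  have hb : ∀ i, |blockAvg l q i| ≤ A * S := fun i => by
    rw [blockAvg, abs_mul, hA, mul_assoc, Finset.sum_mul]
    refine mul_le_mul_of_nonneg_left ?_ (abs_nonneg _)
    refine (Finset.abs_sum_le_sum_abs _ _).trans (Finset.sum_le_sum fun j _ => ?_)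
    rw [abs_mul]
    exact mul_le_mul_of_nonneg_left (hS _) (abs_nonneg _)
  rw [blockProfile, mul_assoc, ← nsmul_eq_mul]
  refine (Finset.abs_sum_le_sum_abs _ _).trans (Finset.sum_le_card_nsmul _ _ _ fun i _ => ?_)
  by_cases hx : x ∈ Metric.ball ((i : ℝ) / N) (1 / (2 * N))
  · rw [indicator_of_mem hx]
    exact hb i
  · rw [indicator_of_notMem hx, abs_zero]
    positivity

lemma exists_uhat_sq_le (hC : DominatesSq V C) (N l : ℕ) :
    ∃ A : ℝ, 0 ≤ A ∧ ∀ (z : Phase N) (x : ℝ),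
      (uhat l z x).1 ^ 2 ≤ A * lyapunov V C N z ∧ (uhat l z x).2 ^ 2 ≤ A * lyapunov V C N z := by
  obtain ⟨A, hA, h⟩ := exists_abs_blockProfile_le N l
  have hC0 := hC.1
  have key : ∀ (z : Phase N) (q : Fin N → ℝ), (∀ k, site q k ^ 2 ≤ (C + 2) * lyapunov V C N z) →
      ∀ x, blockProfile l q x ^ 2 ≤ A ^ 2 * (C + 2) * lyapunov V C N z := fun z q hq x => by
    have hL := one_le_lyapunov hC z
    have h1 := h q (Real.sqrt ((C + 2) * lyapunov V C N z))
      (fun k => Real.abs_le_sqrt (hq k)) x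
    have h2 := pow_le_pow_left₀ (abs_nonneg _) h1 2
    rwa [sq_abs, mul_pow, Real.sq_sqrt (by positivity), ← mul_assoc] at h2
  refine ⟨A ^ 2 * (C + 2), by positivity, fun z x => ?_⟩
  have hL := one_le_lyapunov hC z
  refine ⟨key z _ (fun k => ?_) x, key z _ (fun k => ?_) x⟩
  · have := siteR_sq_le_lyapunov hC z k
    rw [siteR_apply] at this
    linarith
  · have := siteP_sq_le_lyapunov hC z k
    rw [siteP_apply] at this
    have := mul_nonneg hC0 (zero_le_one.trans hL)
    linarith

lemma measurable_uhat (N l : ℕ) : Measurable fun y : Phase N × ℝ => uhat l y.1 y.2 := by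
  have hb : ∀ q : Phase N → Fin N → ℝ, (∀ k, Continuous fun z => site (q z) k) →
      Measurable fun y : Phase N × ℝ => blockProfile l (q y.1) y.2 := fun q hq => by
    unfold blockProfile
    refine Finset.measurable_sum _ fun i _ => ?_
    have h1 : Continuous fun z => blockAvg l (q z) i := by
      unfold blockAvg
      exact continuous_const.mul (continuous_finsetSum _ fun j _ => continuous_const.mul (hq _))
    have h2 : (fun y : Phase N × ℝ =>
        (Metric.ball ((i : ℝ) / N) (1 / (2 * N))).indicator (fun _ => blockAvg l (q y.1) i) y.2) =
        (Prod.snd ⁻¹' Metric.ball ((i : ℝ) / N) (1 / (2 * N))).indicator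
          fun y => blockAvg l (q y.1) i := by
      ext y
      by_cases hx : y.2 ∈ Metric.ball ((i : ℝ) / N) (1 / (2 * N))
      · rw [indicator_of_mem hx, indicator_of_mem (by exact hx)]
      · rw [indicator_of_notMem hx, indicator_of_notMem (by exact hx)]
    rw [h2]
    exact (h1.measurable.comp measurable_fst).indicator
      (measurable_snd Metric.isOpen_ball.measurableSet)
  exact (hb _ IsChain.continuous_site_fst).prodMk (hb _ IsChain.continuous_site_snd)

end Blocks

lemma IsChain.integrable_uhat {Ω : Type*} [mΩ : MeasurableSpace Ω] {μ : Measure Ω}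
    [IsProbabilityMeasure μ] {V : ℝ → ℝ} {c₁ c₂ β σ : ℝ} {τbar : ℝ → ℝ} {N : ℕ}
    {X : ℝ≥0 → Ω → Phase N} (h : IsChain μ V β σ τbar N X) (hV : Admissible V c₁ c₂ β)
    (hN : 1 ≤ N) (hτ : Continuous τbar)
    (h0 : Integrable (fun ω => energy V N (X 0 ω)) μ) (l : ℕ) {f : ℝ × ℝ → ℝ}
    (hf : Continuous f) {K : ℝ} (hfK : ∀ y, |f y| ≤ K * (1 + y.1 ^ 2 + y.2 ^ 2)) (T : ℝ) :
    Integrable (fun y : ℝ × Ω × ℝ => f (uhat l (X y.1.toNNReal y.2.1) y.2.2))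
      (fieldMeasure μ T) := by
  obtain ⟨C, hC⟩ := hV.exists_dominatesSq
  obtain ⟨A, hA, hu⟩ := exists_uhat_sq_le hC N l
  have hK : 0 ≤ K := by
    have := (abs_nonneg _).trans (hfK 0)
    simpa using this
  have hL := (h.integrable_pathMeasure_lyapunov hV hC hN hτ
    (integrable_lyapunov_of_energy (C := C) hN h0) T).const_mul (K * (1 + A + A))
  have hL2 : Integrable (fun y : ℝ × Ω × ℝ =>
      K * (1 + A + A) * lyapunov V C N (X y.1.toNNReal y.2.1)) (fieldMeasure μ T) := by
    have h1 : Integrable (fun y : (ℝ × Ω) × ℝ =>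
        K * (1 + A + A) * lyapunov V C N (X y.1.1.toNNReal y.1.2))
        ((pathMeasure μ T).prod (volume.restrict (Ioc (0 : ℝ) 1))) := hL.comp_fst _
    exact ((measurePreserving_prodAssoc (volume.restrict (Ioc 0 T)) μ
      (volume.restrict (Ioc (0 : ℝ) 1))).symm _).integrable_comp_of_integrable h1
  have hs : Measurable fun y : ℝ × Ω × ℝ => (X y.1.toNNReal y.2.1, y.2.2) :=
    (h.measurable_uncurry.comp (measurable_fst.prodMk (measurable_fst.comp measurable_snd))).prodMk
      (measurable_snd.comp measurable_snd)
  refine hL2.mono' (hf.measurable.comp ((measurable_uhat N l).comp hs)).aestronglyMeasurable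
    (ae_of_all _ fun y => (hfK _).trans ?_)
  rw [mul_assoc]
  refine mul_le_mul_of_nonneg_left ?_ hK
  have h1 := hu (X y.1.toNNReal y.2.1) y.2.2
  have h2 := one_le_lyapunov hC (X y.1.toNNReal y.2.1)
  linarith [h1.1, h1.2]

/-- The density of energy of the macroscopic profiles. -/
noncomputable def energyDensity (V : ℝ → ℝ) (β : ℝ) (y : ℝ × ℝ) : ℝ :=
  y.2 ^ 2 / 2 + internalEnergy V β (tension V β y.1)

namespace Admissible

variable {V : ℝ → ℝ} {c₁ c₂ β : ℝ}

lemma continuous_energyDensity (hV : Admissible V c₁ c₂ β) : Continuous (energyDensity V β) := by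
  have h1 : Continuous fun y : ℝ × ℝ => internalEnergy V β (tension V β y.1) :=
    hV.continuous_internalEnergy.comp (hV.continuous_tension.comp continuous_fst)
  exact ((continuous_snd.pow 2).div_const 2).add h1

lemma exists_abs_energyDensity_le (hV : Admissible V c₁ c₂ β) :
    ∃ K, ∀ y, |energyDensity V β y| ≤ K * (1 + y.1 ^ 2 + y.2 ^ 2) := by
  obtain ⟨K, hK, h⟩ := hV.exists_internalEnergy_tension_le
  refine ⟨K + 1, fun y => (abs_add_le _ _).trans ?_⟩
  rw [abs_of_nonneg (by positivity : 0 ≤ y.2 ^ 2 / 2)]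
  have h1 := mul_nonneg hK (sq_nonneg y.2)
  nlinarith [h y.1, sq_nonneg y.1, sq_nonneg y.2]

end Admissible

/-- Truncation of a real number. -/
noncomputable def clamp (M y : ℝ) : ℝ := max (-M) (min M y)

lemma continuous_clamp (M : ℝ) : Continuous (clamp M) := by
  unfold clamp; fun_prop

lemma abs_clamp_le {M : ℝ} (hM : 0 ≤ M) (y : ℝ) : |clamp M y| ≤ M :=
  abs_le.2 ⟨le_max_left _ _, max_le (by linarith) (min_le_left _ _)⟩

lemma abs_sub_clamp_le {M : ℝ} (hM : 0 ≤ M) (y : ℝ) : |y - clamp M y| ≤ max (|y| - M) 0 := by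
  unfold clamp
  rcases le_total M y with h1 | h1
  · rw [min_eq_left h1, max_eq_right (by linarith), abs_of_nonneg (by linarith)]
    exact (sub_le_sub_right (le_abs_self y) _).trans (le_max_left _ _)
  · rw [min_eq_right h1]
    rcases le_total (-M) y with h2 | h2
    · rw [max_eq_right h2, sub_self, abs_zero]
      exact le_max_right _ _
    · rw [max_eq_left h2, abs_of_nonpos (by linarith)]
      refine le_trans ?_ (le_max_left _ _)
      linarith [neg_abs_le y]

lemma integrable_tail {Ω : Type*} [MeasurableSpace Ω] {Q : Measure Ω} [IsProbabilityMeasure Q]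
    {W : Ω → ℝ} (hW : Integrable W Q) (M : ℝ) : Integrable (fun ω => max (|W ω| - M) 0) Q :=
  (hW.abs.sub (integrable_const M)).sup (integrable_const 0)

lemma abs_integral_sub_integral_clamp_le {Ω : Type*} [MeasurableSpace Ω] {Q : Measure Ω}
    [IsProbabilityMeasure Q] {W : Ω → ℝ} (hW : Integrable W Q) {M : ℝ} (hM : 0 ≤ M) :
    |(∫ ω, W ω ∂Q) - ∫ ω, clamp M (W ω) ∂Q| ≤ ∫ ω, max (|W ω| - M) 0 ∂Q := by
  have hc : Integrable (fun ω => clamp M (W ω)) Q :=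
    Integrable.of_bound ((continuous_clamp M).comp_aestronglyMeasurable hW.aestronglyMeasurable) M
      (ae_of_all _ fun ω => abs_clamp_le hM _)
  rw [← integral_sub hW hc]
  exact (abs_integral_le_integral_abs).trans (integral_mono (hW.sub hc).abs
    (integrable_tail hW M) fun ω => abs_sub_clamp_le hM _)

lemma tendsto_integral_tail {Ω : Type*} [MeasurableSpace Ω] {Q : Measure Ω}
    [IsProbabilityMeasure Q] {W : Ω → ℝ} (hW : Integrable W Q) :
    Tendsto (fun M => ∫ ω, max (|W ω| - M) 0 ∂Q) atTop (𝓝 0) := by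
  have := tendsto_integral_filter_of_dominated_convergence (μ := Q) (l := atTop)
    (F := fun (M : ℝ) ω => max (|W ω| - M) 0) (f := fun _ => 0) (fun ω => |W ω|)
    (Eventually.of_forall fun M => (integrable_tail hW M).aestronglyMeasurable)
    (by
      filter_upwards [eventually_ge_atTop 0] with M hM
      refine ae_of_all _ fun ω => ?_
      rw [Real.norm_eq_abs, abs_of_nonneg (le_max_right _ _)]
      exact max_le (by linarith) (abs_nonneg _))
    hW.abs
    (ae_of_all _ fun ω => tendsto_const_nhds.congr' (by
      filter_upwards [eventually_ge_atTop |W ω|] with M hM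
      rw [max_eq_right (by linarith)]))
  simpa using this

/-- Convergence in law and uniform integrability give convergence of the expectations. -/
lemma tendsto_expectation_of_law {Ω : ℕ → Type*} [∀ k, MeasurableSpace (Ω k)]
    {P : ∀ k, Measure (Ω k)} [∀ k, IsProbabilityMeasure (P k)]
    {Ω' : Type*} [MeasurableSpace Ω'] {P' : Measure Ω'} [IsProbabilityMeasure P']
    {Y : ∀ k, Ω k → ℝ} {Z : Ω' → ℝ} (h : TendstoInDistribution Y atTop Z P P')
    (hY : ∀ᶠ k in atTop, Integrable (Y k) (P k)) (hZ : Integrable Z P')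
    (htail : ∀ ε > 0, ∃ M : ℝ, ∀ᶠ k in atTop, ∫ ω, max (|Y k ω| - M) 0 ∂(P k) ≤ ε) :
    Tendsto (fun k => ∫ ω, Y k ω ∂(P k)) atTop (𝓝 (∫ ω, Z ω ∂P')) := by
  -- Clamps are bounded and continuous, so convergence in law applies; removing them costs the mean
  -- excess of the modulus over `M`.
  have hclamp : ∀ M, 0 ≤ M → Tendsto (fun k => ∫ ω, clamp M (Y k ω) ∂(P k)) atTop
      (𝓝 (∫ ω, clamp M (Z ω) ∂P')) := fun M hM => by
    have h1 := (ProbabilityMeasure.tendsto_iff_forall_integral_tendsto.1 h.tendsto)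
      (BoundedContinuousFunction.ofNormedAddCommGroup (clamp M) (continuous_clamp M) M
        (abs_clamp_le hM))
    simp only [ProbabilityMeasure.coe_mk,
      BoundedContinuousFunction.coe_ofNormedAddCommGroup] at h1
    rw [integral_map h.aemeasurable_limit (continuous_clamp M).aestronglyMeasurable] at h1
    refine h1.congr fun k => ?_
    rw [integral_map (h.forall_aemeasurable k) (continuous_clamp M).aestronglyMeasurable]
  rw [Metric.tendsto_nhds]
  intro ε hε
  obtain ⟨M₁, hM₁⟩ := htail (ε / 4) (by linarith)
  -- One level serves the limit and the sequence: the mean excess decreases in `M`, so any level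
  -- above `M₁` keeps the tail bound.
  obtain ⟨M, hMZ, hM1, hM0⟩ := (((tendsto_integral_tail hZ).eventually
    (ge_mem_nhds (by linarith : 0 < ε / 4))).and
      ((eventually_ge_atTop M₁).and (eventually_ge_atTop 0))).exists
  filter_upwards [hM₁, hY, Metric.tendsto_nhds.1 (hclamp M hM0) (ε / 4) (by linarith)]
    with k h1 h2 h3
  rw [Real.dist_eq] at h3 ⊢
  have h4 := abs_integral_sub_integral_clamp_le h2 hM0
  have h5 := abs_integral_sub_integral_clamp_le hZ hM0
  have h6 : ∫ ω, max (|Y k ω| - M) 0 ∂(P k) ≤ ∫ ω, max (|Y k ω| - M₁) 0 ∂(P k) :=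
    integral_mono (integrable_tail h2 M) (integrable_tail h2 M₁) fun ω =>
      max_le_max_right _ (by linarith)
  rw [abs_lt] at h3 ⊢
  rw [abs_le] at h4 h5
  constructor <;> linarith [h3.1, h3.2, h4.1, h4.2, h5.1, h5.2]


/-- Cauchy–Schwarz and the domination of `r²` by the potential. The constant is independent of `N`,
which makes the lengths uniformly integrable when the mean energies are bounded. -/
lemma meanLength_sq_le {V : ℝ → ℝ} {C : ℝ} {N : ℕ} (hC : DominatesSq V C) (hN : 1 ≤ N)
    (z : Phase N) : meanLength N z ^ 2 ≤ C * (energy V N z + C) := by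
  have hN0 : (0 : ℝ) < N := by positivity
  have h1 := sq_sum_le_card_mul_sum_sq (s := Finset.Icc 1 N) (f := fun i => site z.1 i)
  rw [Nat.card_Icc, Nat.add_sub_cancel] at h1
  have h2 : ∑ i ∈ Finset.Icc 1 N, site z.1 i ^ 2 ≤
      ∑ i ∈ Finset.Icc 1 N, C * ((site z.2 i ^ 2 / 2 + V (site z.1 i)) + C) :=
    Finset.sum_le_sum fun i _ => by
      have := mul_nonneg hC.1 (sq_nonneg (site z.2 i))
      have := hC.2 (site z.1 i)
      linarith
  rw [← Finset.mul_sum, Finset.sum_add_distrib, Finset.sum_const, Nat.card_Icc,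
    Nat.add_sub_cancel, nsmul_eq_mul] at h2
  have h3 := h1.trans (mul_le_mul_of_nonneg_left h2 hN0.le)
  rw [meanLength, energy, mul_pow, div_pow, one_pow, ← sub_nonneg]
  rw [← sub_nonneg] at h3
  have h4 : ∀ S E : ℝ, C * (1 / N * E + C) - 1 / (N : ℝ) ^ 2 * S =
      (N * (C * (E + N * C)) - S) / (N : ℝ) ^ 2 := fun S E => by field_simp
  rw [h4]
  positivity

/-- The empirical measure of the lengths, tested against a function of time. -/
lemma empirical_time {N : ℕ} (x : ℝ≥0 → Phase N) (χ : ℝ → ℝ) :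
    empirical N x (fun y => χ y.1 * spaceCutoff y.2) 0 =
      ∫ t in Ioi (0 : ℝ), χ t * meanLength N (x t.toNNReal) := by
  unfold empirical meanLength
  refine integral_congr_ae (ae_of_all _ fun t => ?_)
  simp only [Pi.zero_apply, zero_mul, add_zero]
  rw [mul_left_comm (χ t), Finset.mul_sum _ _ (χ t)]
  congr 1
  refine Finset.sum_congr rfl fun i hi => ?_
  rw [Finset.mem_Icc] at hi
  have hN0 : (0 : ℝ) < N := by exact_mod_cast (by omega : 0 < N)
  rw [spaceCutoff_eq_one, mul_one]
  exact ⟨by positivity, (div_le_one hN0).2 (by exact_mod_cast hi.2)⟩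

lemma continuous_meanLength (N : ℕ) : Continuous (meanLength N) := by
  unfold meanLength
  exact continuous_const.mul
    (continuous_finsetSum _ fun i _ => IsChain.continuous_site_fst i)

lemma Admissible.continuous_energy {V : ℝ → ℝ} {c₁ c₂ β : ℝ} (hV : Admissible V c₁ c₂ β)
    (N : ℕ) : Continuous (energy V N) :=
  (continuous_const.mul (contDiff_hamiltonian hV).continuous).congr fun z => (energy_eq V z).symm

namespace IsChain

variable {Ω : Type*} [mΩ : MeasurableSpace Ω] {μ : Measure Ω} [IsProbabilityMeasure μ]
  {V : ℝ → ℝ} {c₁ c₂ β σ : ℝ} {τbar : ℝ → ℝ} {N : ℕ} {X : ℝ≥0 → Ω → Phase N}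

lemma integrable_energy (h : IsChain μ V β σ τbar N X) (hV : Admissible V c₁ c₂ β)
    (hN : 1 ≤ N) (hτ : Continuous τbar) (h0 : Integrable (fun ω => energy V N (X 0 ω)) μ) :
    (∀ t, Integrable (fun ω => energy V N (X t ω)) μ) ∧
      ∀ T, Integrable (fun y : ℝ × Ω => energy V N (X y.1.toNNReal y.2)) (pathMeasure μ T) := by
  obtain ⟨C, hC⟩ := hV.exists_dominatesSq
  refine h.integrable_of_abs_le_lyapunov (A := N * C + 2) hV hC hN hτ h0 (hV.continuous_energy N)
    fun z => ?_
  have h1 := one_le_lyapunov hC z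
  have h2 := lyapunov_eq_energy (V := V) (C := C) hN z
  have h3 : (1 : ℝ) ≤ N := by exact_mod_cast hN
  have h4 := mul_nonneg (zero_le_one.trans h3) hC.1
  have h5 : |energy V N z| ≤ |N * energy V N z| := by
    rw [abs_mul, Nat.abs_cast]
    exact le_mul_of_one_le_left (abs_nonneg _) h3
  refine h5.trans ?_
  rw [show N * energy V N z = lyapunov V C N z - (N * C + 1) by linarith, abs_le]
  constructor <;> nlinarith

lemma integrable_meanLength (h : IsChain μ V β σ τbar N X) (hV : Admissible V c₁ c₂ β)
    (hN : 1 ≤ N) (hτ : Continuous τbar) (h0 : Integrable (fun ω => energy V N (X 0 ω)) μ) :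
    (∀ t, Integrable (fun ω => meanLength N (X t ω)) μ) ∧
      ∀ T, Integrable (fun y : ℝ × Ω => meanLength N (X y.1.toNNReal y.2)) (pathMeasure μ T) := by
  obtain ⟨C, hC⟩ := hV.exists_dominatesSq
  obtain ⟨A, -, hA⟩ := exists_abs_meanLength_le (V := V) hC hN
  exact h.integrable_of_abs_le_lyapunov hV hC hN hτ h0 (continuous_meanLength N) fun z => (hA z).2

/-- Time averages of the length are controlled by those of the energy. -/
lemma integral_tail_length_le (h : IsChain μ V β σ τbar N X) (hV : Admissible V c₁ c₂ β)
    (hN : 1 ≤ N) (hτ : Continuous τbar) (h0 : Integrable (fun ω => energy V N (X 0 ω)) μ)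
    {C : ℝ} (hC : DominatesSq V C) {χ : ℝ → ℝ} (hχ : Continuous χ) (hχc : HasCompactSupport χ)
    {m : ℝ} (hm : 0 < m) :
    ∫ ω, max (|∫ t in Ioi (0 : ℝ), χ t * meanLength N (X t.toNNReal ω)| -
        m * ∫ t in Ioi (0 : ℝ), |χ t|) 0 ∂μ ≤
      C * ((∫ t in Ioi (0 : ℝ), |χ t| * ∫ ω, energy V N (X t.toNNReal ω) ∂μ) +
        C * ∫ t in Ioi (0 : ℝ), |χ t|) / (4 * m) := by
  obtain ⟨T, hT, hχT⟩ := exists_time_horizon hχc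
  have hE := h.integrable_energy hV hN hτ h0
  have hM := h.integrable_meanLength hV hN hτ h0
  have hχa : HasCompactSupport fun t => |χ t| := hχc.norm
  have hG : ∀ T, Integrable (fun y : ℝ × Ω => C * (energy V N (X y.1.toNNReal y.2) + C))
      (pathMeasure μ T) := fun T => ((hE.2 T).add (integrable_const C)).const_mul C
  have hS := expectation_weak hχ.abs hχa hG
  have hY := expectation_weak hχ hχc hM.2
  have e : ∀ g : ℝ → ℝ, ∫ t in Ioi (0 : ℝ), |χ t| * g t = ∫ t in (0 : ℝ)..T, |χ t| * g t :=
    fun g => setIntegral_Ioi_eq_intervalIntegral hT.le fun t ht => by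
      rw [hχT t ht, abs_zero, zero_mul]
  have e' : ∀ g : ℝ → ℝ, ∫ t in Ioi (0 : ℝ), χ t * g t = ∫ t in (0 : ℝ)..T, χ t * g t :=
    fun g => setIntegral_Ioi_eq_intervalIntegral hT.le fun t ht => by
      rw [hχT t ht, zero_mul]
  have e1 : ∫ t in Ioi (0 : ℝ), |χ t| = ∫ t in (0 : ℝ)..T, |χ t| := by
    simpa using e fun _ => 1
  have hIE : IntervalIntegrable (fun t => |χ t| * ∫ ω, energy V N (X t.toNNReal ω) ∂μ)
      volume 0 T :=
    (intervalIntegrable_expectation hT.le (hE.2 T)).continuousOn_mul hχ.abs.continuousOn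
  have hES : ∫ t in Ioi (0 : ℝ), |χ t| * ∫ ω, C * (energy V N (X t.toNNReal ω) + C) ∂μ =
      C * ((∫ t in Ioi (0 : ℝ), |χ t| * ∫ ω, energy V N (X t.toNNReal ω) ∂μ) +
        C * ∫ t in Ioi (0 : ℝ), |χ t|) := by
    rw [e, e, e1, ← intervalIntegral.integral_const_mul, ← intervalIntegral.integral_add hIE
      ((hχ.abs.intervalIntegrable _ _).const_mul C), ← intervalIntegral.integral_const_mul]
    refine intervalIntegral.integral_congr fun t _ => ?_
    rw [integral_const_mul, integral_add (hE.1 _) (integrable_const C), integral_const]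
    simp only [probReal_univ, one_smul]
    ring
  rw [← hES, ← hS.2, ← integral_div]
  refine integral_mono (integrable_tail hY.1 _) (hS.1.div_const _) fun ω => ?_
  have hx : Continuous fun t : ℝ => X t.toNNReal ω :=
    (h.continuous_paths ω).comp continuous_real_toNNReal
  have hxm := (continuous_meanLength N).comp hx
  have hxe := (hV.continuous_energy N).comp hx
  have hsq : ∀ t : ℝ, meanLength N (X t.toNNReal ω) ^ 2 ≤
      C * (energy V N (X t.toNNReal ω) + C) := fun t => meanLength_sq_le hC hN _
  simp only
  rw [e', e, e1]
  refine max_le ?_ (div_nonneg ?_ (by linarith))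
  · rw [sub_le_iff_le_add]
    refine (intervalIntegral.abs_integral_le_integral_abs hT.le).trans ?_
    rw [← intervalIntegral.integral_div, ← intervalIntegral.integral_const_mul,
      ← intervalIntegral.integral_add]
    · refine intervalIntegral.integral_mono_on hT.le ?_ ?_ fun t _ => ?_
      · exact (hχ.mul hxm).abs.intervalIntegrable _ _
      · exact Continuous.intervalIntegrable (((hχ.abs.mul
          (continuous_const.mul (hxe.add continuous_const))).div_const _).add
            (continuous_const.mul hχ.abs)) _ _
      · rw [abs_mul, mul_div_assoc, mul_comm m, ← mul_add]
        refine mul_le_mul_of_nonneg_left ?_ (abs_nonneg _)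
        have h1 : meanLength N (X t.toNNReal ω) ^ 2 / (4 * m) ≤
            C * (energy V N (X t.toNNReal ω) + C) / (4 * m) :=
          div_le_div_of_nonneg_right (hsq t) (by linarith)
        -- Young's inequality `a ≤ a² / (4 m) + m`: the excess over `m` is paid by the square, hence
        -- by the energy.
        refine le_trans ?_ (add_le_add_left h1 m)
        rw [← sq_abs, ← sub_nonneg, show ∀ a : ℝ, a ^ 2 / (4 * m) + m - a =
          (a - 2 * m) ^ 2 / (4 * m) from fun a => by field_simp; ring]
        positivity
    · exact Continuous.intervalIntegrable ((hχ.abs.mul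
        (continuous_const.mul (hxe.add continuous_const))).div_const _) _ _
    · exact (continuous_const.mul hχ.abs).intervalIntegrable _ _
  · exact intervalIntegral.integral_nonneg hT.le fun t _ =>
      mul_nonneg (abs_nonneg _) ((sq_nonneg _).trans (hsq t))

end IsChain

/-! ### Weak convergence of the mean energy and of the mean length. -/

section Limits

variable {Ω : ℕ → Type*} [∀ N, MeasurableSpace (Ω N)]
  {P : ∀ N, Measure (Ω N)} [∀ N, IsProbabilityMeasure (P N)]
  {X : ∀ N, ℝ≥0 → Ω N → Phase N} {φ : ℕ → ℕ}
  {Ω' : Type*} [MeasurableSpace Ω'] {P' : Measure Ω'} [IsProbabilityMeasure P']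
  {r p : Ω' → ℝ → ℝ → ℝ} {V : ℝ → ℝ} {c₁ c₂ β τ₀ : ℝ} {σ : ℕ → ℝ} {τbar : ℝ → ℝ} {l : ℕ → ℕ}

lemma IsLimitProfile.eventually_one_le (hlim : IsLimitProfile P X φ P' r p) :
    ∀ᶠ k in atTop, 1 ≤ φ k := hlim.strictMono.tendsto_atTop.eventually_ge_atTop 1

/-- The macroscopic energy is integrable. -/
lemma IsLimitProfile.integrable_energyDensity (hlim : IsLimitProfile P X φ P' r p)
    (hV : Admissible V c₁ c₂ β) (T : ℝ) :
    Integrable (fun y : ℝ × Ω' => ∫ x in (0 : ℝ)..1,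
      energyDensity V β (r y.2 y.1 x, p y.2 y.1 x)) (pathMeasure P' T) := by
  obtain ⟨K, hK⟩ := hV.exists_abs_energyDensity_le
  exact integrable_integral_space (hlim.integrable_field T hV.continuous_energyDensity hK)

lemma IsLimitProfile.integrable_totalLength (hlim : IsLimitProfile P X φ P' r p) (T : ℝ) :
    Integrable (fun y : ℝ × Ω' => totalLength (r y.2) y.1) (pathMeasure P' T) :=
  integrable_integral_space (hlim.integrable_field T continuous_fst (C := 1) fun y => by
    rw [abs_le]
    constructor <;> nlinarith [sq_nonneg (y.1 - 1), sq_nonneg (y.1 + 1), sq_nonneg y.2])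

/-- Weak convergence of the mean energy. -/
theorem tendsto_weak_energy (hV : Admissible V c₁ c₂ β) (hτ : Continuous τbar)
    (hX : ∀ N, IsChain (P N) V β (σ N) τbar N (X N)) (hlim : IsLimitProfile P X φ P' r p)
    (henergy : EnergyConvergence P V β τ₀ l X φ P' r p) {ψ : ℝ → ℝ} (hψ : Continuous ψ)
    (hψc : HasCompactSupport ψ) :
    Tendsto (fun k => ∫ t in Ioi (0 : ℝ), ψ t *
        ∫ ω, energy V (φ k) (X (φ k) t.toNNReal ω) ∂(P (φ k))) atTop
      (𝓝 (∫ t in Ioi (0 : ℝ), ψ t * ∫ ω, (∫ x in (0 : ℝ)..1,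
        energyDensity V β (r ω t x, p ω t x)) ∂P')) := by
  obtain ⟨K, hK⟩ := hV.exists_abs_energyDensity_le
  have hc := hV.continuous_energyDensity
  obtain ⟨C, hC⟩ := hV.exists_dominatesSq
  have h1 := henergy.tendsto_energy ψ hψ hψc
  have h2 := henergy.tendsto_quadratic _ (continuous_mul_spaceCutoff hψ)
    (hasCompactSupport_mul_spaceCutoff hψc) _ hc ⟨K, hK⟩
  rw [integral_weak_field (F := fun y => energyDensity V β (r y.2.1 y.1 y.2.2, p y.2.1 y.1 y.2.2))
    hψ hψc (fun x hx => spaceCutoff_eq_one hx) fun T => hlim.integrable_field T hc hK] at h2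
  -- The microscopic energy is its deviation from the energy of the block profiles, which tends to
  -- `0` in mean, plus that energy, whose mean converges by its quadratic growth.
  have h3 := h1.add h2
  rw [zero_add] at h3
  refine h3.congr' ?_
  filter_upwards [hlim.eventually_one_le] with k hk
  have hu := fun T => (hX (φ k)).integrable_uhat hV hk hτ (henergy.integrable_initial _)
    (l (φ k)) hc hK T
  rw [integral_weak_field
    (F := fun y => energyDensity V β (uhat (l (φ k)) (X (φ k) y.1.toNNReal y.2.1) y.2.2))
    hψ hψc (fun x hx => spaceCutoff_eq_one hx) hu]
  have hE := ((hX (φ k)).integrable_energy hV hk hτ (henergy.integrable_initial _)).2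
  have hU := fun T => integrable_integral_space (hu T)
  have hD := fun T => (hE T).sub (hU T)
  have e1 := (expectation_weak hψ hψc hE)
  have e2 := (expectation_weak hψ hψc hU)
  have e3 := (expectation_weak hψ hψc hD)
  obtain ⟨T, hT, hψT⟩ := exists_time_horizon hψc
  have e : ∀ g : ℝ → ℝ, ∫ t in Ioi (0 : ℝ), ψ t * g t = ∫ t in (0 : ℝ)..T, ψ t * g t := fun g =>
    setIntegral_Ioi_eq_intervalIntegral hT.le fun t ht => by rw [hψT t ht, zero_mul]
  have i1 := (intervalIntegrable_expectation hT.le (hD T)).continuousOn_mul hψ.continuousOn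
  have i2 := (intervalIntegrable_expectation hT.le (hU T)).continuousOn_mul hψ.continuousOn
  rw [e, e, e]
  refine (intervalIntegral.integral_add i1 i2).symm.trans ?_
  -- Fubini gives integrability of the block energy at almost every time, which suffices to split
  -- the expectation.
  have hae : ∀ᵐ t ∂(volume.restrict (Ioc 0 T)),
      Integrable (fun ω => energy V (φ k) (X (φ k) t.toNNReal ω)) (P (φ k)) ∧
      Integrable (fun ω => ∫ x in (0 : ℝ)..1,
        energyDensity V β (uhat (l (φ k)) (X (φ k) t.toNNReal ω) x)) (P (φ k)) :=
    (hE T).prod_right_ae.and (hU T).prod_right_ae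
  refine intervalIntegral.integral_congr_ae ?_
  rw [uIoc_of_le hT.le, ← ae_restrict_iff' measurableSet_Ioc]
  filter_upwards [hae] with t ht
  simp only [Pi.sub_apply]
  rw [integral_sub ht.1 ht.2]
  ring

/-- Weak convergence of the mean length. -/
theorem tendsto_weak_length (hV : Admissible V c₁ c₂ β) (hτ : Continuous τbar)
    (hX : ∀ N, IsChain (P N) V β (σ N) τbar N (X N)) (hlim : IsLimitProfile P X φ P' r p)
    (henergy : EnergyConvergence P V β τ₀ l X φ P' r p) {χ : ℝ → ℝ} (hχ : Continuous χ)
    (hχc : HasCompactSupport χ) :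
    Tendsto (fun k => ∫ t in Ioi (0 : ℝ), χ t *
        ∫ ω, meanLength (φ k) (X (φ k) t.toNNReal ω) ∂(P (φ k))) atTop
      (𝓝 (∫ t in Ioi (0 : ℝ), χ t * ∫ ω, totalLength (r ω) t ∂P')) := by
  obtain ⟨C, hC⟩ := hV.exists_dominatesSq
  have hlaw := hlim.tendsto_law _ 0 (continuous_mul_spaceCutoff hχ)
    (hasCompactSupport_mul_spaceCutoff hχc) continuous_zero HasCompactSupport.zero
  have eZ : ∀ ω, ∫ t in Ioi (0 : ℝ), ∫ x in (0 : ℝ)..1,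
      (χ t * spaceCutoff x * r ω t x + (0 : ℝ × ℝ → ℝ) (t, x) * p ω t x) =
        ∫ t in Ioi (0 : ℝ), χ t * totalLength (r ω) t := fun ω => by
    refine integral_congr_ae (ae_of_all _ fun t => ?_)
    simp only [totalLength]
    rw [← intervalIntegral.integral_const_mul]
    refine intervalIntegral.integral_congr fun x hx => ?_
    rw [uIcc_of_le zero_le_one] at hx
    simp [spaceCutoff_eq_one hx]
  simp only [empirical_time, eZ] at hlaw
  have hm := fun k (hk : 1 ≤ φ k) =>
    ((hX (φ k)).integrable_meanLength hV hk hτ (henergy.integrable_initial _)).2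
  have hZ := expectation_weak hχ hχc hlim.integrable_totalLength
  rw [← hZ.2]
  refine (tendsto_expectation_of_law hlaw ?_ hZ.1 ?_).congr' ?_
  · filter_upwards [hlim.eventually_one_le] with k hk
    exact (expectation_weak hχ hχc (hm k hk)).1
  · intro ε hε
    -- Uniform integrability: the mean energies tested against `|χ|` converge, hence are eventually
    -- bounded by some `B`. At the level `m = D / (4 ε)`, with `D` above `C (B + C a)`, the tail is
    -- at most `ε`.
    have hea := tendsto_weak_energy hV hτ hX hlim henergy hχ.abs (hχc.norm :)
    obtain ⟨B, hB⟩ : ∃ B, ∀ᶠ k in atTop, ∫ t in Ioi (0 : ℝ), |χ t| *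
        ∫ ω, energy V (φ k) (X (φ k) t.toNNReal ω) ∂(P (φ k)) ≤ B :=
      ⟨_, hea.eventually (ge_mem_nhds (lt_add_one _))⟩
    set a : ℝ := ∫ t in Ioi (0 : ℝ), |χ t| with ha
    set D : ℝ := |C * (B + C * a)| + 1 with hD
    have hD0 : 0 < D := by positivity
    have hm0 : 0 < D / (4 * ε) := by positivity
    refine ⟨D / (4 * ε) * a, ?_⟩
    filter_upwards [hB, hlim.eventually_one_le] with k h1 h2
    refine ((hX (φ k)).integral_tail_length_le hV h2 hτ (henergy.integrable_initial _) hC hχ hχc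
      hm0).trans ?_
    rw [show 4 * (D / (4 * ε)) = D / ε by field_simp, div_le_iff₀ (by positivity),
      mul_div_cancel₀ _ hε.ne', ← ha]
    have := mul_le_mul_of_nonneg_left (add_le_add_left h1 (C * a)) hC.1
    linarith [le_abs_self (C * (B + C * a))]
  · filter_upwards [hlim.eventually_one_le] with k hk
    exact (expectation_weak hχ hχc (hm k hk)).2

end Limits


/-! ### Convergence of the mean work and of the mean heat -/

lemma integral_sub_sub {α : Type*} [MeasurableSpace α] {μ : Measure α} {f g h : α → ℝ}
    (hf : Integrable f μ) (hg : Integrable g μ) (hh : Integrable h μ) :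
    ∫ a, (f a - g a - h a) ∂μ = (∫ a, f a ∂μ) - (∫ a, g a ∂μ) - ∫ a, h a ∂μ := by
  rw [← integral_sub hf hg]
  exact integral_sub (hf.sub hg) hh

lemma ae_Ioi_of_forall {Q : ℝ → Prop}
    (h : ∀ T, ∀ᵐ t ∂(volume.restrict (Ioc (0 : ℝ) T)), Q t) :
    ∀ᵐ t ∂(volume.restrict (Ioi (0 : ℝ))), Q t := by
  have : Ioi (0 : ℝ) = ⋃ n : ℕ, Ioc (0 : ℝ) n := by
    ext t
    simp only [mem_Ioi, mem_iUnion, mem_Ioc, exists_and_left, iff_self_and]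
    exact fun _ => exists_nat_ge t
  rw [this, ae_restrict_iUnion_iff]
  exact fun n => h n

lemma integrableOn_Ioi_mul {ψ g : ℝ → ℝ} (hψ : Continuous ψ) (hψc : HasCompactSupport ψ)
    (hg : ∀ T, 0 ≤ T → IntervalIntegrable g volume 0 T) :
    IntegrableOn (fun t => ψ t * g t) (Ioi 0) := by
  obtain ⟨T, hT, hψT⟩ := exists_time_horizon hψc
  have h1 := (hg T hT.le).continuousOn_mul hψ.continuousOn
  rw [intervalIntegrable_iff_integrableOn_Ioc_of_le hT.le] at h1
  refine h1.of_forall_sdiff_eq_zero measurableSet_Ioi fun t ht => ?_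
  rw [hψT t (not_lt.1 fun h => ht.2 ⟨ht.1, h.le⟩), zero_mul]

lemma StartsAtEquilibrium.totalLength_zero {V : ℝ → ℝ} {β τ₀ : ℝ} {r p : ℝ → ℝ → ℝ}
    (h : StartsAtEquilibrium V β τ₀ r p) : totalLength r 0 = tensionInv V β τ₀ := by
  rw [totalLength, intervalIntegral.integral_of_le zero_le_one, ← integral_Icc_eq_integral_Ioc,
    integral_congr_ae (h.mono fun x hx => hx.1)]
  simp

section Macro

variable {Ω : ℕ → Type*} [∀ N, MeasurableSpace (Ω N)]
  {P : ∀ N, Measure (Ω N)} [∀ N, IsProbabilityMeasure (P N)]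
  {X : ∀ N, ℝ≥0 → Ω N → Phase N} {φ : ℕ → ℕ}
  {Ω' : Type*} [MeasurableSpace Ω'] {P' : Measure Ω'} [IsProbabilityMeasure P']
  {r p : Ω' → ℝ → ℝ → ℝ} {V : ℝ → ℝ} {c₁ c₂ β τ₀ : ℝ} {σ : ℕ → ℝ} {τbar : ℝ → ℝ} {l : ℕ → ℕ}

/-- The mean of the macroscopic work. -/
lemma IsLimitProfile.expectation_macroWork (hlim : IsLimitProfile P X φ P' r p)
    (hτ : ContDiff ℝ 1 τbar) (hstart : ∀ᵐ ω ∂P', StartsAtEquilibrium V β τ₀ (r ω) (p ω))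
    (hBV : ∀ᵐ ω ∂P', HasBVLength (r ω)) :
    ∀ᵐ t ∂(volume.restrict (Ioi (0 : ℝ))), Integrable (fun ω => macroWork τbar (r ω) t) P' ∧
      ∫ ω, macroWork τbar (r ω) t ∂P' =
        stieltjesByParts τbar (fun s => ∫ ω, totalLength (r ω) s ∂P') t := by
  have h1 : ∀ᵐ t ∂(volume.restrict (Ioi (0 : ℝ))),
      Integrable (fun ω => totalLength (r ω) t) P' :=
    ae_Ioi_of_forall fun T => (hlim.integrable_totalLength T).prod_right_ae
  filter_upwards [h1, ae_restrict_mem measurableSet_Ioi] with t ht ht0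
  have ht0 : 0 ≤ t := le_of_lt ht0
  have h0 : ∀ᵐ ω ∂P', totalLength (r ω) 0 = tensionInv V β τ₀ :=
    hstart.mono fun ω hω => hω.totalLength_zero
  have i0 : Integrable (fun ω => totalLength (r ω) 0) P' :=
    (integrable_const (tensionInv V β τ₀)).congr (h0.mono fun ω hω => hω.symm)
  obtain ⟨K, hK⟩ := (isCompact_Icc (a := (0 : ℝ)) (b := t)).exists_bound_of_continuousOn
    (hτ.continuous_deriv le_rfl).continuousOn
  have hq : Integrable (fun y : ℝ × Ω' => deriv τbar y.1 * totalLength (r y.2) y.1)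
      (pathMeasure P' t) := by
    refine (hlim.integrable_totalLength t).bdd_mul (c := K)
      ((hτ.continuous_deriv le_rfl).measurable.comp measurable_fst).aestronglyMeasurable ?_
    filter_upwards [ae_pathMeasure_mem (μ := P') t] with y hy
    exact hK _ (Ioc_subset_Icc_self hy)
  have iq := integrable_intervalIntegral ht0 hq
  -- Almost surely the work is an explicit expression in the length, so its measurability and the
  -- interchange with the expectation follow from Fubini's theorem. The length at time `0` is almost
  -- surely constant.
  have eW : (fun ω => macroWork τbar (r ω) t) =ᵐ[P'] fun ω =>
      τbar t * totalLength (r ω) t - τbar 0 * totalLength (r ω) 0 -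
        ∫ s in (0 : ℝ)..t, deriv τbar s * totalLength (r ω) s :=
    hBV.mono fun ω hω => hω.macroWork_eq hτ ht0
  refine ⟨(((ht.const_mul _).sub (i0.const_mul _)).sub iq).congr eW.symm, ?_⟩
  rw [integral_congr_ae eW, integral_sub_sub (ht.const_mul _) (i0.const_mul _) iq,
    integral_const_mul, integral_const_mul,
    ← integral_pathMeasure_symm ht0 hq, integral_pathMeasure ht0 hq, stieltjesByParts]
  congr 1
  exact intervalIntegral.integral_congr fun s _ =>
    integral_const_mul (deriv τbar s) fun ω => totalLength (r ω) s

/-- The mean of the macroscopic heat. -/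
lemma IsLimitProfile.expectation_macroHeat (hlim : IsLimitProfile P X φ P' r p)
    (hV : Admissible V c₁ c₂ β)
    (hτ : ContDiff ℝ 1 τbar) (hstart : ∀ᵐ ω ∂P', StartsAtEquilibrium V β τ₀ (r ω) (p ω))
    (hBV : ∀ᵐ ω ∂P', HasBVLength (r ω)) :
    ∀ᵐ t ∂(volume.restrict (Ioi (0 : ℝ))),
      Integrable (fun ω => macroHeat V β τ₀ τbar (r ω) (p ω) t) P' ∧
      ∫ ω, macroHeat V β τ₀ τbar (r ω) (p ω) t ∂P' =
        (∫ ω, (∫ x in (0 : ℝ)..1, energyDensity V β (r ω t x, p ω t x)) ∂P') -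
          internalEnergy V β τ₀ - ∫ ω, macroWork τbar (r ω) t ∂P' := by
  obtain ⟨K, hK⟩ := hV.exists_abs_energyDensity_le
  have hf := fun T => hlim.integrable_field T hV.continuous_energyDensity hK
  have h1 : ∀ᵐ t ∂(volume.restrict (Ioi (0 : ℝ))),
      Integrable (fun ω => ∫ x in (0 : ℝ)..1, energyDensity V β (r ω t x, p ω t x)) P' :=
    ae_Ioi_of_forall fun T => (hlim.integrable_energyDensity hV T).prod_right_ae
  have h2 : ∀ᵐ t ∂(volume.restrict (Ioi (0 : ℝ))), ∀ᵐ ω ∂P',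
      IntervalIntegrable (fun x => energyDensity V β (r ω t x, p ω t x)) volume 0 1 := by
    refine ae_Ioi_of_forall fun T => ?_
    have h3 := ((measurePreserving_prodAssoc (volume.restrict (Ioc 0 T)) P'
      (volume.restrict (Ioc (0 : ℝ) 1))).integrable_comp_of_integrable (hf T)).prod_right_ae
    refine (Measure.ae_ae_of_ae_prod h3).mono fun t ht => ht.mono fun ω hω => ?_
    rw [intervalIntegrable_iff_integrableOn_Ioc_of_le zero_le_one]
    exact hω
  filter_upwards [h1, h2, hlim.expectation_macroWork hτ hstart hBV] with t ht1 ht2 ht3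
  have eQ : (fun ω => macroHeat V β τ₀ τbar (r ω) (p ω) t) =ᵐ[P'] fun ω =>
      (∫ x in (0 : ℝ)..1, energyDensity V β (r ω t x, p ω t x)) - internalEnergy V β τ₀ -
        macroWork τbar (r ω) t := by
    filter_upwards [ht2] with ω hω
    have := intervalIntegral.integral_sub hω
      (intervalIntegrable_const (c := internalEnergy V β τ₀))
    rw [intervalIntegral.integral_const, sub_zero, one_smul] at this
    rw [macroHeat, ← this]
    rfl
  refine ⟨((ht1.sub (integrable_const _)).sub ht3.1).congr eQ.symm, ?_⟩
  rw [integral_congr_ae eQ, integral_sub_sub ht1 (integrable_const _) ht3.1, integral_const, probReal_univ, one_smul]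

lemma setIntegral_weak_congr {ψ g g' : ℝ → ℝ}
    (h : ∀ᵐ t ∂(volume.restrict (Ioi (0 : ℝ))), g t = g' t) :
    ∫ t in Ioi (0 : ℝ), ψ t * g t = ∫ t in Ioi (0 : ℝ), ψ t * g' t :=
  integral_congr_ae (h.mono fun t ht => by simp only [ht])

lemma intervalIntegrable_of_pathMeasure {μ : Measure Ω'} [IsProbabilityMeasure μ]
    {G : ℝ × Ω' → ℝ} (hG : ∀ T, Integrable G (pathMeasure μ T)) :
    ∀ T, 0 ≤ T → IntervalIntegrable (fun t => ∫ ω, G (t, ω) ∂μ) volume 0 T :=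
  fun T hT => intervalIntegrable_expectation hT (hG T)

/-- Weak convergence of the mean work. -/
theorem tendsto_weak_work (hV : Admissible V c₁ c₂ β) (hτ : ContDiff ℝ 1 τbar)
    (hX : ∀ N, IsChain (P N) V β (σ N) τbar N (X N)) (hlim : IsLimitProfile P X φ P' r p)
    (henergy : EnergyConvergence P V β τ₀ l X φ P' r p)
    (hlength : Tendsto (fun k => ∫ ω, meanLength (φ k) (X (φ k) 0 ω) ∂(P (φ k))) atTop
      (𝓝 (tensionInv V β τ₀)))
    (hstart : ∀ᵐ ω ∂P', StartsAtEquilibrium V β τ₀ (r ω) (p ω))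
    (hBV : ∀ᵐ ω ∂P', HasBVLength (r ω)) {ψ : ℝ → ℝ} (hψ : Continuous ψ)
    (hψc : HasCompactSupport ψ) :
    Tendsto (fun k => ∫ t in Ioi (0 : ℝ), ψ t *
        ∫ ω, microWork τbar (φ k) (fun s => X (φ k) s ω) t ∂(P (φ k))) atTop
      (𝓝 (∫ t in Ioi (0 : ℝ), ψ t * ∫ ω, macroWork τbar (r ω) t ∂P')) := by
  rw [setIntegral_weak_congr ((hlim.expectation_macroWork hτ hstart hBV).mono fun t ht => ht.2)]
  refine (tendsto_weak_stieltjesByParts hτ hψ hψc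
    (m := fun k s => ∫ ω, meanLength (φ k) (X (φ k) s.toNNReal ω) ∂(P (φ k))) ?_
    (intervalIntegrable_of_pathMeasure hlim.integrable_totalLength) ?_ fun χ hχ hχc =>
      tendsto_weak_length hV hτ.continuous hX hlim henergy hχ hχc).congr' ?_
  · filter_upwards [hlim.eventually_one_le] with k hk
    exact intervalIntegrable_of_pathMeasure ((hX (φ k)).integrable_meanLength hV hk hτ.continuous
      (henergy.integrable_initial _)).2
  · rw [integral_congr_ae (hstart.mono fun ω hω => hω.totalLength_zero)]
    simpa using hlength
  · filter_upwards [hlim.eventually_one_le] with k hk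
    refine setIntegral_weak_congr ?_
    filter_upwards [ae_restrict_mem measurableSet_Ioi] with t ht
    have := (hX (φ k)).expectation_microWork hV hk hτ (henergy.integrable_initial _) t.toNNReal
    rw [Real.coe_toNNReal _ (le_of_lt ht)] at this
    exact this.symm

/-- Weak convergence of the mean heat. -/
theorem tendsto_weak_heat (hV : Admissible V c₁ c₂ β) (hτ : ContDiff ℝ 1 τbar)
    (hX : ∀ N, IsChain (P N) V β (σ N) τbar N (X N)) (hlim : IsLimitProfile P X φ P' r p)
    (henergy : EnergyConvergence P V β τ₀ l X φ P' r p)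
    (hlength : Tendsto (fun k => ∫ ω, meanLength (φ k) (X (φ k) 0 ω) ∂(P (φ k))) atTop
      (𝓝 (tensionInv V β τ₀)))
    (hstart : ∀ᵐ ω ∂P', StartsAtEquilibrium V β τ₀ (r ω) (p ω))
    (hBV : ∀ᵐ ω ∂P', HasBVLength (r ω)) {ψ : ℝ → ℝ} (hψ : Continuous ψ)
    (hψc : HasCompactSupport ψ) :
    Tendsto (fun k => ∫ t in Ioi (0 : ℝ), ψ t *
        ∫ ω, microHeat V β (σ (φ k)) (φ k) (fun s => X (φ k) s ω) t ∂(P (φ k))) atTop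
      (𝓝 (∫ t in Ioi (0 : ℝ), ψ t * ∫ ω, macroHeat V β τ₀ τbar (r ω) (p ω) t ∂P')) := by
  have split : ∀ (e w : ℝ → ℝ) (u : ℝ), (∀ T, 0 ≤ T → IntervalIntegrable e volume 0 T) →
      (∀ T, 0 ≤ T → IntervalIntegrable w volume 0 T) →
      ∫ t in Ioi (0 : ℝ), ψ t * (e t - u - w t) = (∫ t in Ioi (0 : ℝ), ψ t * e t) -
        u * (∫ t in Ioi (0 : ℝ), ψ t) - ∫ t in Ioi (0 : ℝ), ψ t * w t := fun e w u he hw => by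
    have i1 := integrableOn_Ioi_mul hψ hψc he
    have i2 := integrableOn_Ioi_mul hψ hψc hw
    have i3 : IntegrableOn (fun t => u * ψ t) (Ioi 0) :=
      ((hψ.integrable_of_hasCompactSupport hψc).const_mul u).integrableOn
    rw [← integral_const_mul, ← integral_sub_sub i1 i3 i2]
    exact integral_congr_ae (ae_of_all _ fun t => by ring)
  have hL' := intervalIntegrable_of_pathMeasure hlim.integrable_totalLength
  have eW := (hlim.expectation_macroWork hτ hstart hBV).mono fun t ht => ht.2
  have eQ : ∀ᵐ t ∂(volume.restrict (Ioi (0 : ℝ))),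
      ∫ ω, macroHeat V β τ₀ τbar (r ω) (p ω) t ∂P' =
        (∫ ω, (∫ x in (0 : ℝ)..1, energyDensity V β (r ω t x, p ω t x)) ∂P') -
          internalEnergy V β τ₀ -
            stieltjesByParts τbar (fun s => ∫ ω, totalLength (r ω) s ∂P') t := by
    filter_upwards [hlim.expectation_macroHeat hV hτ hstart hBV, eW] with t h1 h2
    rw [h1.2, h2]
  rw [setIntegral_weak_congr eQ, split _ _ _
    (intervalIntegrable_of_pathMeasure (hlim.integrable_energyDensity hV))
    (fun T hT => intervalIntegrable_stieltjesByParts hτ (hL' T hT)), ← setIntegral_weak_congr eW]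
  -- By the balance of energy the mean heat is the mean energy minus its initial value minus the
  -- mean work. The initial energy tends to `U(β, τ₀)`, the reference value in the macroscopic heat.
  refine ((((tendsto_weak_energy hV hτ.continuous hX hlim henergy hψ hψc).sub
    (henergy.tendsto_initial.mul_const _))).sub
      (tendsto_weak_work hV hτ hX hlim henergy hlength hstart hBV hψ hψc)).congr' ?_
  filter_upwards [hlim.eventually_one_le] with k hk
  have h0 := henergy.integrable_initial (φ k)
  have eWk : ∀ᵐ t ∂(volume.restrict (Ioi (0 : ℝ))),
      ∫ ω, microWork τbar (φ k) (fun s => X (φ k) s ω) t ∂(P (φ k)) =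
        stieltjesByParts τbar
          (fun s => ∫ ω, meanLength (φ k) (X (φ k) s.toNNReal ω) ∂(P (φ k))) t := by
    filter_upwards [ae_restrict_mem measurableSet_Ioi] with t ht
    have := (hX (φ k)).expectation_microWork hV hk hτ h0 t.toNNReal
    rwa [Real.coe_toNNReal _ (le_of_lt ht)] at this
  rw [setIntegral_weak_congr eWk, ← split _ _ _
    (intervalIntegrable_of_pathMeasure ((hX (φ k)).integrable_energy hV hk hτ.continuous h0).2)
    (fun T hT => intervalIntegrable_stieltjesByParts hτ (intervalIntegrable_of_pathMeasure
      ((hX (φ k)).integrable_meanLength hV hk hτ.continuous h0).2 T hT))]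
  refine setIntegral_weak_congr ?_
  filter_upwards [eWk, ae_restrict_mem measurableSet_Ioi] with t h1 ht
  have := ((hX (φ k)).energy_balance hV hk hτ.continuous h0 t.toNNReal).2.2.2
  rw [Real.coe_toNNReal _ (le_of_lt ht), h1] at this
  linarith

end Macro


/-! ### Convergence to equilibrium for large times -/

/-- Near `ρ` continuity gives `ε`. At distance at least `δ` the quadratic growth and the constants
are absorbed by `(y - ρ)²`, at the price of `1/δ²`. Convergence in `L²` thereby controls integrals
of functions of quadratic growth. -/
lemma exists_abs_sub_le_add_sq {h : ℝ → ℝ} (hh : Continuous h) {K : ℝ}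
    (hK : ∀ y, |h y| ≤ K * (1 + y ^ 2)) (ρ : ℝ) {ε : ℝ} (hε : 0 < ε) :
    ∃ D, 0 ≤ D ∧ ∀ y, |h y - h ρ| ≤ ε + D * (y - ρ) ^ 2 := by
  obtain ⟨δ, hδ, hd⟩ := Metric.continuous_iff.1 hh ρ ε hε
  have hK0 : 0 ≤ K := by
    have := (abs_nonneg _).trans (hK 0)
    simpa using this
  set B : ℝ := K * (1 + 2 * ρ ^ 2) + |h ρ| with hB
  have hB0 : 0 ≤ B := by positivity
  refine ⟨2 * K + B / δ ^ 2, by positivity, fun y => ?_⟩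
  rcases lt_or_ge |y - ρ| δ with h1 | h1
  · have := hd y h1
    rw [Real.dist_eq] at this
    have h2 : 0 ≤ (2 * K + B / δ ^ 2) * (y - ρ) ^ 2 := by positivity
    linarith
  · have h2 : |h y - h ρ| ≤ |h y| + |h ρ| := abs_sub _ _
    have h3 : y ^ 2 ≤ 2 * (y - ρ) ^ 2 + 2 * ρ ^ 2 := by nlinarith [sq_nonneg (y - 2 * ρ)]
    have h4 := mul_le_mul_of_nonneg_left h3 hK0
    have h5 : B ≤ B / δ ^ 2 * (y - ρ) ^ 2 := by
      rw [div_mul_eq_mul_div, le_div_iff₀ (by positivity)]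
      refine mul_le_mul_of_nonneg_left ?_ hB0
      rw [← sq_abs (y - ρ)]
      exact pow_le_pow_left₀ hδ.le h1 2
    have := hK y
    rw [hB] at h5 ⊢
    linarith

section Vitali

variable {r : ℝ → ℝ → ℝ} {T ρ : ℝ}

/-- Vitali's theorem along an arbitrary sequence of times tending to infinity. The sequence is
pushed into `[T, ∞)`, where the family is uniformly integrable; this changes only finitely many
terms. -/
lemma tendsto_eLpNorm_sub_of_uniformIntegrable
    (hui : UniformIntegrable (fun t : Ici T => r t) 2 (volume.restrict (Icc (0 : ℝ) 1)))
    (hae : ∀ᵐ x ∂(volume.restrict (Icc (0 : ℝ) 1)), Tendsto (fun t => r t x) atTop (𝓝 ρ)) :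
    Tendsto (fun t => eLpNorm (fun x => r t x - ρ) 2 (volume.restrict (Icc (0 : ℝ) 1))) atTop
      (𝓝 0) := by
  refine tendsto_of_seq_tendsto fun u hu => ?_
  set s : ℕ → Ici T := fun n => ⟨max T (u n), mem_Ici.2 (le_max_left _ _)⟩ with hs
  have hsu : ∀ᶠ n in atTop, (s n : ℝ) = u n := by
    filter_upwards [hu.eventually_ge_atTop T] with n hn
    exact max_eq_right hn
  have key := tendsto_Lp_finite_of_tendsto_ae (p := 2) one_le_two ENNReal.ofNat_ne_top
    (f := fun n => r (s n)) (g := fun _ => ρ) (μ := volume.restrict (Icc (0 : ℝ) 1))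
    (fun n => hui.1 (s n)) (memLp_const ρ)
    (fun ε hε => by
      obtain ⟨δ, hδ, h⟩ := hui.2.1 hε
      exact ⟨δ, hδ, fun n => h (s n)⟩)
    (hae.mono fun x hx => (hx.comp hu).congr' (by
      filter_upwards [hsu] with n hn
      rw [hn, Function.comp_apply]))
  refine key.congr' ?_
  filter_upwards [hsu] with n hn
  rw [hn]
  rfl

lemma tendsto_integral_comp_of_uniformIntegrable
    (hui : UniformIntegrable (fun t : Ici T => r t) 2 (volume.restrict (Icc (0 : ℝ) 1)))
    (hae : ∀ᵐ x ∂(volume.restrict (Icc (0 : ℝ) 1)), Tendsto (fun t => r t x) atTop (𝓝 ρ))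
    {h : ℝ → ℝ} (hh : Continuous h) {K : ℝ} (hK : ∀ y, |h y| ≤ K * (1 + y ^ 2)) :
    (∀ t, T ≤ t → IntervalIntegrable (fun x => h (r t x)) volume 0 1) ∧
      Tendsto (fun t => ∫ x in (0 : ℝ)..1, h (r t x)) atTop (𝓝 (h ρ)) := by
  set μ : Measure ℝ := volume.restrict (Icc (0 : ℝ) 1) with hμ
  have : IsProbabilityMeasure μ := ⟨by simp [hμ]⟩
  have hmem : ∀ t, T ≤ t → MemLp (r t) 2 μ := fun t ht => hui.memLp ⟨t, ht⟩
  have hint : ∀ t, T ≤ t → Integrable (fun x => h (r t x)) μ := fun t ht =>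
    (((integrable_const 1).add (hmem t ht).integrable_sq).const_mul K).mono'
      (hh.comp_aestronglyMeasurable (hmem t ht).1) (ae_of_all _ fun x => hK _)
  have e : ∀ g : ℝ → ℝ, ∫ x in (0 : ℝ)..1, g x = ∫ x, g x ∂μ := fun g => by
    rw [intervalIntegral.integral_of_le zero_le_one, ← integral_Icc_eq_integral_Ioc]
  refine ⟨fun t ht => ?_, ?_⟩
  · rw [intervalIntegrable_iff_integrableOn_Icc_of_le zero_le_one]
    exact hint t ht
  simp_rw [e]
  have hsq : ∀ t, T ≤ t → ∫ x, (r t x - ρ) ^ 2 ∂μ =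
      (eLpNorm (fun x => r t x - ρ) 2 μ).toReal ^ 2 := fun t ht => by
    have h0 : MemLp (fun x => r t x - ρ) 2 μ := (hmem t ht).sub (memLp_const ρ)
    rw [h0.eLpNorm_eq_integral_rpow_norm two_ne_zero ENNReal.ofNat_ne_top]
    have h1 : ∀ x, ‖r t x - ρ‖ ^ (2 : ℝ≥0∞).toReal = (r t x - ρ) ^ 2 := fun x => by
      simp [Real.norm_eq_abs]
    simp_rw [h1]
    have h2 : 0 ≤ ∫ x, (r t x - ρ) ^ 2 ∂μ := integral_nonneg fun x => sq_nonneg _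
    rw [ENNReal.toReal_ofReal (by positivity), ← Real.rpow_natCast, ← Real.rpow_mul h2]
    simp
  have hlim : Tendsto (fun t => ∫ x, (r t x - ρ) ^ 2 ∂μ) atTop (𝓝 0) := by
    have h1 := ((ENNReal.tendsto_toReal ENNReal.zero_ne_top).comp
      (tendsto_eLpNorm_sub_of_uniformIntegrable hui hae)).pow 2
    simp only [ENNReal.toReal_zero, ne_eq, OfNat.ofNat_ne_zero, not_false_eq_true,
      zero_pow] at h1
    refine h1.congr' ?_
    filter_upwards [eventually_ge_atTop T] with t ht
    exact (hsq t ht).symm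
  rw [Metric.tendsto_nhds]
  intro ε hε
  obtain ⟨D, hD, hb⟩ := exists_abs_sub_le_add_sq hh hK ρ (half_pos hε)
  have h0 : Tendsto (fun t => D * ∫ x, (r t x - ρ) ^ 2 ∂μ) atTop (𝓝 0) := by
    simpa using hlim.const_mul D
  filter_upwards [h0.eventually (gt_mem_nhds (half_pos hε)), eventually_ge_atTop T] with t h1 ht
  have i1 : Integrable (fun x => (r t x - ρ) ^ 2) μ :=
    ((hmem t ht).sub (memLp_const ρ)).integrable_sq
  have h2 : (∫ x, h (r t x) ∂μ) - h ρ = ∫ x, (h (r t x) - h ρ) ∂μ := by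
    rw [integral_sub (hint t ht) (integrable_const _), integral_const, probReal_univ, one_smul]
  rw [Real.dist_eq, h2]
  refine lt_of_le_of_lt (abs_integral_le_integral_abs.trans (integral_mono
    ((hint t ht).sub (integrable_const _)).abs ((integrable_const (ε / 2)).add (i1.const_mul D))
    fun x => hb _)) ?_
  have h3 : ∫ x, ((fun _ => ε / 2) + fun x => D * (r t x - ρ) ^ 2 : ℝ → ℝ) x ∂μ =
      ε / 2 + D * ∫ x, (r t x - ρ) ^ 2 ∂μ := by
    rw [integral_add' (integrable_const _) (i1.const_mul D), integral_const, probReal_univ,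
      one_smul, integral_const_mul]
  rw [h3]
  linarith

end Vitali

/-- The first law and the Clausius inequality for one realization of the profiles. -/
theorem thermodynamic_transformation {V : ℝ → ℝ} {c₁ c₂ β τ₀ τ₁ t₁ : ℝ} {τbar : ℝ → ℝ}
    {r p : ℝ → ℝ → ℝ} (hV : Admissible V c₁ c₂ β) (hτ : ContDiff ℝ 1 τbar) (hτ₀ : τbar 0 = τ₀)
    (hτ₁ : ∀ t ≥ t₁, τbar t = τ₁) (hvisc : IsVanishingViscositySolution V β τbar r p)
    (hstart : StartsAtEquilibrium V β τ₀ r p) (hend : ReachesEquilibrium V β τ₁ r p)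
    (hBV : HasBVLength r) :
    (∀ t ≥ 0, HasRSIntegral τbar (totalLength r) 0 t (macroWork τbar r t)) ∧
      ∃ W Q : ℝ,
        Tendsto (fun t => macroWork τbar r t) atTop (𝓝 W) ∧
        Tendsto (fun t => macroHeat V β τ₀ τbar r p t) atTop (𝓝 Q) ∧
        internalEnergy V β τ₁ - internalEnergy V β τ₀ = W + Q ∧
        freeEnergy V β (tensionInv V β τ₁) - freeEnergy V β (tensionInv V β τ₀) ≤ W := by
  refine ⟨fun t ht => by rw [hBV.macroWork_eq hτ ht]; exact hBV.hasRSIntegral hτ ht, ?_⟩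
  obtain ⟨hae, T, hr, hp⟩ := hend
  set ρ₁ := tensionInv V β τ₁ with hρ₁
  have haer : ∀ᵐ x ∂(volume.restrict (Icc (0 : ℝ) 1)), Tendsto (fun t => r t x) atTop (𝓝 ρ₁) :=
    hae.mono fun x hx => by
      have := (hV.continuous_tensionInv.tendsto τ₁).comp hx.1
      refine this.congr fun t => ?_
      exact hV.tensionInv_tension _
  have haep := hae.mono fun x hx => hx.2
  -- the limits of the length and of the energy
  have hlen : Tendsto (totalLength r) atTop (𝓝 ρ₁) :=
    (tendsto_integral_comp_of_uniformIntegrable hr haer continuous_id (K := 1) fun y => by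
      rw [id, abs_le]
      constructor <;> nlinarith [sq_nonneg (y - 1), sq_nonneg (y + 1)]).2
  obtain ⟨K, -, hK⟩ := hV.exists_internalEnergy_tension_le
  obtain ⟨iU, hU⟩ := tendsto_integral_comp_of_uniformIntegrable hr haer
    (h := fun y => internalEnergy V β (tension V β y))
    (hV.continuous_internalEnergy.comp hV.continuous_tension) hK
  obtain ⟨iP, hP⟩ := tendsto_integral_comp_of_uniformIntegrable hp haep
    (h := fun y => y ^ 2 / 2) (by fun_prop) (K := 1) fun y => by
      rw [abs_of_nonneg (by positivity)]
      nlinarith [sq_nonneg y]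
  rw [hρ₁, hV.tension_tensionInv] at hU
  -- the work
  set T₀ := max t₁ 0 with hT₀
  have hT0 : 0 ≤ T₀ := le_max_right _ _
  -- The by-parts formula with the length replaced by its limit at the upper end and the integral
  -- stopped at `T₀`.
  set W : ℝ := τ₁ * ρ₁ - τ₀ * tensionInv V β τ₀ -
    ∫ s in (0 : ℝ)..T₀, deriv τbar s * totalLength r s with hW
  -- After `T₀` the tension is constant, so `τbar' = 0` and the work depends on `t` through the
  -- length only.
  have hwork : ∀ t, T₀ ≤ t → macroWork τbar r t = τ₁ * totalLength r t -
      τ₀ * tensionInv V β τ₀ - ∫ s in (0 : ℝ)..T₀, deriv τbar s * totalLength r s := fun t ht => by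
    have ht0 := hT0.trans ht
    have hi : ∀ a ∈ Icc 0 t, ∀ b ∈ Icc 0 t,
        IntervalIntegrable (fun s => deriv τbar s * totalLength r s) volume a b :=
      fun a ha b hb => (intervalIntegrable_of_boundedVariationOn (hBV.boundedVariationOn ht0)
        ha hb).continuousOn_mul (hτ.continuous_deriv le_rfl).continuousOn
    have h0 : ∫ s in T₀..t, deriv τbar s * totalLength r s = 0 := by
      refine intervalIntegral.integral_zero_ae (ae_of_all _ fun s hs => ?_)
      rw [uIoc_of_le ht] at hs
      have h1 : τbar =ᶠ[𝓝 s] fun _ => τ₁ := by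
        filter_upwards [Ioi_mem_nhds ((le_max_left t₁ 0).trans_lt hs.1)] with u hu
        exact hτ₁ u (le_of_lt hu)
      rw [h1.deriv_eq, deriv_const, zero_mul]
    rw [hBV.macroWork_eq hτ ht0, stieltjesByParts, hτ₁ t ((le_max_left _ _).trans ht), hτ₀,
      hstart.totalLength_zero, ← intervalIntegral.integral_add_adjacent_intervals
        (hi 0 ⟨le_rfl, ht0⟩ T₀ ⟨hT0, ht⟩) (hi T₀ ⟨hT0, ht⟩ t ⟨ht0, le_rfl⟩), h0, add_zero]
  have hWlim : Tendsto (fun t => macroWork τbar r t) atTop (𝓝 W) := by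
    refine (((hlen.const_mul τ₁).sub_const _).sub_const _).congr' ?_
    filter_upwards [eventually_ge_atTop T₀] with t ht
    exact (hwork t ht).symm
  refine ⟨W, internalEnergy V β τ₁ - internalEnergy V β τ₀ - W, hWlim, ?_, by ring, ?_⟩
  · have h1 := ((hP.add hU).sub_const (internalEnergy V β τ₀)).sub hWlim
    rw [show (0 : ℝ) ^ 2 / 2 + internalEnergy V β τ₁ - internalEnergy V β τ₀ - W =
      internalEnergy V β τ₁ - internalEnergy V β τ₀ - W by ring] at h1
    refine h1.congr' ?_
    filter_upwards [eventually_ge_atTop T] with t ht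
    rw [macroHeat, intervalIntegral.integral_sub ((iP t ht).add (iU t ht))
      intervalIntegrable_const, intervalIntegral.integral_add (iP t ht) (iU t ht),
      intervalIntegral.integral_const, sub_zero, one_smul]
  -- The inequality at the finite time `T₀` is already the final one: the tension has its final
  -- value there, and the frozen integral is the one in `W`. The profile itself need not yet be at
  -- equilibrium.
  · have h1 := hvisc.clausius hV hτ (hτ₀ ▸ hstart) hBV hT0
    rw [hτ₁ T₀ (le_max_left _ _), hτ₀] at h1
    rw [hW]
    linarith

end AnharmonicChain

theorem theorem2
    -- the interaction, the temperature and the external tension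
    (V : ℝ → ℝ) (c₁ c₂ β τ₀ τ₁ t₁ : ℝ) (τbar : ℝ → ℝ)
    (hV : ContDiff ℝ 2 V) (hc₁ : 0 < c₁)
    (hV'' : ∀ r, c₁ ≤ deriv (deriv V) r ∧ deriv (deriv V) r ≤ c₂)
    (hβ : 0 < β)
    (hτ : ContDiff ℝ 1 τbar) (hτ₀ : τbar 0 = τ₀) (hτ₁ : ∀ t ≥ t₁, τbar t = τ₁)
    -- the strength of the noise and the size of the blocks
    (σ : ℕ → ℝ) (l : ℕ → ℕ) (hσ : ∀ N, 0 < σ N) (hl : ∀ N, 1 ≤ l N)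
    (hσ₁ : Tendsto (fun N : ℕ => σ N / N) atTop (𝓝 0))
    (hσ₂ : Tendsto (fun N : ℕ => (N : ℝ) / σ N ^ 2) atTop (𝓝 0))
    (hl₁ : Tendsto (fun N : ℕ => (l N : ℝ) / σ N) atTop (𝓝 0))
    (hl₂ : Tendsto (fun N : ℕ => (N : ℝ) * σ N / (l N : ℝ) ^ 3) atTop (𝓝 0))
    -- the chains
    {Ω : ℕ → Type*} [∀ N, MeasurableSpace (Ω N)]
    (P : ∀ N, Measure (Ω N)) [∀ N, IsProbabilityMeasure (P N)]
    (X : ∀ N, ℝ≥0 → Ω N → AnharmonicChain.Phase N)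
    (hX : ∀ N, AnharmonicChain.IsChain (P N) V β (σ N) τbar N (X N))
    -- a limit point of the random profiles
    (φ : ℕ → ℕ) {Ω' : Type*} [MeasurableSpace Ω'] (P' : Measure Ω') [IsProbabilityMeasure P']
    (r p : Ω' → ℝ → ℝ → ℝ)
    (hlim : AnharmonicChain.IsLimitProfile P X φ P' r p)
    -- convergence of the energy, and of the initial length to its equilibrium value
    (henergy : AnharmonicChain.EnergyConvergence P V β τ₀ l X φ P' r p)
    (hlength : Tendsto
      (fun k => ∫ ω, AnharmonicChain.meanLength (φ k) (X (φ k) 0 ω) ∂(P (φ k))) atTop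
      (𝓝 (AnharmonicChain.tensionInv V β τ₀)))
    -- assumptions on the limit profiles
    (hvisc : ∀ᵐ ω ∂P', AnharmonicChain.IsVanishingViscositySolution V β τbar (r ω) (p ω))
    (hstart : ∀ᵐ ω ∂P', AnharmonicChain.StartsAtEquilibrium V β τ₀ (r ω) (p ω))
    (hend : ∀ᵐ ω ∂P', AnharmonicChain.ReachesEquilibrium V β τ₁ (r ω) (p ω))
    (hBV : ∀ᵐ ω ∂P', AnharmonicChain.HasBVLength (r ω)) :
    -- microscopic balance of the mean energy
    (∀ N ≥ 1, ∀ t : ℝ≥0,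
      Integrable (fun ω => AnharmonicChain.energy V N (X N t ω)) (P N) ∧
      Integrable (fun ω => AnharmonicChain.microWork τbar N (fun s => X N s ω) t) (P N) ∧
      Integrable (fun ω => AnharmonicChain.microHeat V β (σ N) N (fun s => X N s ω) t) (P N) ∧
      (∫ ω, AnharmonicChain.energy V N (X N t ω) ∂(P N)) -
          (∫ ω, AnharmonicChain.energy V N (X N 0 ω) ∂(P N)) =
        (∫ ω, AnharmonicChain.microWork τbar N (fun s => X N s ω) t ∂(P N)) +
          ∫ ω, AnharmonicChain.microHeat V β (σ N) N (fun s => X N s ω) t ∂(P N)) ∧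
    -- the macroscopic work and heat have finite expectation and are the limits of the
    -- microscopic ones
    (∀ᵐ t ∂(volume.restrict (Ioi (0 : ℝ))),
      Integrable (fun ω => AnharmonicChain.macroWork τbar (r ω) t) P' ∧
      Integrable (fun ω => AnharmonicChain.macroHeat V β τ₀ τbar (r ω) (p ω) t) P') ∧
    (∀ ψ : ℝ → ℝ, Continuous ψ → HasCompactSupport ψ →
      Tendsto (fun k => ∫ t in Ioi (0 : ℝ), ψ t *
          ∫ ω, AnharmonicChain.microWork τbar (φ k) (fun s => X (φ k) s ω) t ∂(P (φ k)))
        atTop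
        (𝓝 (∫ t in Ioi (0 : ℝ), ψ t *
          ∫ ω, AnharmonicChain.macroWork τbar (r ω) t ∂P')) ∧
      Tendsto (fun k => ∫ t in Ioi (0 : ℝ), ψ t *
          ∫ ω, AnharmonicChain.microHeat V β (σ (φ k)) (φ k) (fun s => X (φ k) s ω) t
            ∂(P (φ k)))
        atTop
        (𝓝 (∫ t in Ioi (0 : ℝ), ψ t *
          ∫ ω, AnharmonicChain.macroHeat V β τ₀ τbar (r ω) (p ω) t ∂P'))) ∧
    -- the total work and heat exist and satisfy the first law and the Clausius inequality
    (∀ᵐ ω ∂P',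
      (∀ t ≥ 0, AnharmonicChain.HasRSIntegral τbar (AnharmonicChain.totalLength (r ω)) 0 t
        (AnharmonicChain.macroWork τbar (r ω) t)) ∧
      ∃ W Q : ℝ,
        Tendsto (fun t => AnharmonicChain.macroWork τbar (r ω) t) atTop (𝓝 W) ∧
        Tendsto (fun t => AnharmonicChain.macroHeat V β τ₀ τbar (r ω) (p ω) t) atTop (𝓝 Q) ∧
        AnharmonicChain.internalEnergy V β τ₁ - AnharmonicChain.internalEnergy V β τ₀ = W + Q ∧
        AnharmonicChain.freeEnergy V β (AnharmonicChain.tensionInv V β τ₁) -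
          AnharmonicChain.freeEnergy V β (AnharmonicChain.tensionInv V β τ₀) ≤ W) := by
  have hadm : AnharmonicChain.Admissible V c₁ c₂ β := ⟨hV, hc₁, hV'', hβ⟩
  refine ⟨fun N hN t => (hX N).energy_balance hadm hN hτ.continuous
    (henergy.integrable_initial N) t, ?_, fun ψ hψ hψc =>
      ⟨AnharmonicChain.tendsto_weak_work hadm hτ hX hlim henergy hlength hstart hBV hψ hψc,
        AnharmonicChain.tendsto_weak_heat hadm hτ hX hlim henergy hlength hstart hBV hψ hψc⟩, ?_⟩
  · filter_upwards [hlim.expectation_macroWork hτ hstart hBV,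
      hlim.expectation_macroHeat hadm hτ hstart hBV] with t h1 h2
    exact ⟨h1.1, h2.1⟩
  · filter_upwards [hvisc, hstart, hend, hBV] with ω h1 h2 h3 h4
    exact AnharmonicChain.thermodynamic_transformation hadm hτ hτ₀ hτ₁ h1 h2 h3 h4
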